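/- Let $\mathbb{K}$ be a field of arbitrary characteristic. Let $\Gamma_4$ be the group with generators $a,b,\nu$ and relations $ba=\nu ab$, $a\nu=\nu^{-1}a$, $b\nu=\nu b$, $\nu^4=1$. Let $G$ be a group and let $g,h,\epsilon\in G$ be such that $G=\langle g,h,\epsilon\rangle$, $\epsilon^2\neq 1$, and there is a group homomorphism $\Gamma_4\to G$ with $a\mapsto g$, $b\mapsto h$, $\nu\mapsto\epsilon$. For $x\in G$ let $G^x$ denote its centralizer; then $\epsilon,\epsilon^2,g^2\in G^h$ and $\epsilon^{-1}h^2\in G^g$. Let $\rho:G^h\to\mathbb{K}^\times$ and $\sigma:G^g\to\mathbb{K}^\times$ be characters (representations of degree one), and let $$V=M(h,\rho)=\mathbb{K}G\otimes_{\mathbb{K}G^h}\rho,\qquad W=M(g,\sigma)=\mathbb{K}G\otimes_{\mathbb{K}G^g}\sigma$$ be the associated Yetter-Drinfeld modules over $G$, where $y\otimes 1\in M(x,\chi)$ has degree $yxy^{-1}$. Let $\mathfrak{B}(V\oplus W)$ be the Nichols algebra of $V\oplus W$. For a homogeneous element $u\in V\oplus W$ of degree $x\in G$ and for $y\in\mathfrak{B}(V\oplus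 W)$ let $(\mathrm{ad}\,u)(y)=uy-(x\cdot y)u$. Let $(\mathrm{ad}\,V)^0(W)=W$ and, for $m\ge 0$, let $(\mathrm{ad}\,V)^{m+1}(W)$ be the span of all $(\mathrm{ad}\,v)(y)$ with $v\in V$ and $y\in(\mathrm{ad}\,V)^m(W)$; define $(\mathrm{ad}\,W)^m(V)$ likewise. A Yetter-Drinfeld module $X$ over $G$ is called absolutely simple if $\mathbb{L}\otimes_{\mathbb{K}}X$ is a simple Yetter-Drinfeld module for every field extension $\mathbb{L}$ of $\mathbb{K}$. Assume that $$\rho(h)=\sigma(g)=-1,\qquad \rho(\epsilon)=\rho(g^2)\,\sigma(\epsilon^{-1}h^2).$$ Then the following hold: 1. $(\mathrm{ad}\,V)(W)$ is absolutely simple and $(\mathrm{ad}\,V)^2(W)=0$. 2. The Yetter-Drinfeld modules $(\mathrm{ad}\,W)^m(V)$ are absolutely simple or zero for all $m\in\mathbb{N}_0$ if and only if $\rho(\epsilon^2)=-1$. In this case, $(\mathrm{ad}\,W)^2(V)\neq 0$ and $(\mathrm{ad}\,W)^3(V)=0$. -/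

import Mathlib

open scoped TensorProduct

universe u

/-! ### Yetter-Drinfeld modules over a group algebra -/

/-- A Yetter-Drinfeld module structure on the `K`-vector space `V` over the group `G`: a linear
action of `G` together with a coaction of the coalgebra `K G`, that is, a `G`-grading.  The
comodule `K G ⊗ V` is written as `G →₀ V`, so that `coact v x` is the component of degree `x`
of `v`.  The last axiom says `x · V_y ⊆ V_{x y x⁻¹}`. -/
@[ext]
structure YetterDrinfeld (K G V : Type*) [Field K] [Group G] [AddCommGroup V] [Module K V] where
  act : Representation K G V
  coact : V →ₗ[K] (G →₀ V)
  coact_coact : ∀ v x, coact (coact v x) = Finsupp.single x (coact v x)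
  sum_coact : ∀ v, ((coact v).sum fun _ w => w) = v
  coact_act : ∀ x v y, coact (act x v) (x * y * x⁻¹) = act x (coact v y)

namespace YetterDrinfeld

section Basic

variable {K G V W X : Type*} [Field K] [Group G] [AddCommGroup V] [Module K V]
  [AddCommGroup W] [Module K W] [AddCommGroup X] [Module K X]

/-- `v` is homogeneous of degree `x`, i.e. `v ∈ V_x`. -/
def IsHomogeneous (M : YetterDrinfeld K G V) (x : G) (v : V) : Prop :=
  M.coact v = Finsupp.single x v

theorem isHomogeneous_coact (M : YetterDrinfeld K G V) (v : V) (x : G) :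
    M.IsHomogeneous x (M.coact v x) := M.coact_coact v x

theorem span_homogeneous (M : YetterDrinfeld K G V) (v : V) :
    v ∈ Submodule.span K {w | ∃ x, M.IsHomogeneous x w} := by
  conv_rhs => rw [← M.sum_coact v]
  exact Submodule.sum_mem _ fun x _ => Submodule.subset_span ⟨x, M.isHomogeneous_coact v x⟩

theorem homogeneous_induction (M : YetterDrinfeld K G V) {P : V → Prop}
    (hom : ∀ x v, M.IsHomogeneous x v → P v) (zero : P 0)
    (add : ∀ v w, P v → P w → P (v + w)) (v : V) : P v := by
  rw [← M.sum_coact v]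
  exact Finset.sum_induction _ P add zero fun x _ => hom x _ (M.isHomogeneous_coact v x)

theorem IsHomogeneous.act {M : YetterDrinfeld K G V} {x : G} {v : V} (hv : M.IsHomogeneous x v)
    (y : G) : M.IsHomogeneous (y * x * y⁻¹) (M.act y v) := by
  classical
  unfold IsHomogeneous at *
  ext z
  obtain ⟨z, rfl⟩ : ∃ z', z = y * z' * y⁻¹ := ⟨y⁻¹ * z * y, by group⟩
  rw [M.coact_act, hv, Finsupp.single_apply, Finsupp.single_apply]
  by_cases h : x = z
  · simp [h]
  · have : ¬ (y * x * y⁻¹ = y * z * y⁻¹) := by simpa using h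
    rw [if_neg h, if_neg this, map_zero]

/-- An action and a coaction define a Yetter-Drinfeld module as soon as the vectors that behave
like homogeneous ones span the space. -/
def ofSpan (act : Representation K G V) (coact : V →ₗ[K] (G →₀ V))
    (h : Submodule.span K {v | ∃ x, ∀ y, coact (act y v) =
      Finsupp.single (y * x * y⁻¹) (act y v)} = ⊤) : YetterDrinfeld K G V where
  act := act
  coact := coact
  coact_coact v x := by
    classical
    have hv : v ∈ Submodule.span K {v | ∃ x, ∀ y, coact (act y v) =
      Finsupp.single (y * x * y⁻¹) (act y v)} := h ▸ Submodule.mem_top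
    induction hv using Submodule.span_induction with
    | mem v hv =>
      obtain ⟨z, hz⟩ := hv
      have hz := by simpa using hz 1
      rw [hz, Finsupp.single_apply]
      split_ifs with hzx
      · rw [hz, hzx]
      · simp
    | zero => simp
    | add v w _ _ hv hw => simp [hv, hw]
    | smul a v _ hv => simp [hv]
  sum_coact v := by
    classical
    have hv : v ∈ Submodule.span K {v | ∃ x, ∀ y, coact (act y v) =
      Finsupp.single (y * x * y⁻¹) (act y v)} := h ▸ Submodule.mem_top
    induction hv using Submodule.span_induction with
    | mem v hv =>
      obtain ⟨z, hz⟩ := hv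
      have hz := by simpa using hz 1
      rw [hz, Finsupp.sum_single_index rfl]
    | zero => simp
    | add v w _ _ hv hw => rw [map_add, Finsupp.sum_add_index' (by simp) (by simp), hv, hw]
    | smul a v _ hv => rw [map_smul, Finsupp.sum_smul_index' (by simp), ← Finsupp.smul_sum, hv]
  coact_act x v y := by
    classical
    have hv : v ∈ Submodule.span K {v | ∃ x, ∀ y, coact (act y v) =
      Finsupp.single (y * x * y⁻¹) (act y v)} := h ▸ Submodule.mem_top
    induction hv using Submodule.span_induction with
    | mem v hv =>
      obtain ⟨z, hz⟩ := hv
      have hz1 := by simpa using hz 1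
      rw [hz, hz1, Finsupp.single_apply, Finsupp.single_apply]
      by_cases h : z = y
      · simp [h]
      · have : ¬ (x * z * x⁻¹ = x * y * x⁻¹) := by simpa using h
        rw [if_neg h, if_neg this, map_zero]
    | zero => simp
    | add v w _ _ hv hw => simp [hv, hw]
    | smul a v _ hv => simp [hv]

/-- Morphisms of Yetter-Drinfeld modules. -/
def IsHom (M : YetterDrinfeld K G V) (N : YetterDrinfeld K G W) (f : V →ₗ[K] W) : Prop :=
  (∀ x v, f (M.act x v) = N.act x (f v)) ∧ ∀ x v, f (M.coact v x) = N.coact (f v) x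

theorem IsHom.isHomogeneous {M : YetterDrinfeld K G V} {N : YetterDrinfeld K G W} {f : V →ₗ[K] W}
    (hf : M.IsHom N f) {x : G} {v : V} (hv : M.IsHomogeneous x v) : N.IsHomogeneous x (f v) := by
  classical
  unfold IsHomogeneous at *
  ext y
  rw [← hf.2, hv, Finsupp.single_apply, Finsupp.single_apply]
  split_ifs <;> simp

theorem IsHom.of_homogeneous {M : YetterDrinfeld K G V} {N : YetterDrinfeld K G W} {f : V →ₗ[K] W}
    (h₁ : ∀ x v y, M.IsHomogeneous y v → f (M.act x v) = N.act x (f v))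
    (h₂ : ∀ x v, M.IsHomogeneous x v → N.IsHomogeneous x (f v)) : M.IsHom N f := by
  classical
  refine ⟨fun x v => ?_, fun x v => ?_⟩
  · refine M.homogeneous_induction (P := fun v => f (M.act x v) = N.act x (f v))
      (fun y v hv => h₁ x v y hv) (by simp) ?_ v
    intro v w hv hw
    simp [hv, hw]
  · refine M.homogeneous_induction (P := fun v => f (M.coact v x) = N.coact (f v) x)
      (fun y v hv => ?_) (by simp) ?_ v
    · rw [hv, h₂ _ _ hv, Finsupp.single_apply, Finsupp.single_apply]
      split_ifs <;> simp
    · intro v w hv hw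
      simp [hv, hw]

theorem IsHom.comp {M : YetterDrinfeld K G V} {N : YetterDrinfeld K G W} {P : YetterDrinfeld K G X}
    {f : V →ₗ[K] W} {f' : W →ₗ[K] X} (hf' : N.IsHom P f') (hf : M.IsHom N f) :
    M.IsHom P (f' ∘ₗ f) :=
  ⟨fun x v => by simp [hf.1, hf'.1], fun x v => by simp [hf.2, hf'.2]⟩

/-! ### Submodules, simplicity -/

/-- Yetter-Drinfeld submodules: subspaces stable under the action and the coaction. -/
def IsSub (M : YetterDrinfeld K G V) (N : Submodule K V) : Prop :=
  (∀ x, ∀ v ∈ N, M.act x v ∈ N) ∧ ∀ x, ∀ v ∈ N, M.coact v x ∈ N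

/-- The Yetter-Drinfeld module structure on a Yetter-Drinfeld submodule. -/
noncomputable def restrict (M : YetterDrinfeld K G V) (N : Submodule K V) (hN : M.IsSub N) :
    YetterDrinfeld K G N where
  act :=
    { toFun := fun x => (M.act x).restrict (hN.1 x)
      map_one' := by ext; simp
      map_mul' := fun x y => by ext; simp }
  coact :=
    { toFun := fun v =>
        { support := (M.coact v).support
          toFun := fun x => ⟨M.coact v x, hN.2 x v v.2⟩
          mem_support_toFun := fun x => by simp }
      map_add' := fun v w => by ext; simp
      map_smul' := fun a v => by ext; simp }
  coact_coact v x := by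
    classical
    ext y
    have := DFunLike.congr_fun (M.coact_coact v x) y
    rw [Finsupp.single_apply] at this ⊢
    change M.coact (M.coact v x) y = _
    rw [this]
    split_ifs <;> rfl
  sum_coact v := by
    ext
    conv_rhs => rw [← M.sum_coact v]
    simp [Finsupp.sum]
  coact_act x v y := by
    ext
    exact M.coact_act x v y

/-- A Yetter-Drinfeld module is simple if it is nonzero and has no Yetter-Drinfeld submodules
except zero and itself. -/
def IsSimple (M : YetterDrinfeld K G V) : Prop :=
  Nontrivial V ∧ ∀ N : Submodule K V, M.IsSub N → N = ⊥ ∨ N = ⊤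

open Classical in
/-- Extension of scalars: the Yetter-Drinfeld module `L ⊗ V` over `L G`. -/
noncomputable def baseChange (L : Type*) [Field L] [Algebra K L] (M : YetterDrinfeld K G V) :
    YetterDrinfeld L G (L ⊗[K] V) :=
  ofSpan
    { toFun := fun x => (M.act x).baseChange L
      map_one' := by ext; simp
      map_mul' := fun x y => by ext; simp }
    ((TensorProduct.finsuppRight K L L V G).toLinearMap ∘ₗ M.coact.baseChange L) (by
      rw [eq_top_iff]
      intro z _
      induction z using TensorProduct.induction_on with
      | zero => exact Submodule.zero_mem _
      | add a b ha hb => exact Submodule.add_mem _ (ha trivial) (hb trivial)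
      | tmul a v =>
        refine M.homogeneous_induction (P := fun v => a ⊗ₜ[K] v ∈ Submodule.span L _)
          (fun x v hv => ?_) (by simp) (fun v w hv hw => ?_) v
        · refine Submodule.subset_span ⟨x, fun y => ?_⟩
          have := hv.act y
          unfold IsHomogeneous at this
          simp [this]
        · rw [TensorProduct.tmul_add]
          exact Submodule.add_mem _ hv hw)

end Basic

/-- `M` is absolutely simple if `L ⊗ M` is simple for every field extension `L` of `K`.
(Extensions in the universe of `K` suffice: this universe contains the algebraic closure of `K`
and all finitely generated extensions.) -/
def IsAbsolutelySimple {K : Type u} {G V : Type*} [Field K] [Group G] [AddCommGroup V] [Module K V]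
    (M : YetterDrinfeld K G V) : Prop :=
  ∀ (L : Type u) [Field L] [Algebra K L], (M.baseChange L).IsSimple

/-- The subspace `N` of `M` is a Yetter-Drinfeld submodule, and as a Yetter-Drinfeld module it is
absolutely simple. -/
def IsAbsolutelySimpleSub {K : Type u} {G V : Type*} [Field K] [Group G] [AddCommGroup V]
    [Module K V] (M : YetterDrinfeld K G V) (N : Submodule K V) : Prop :=
  ∃ hN : M.IsSub N, (M.restrict N hN).IsAbsolutelySimple

/-! ### Direct sums, tensor products, the braiding -/

section Tensor

variable {K G V W X Y : Type*} [Field K] [Group G] [AddCommGroup V] [Module K V]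
  [AddCommGroup W] [Module K W] [AddCommGroup X] [Module K X] [AddCommGroup Y] [Module K Y]

/-- The direct sum of two Yetter-Drinfeld modules. -/
noncomputable def prod (M : YetterDrinfeld K G V) (N : YetterDrinfeld K G W) :
    YetterDrinfeld K G (V × W) :=
  ofSpan
    { toFun := fun x => (M.act x).prodMap (N.act x)
      map_one' := by ext <;> simp
      map_mul' := fun x y => by ext <;> simp }
    ((Finsupp.mapRange.linearMap (LinearMap.inl K V W) ∘ₗ M.coact).coprod
      (Finsupp.mapRange.linearMap (LinearMap.inr K V W) ∘ₗ N.coact)) (by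
      rw [eq_top_iff]
      rintro ⟨v, w⟩ _
      have : ((v, w) : V × W) = (v, 0) + (0, w) := by simp
      rw [this]
      refine Submodule.add_mem _ ?_ ?_
      · refine M.homogeneous_induction (P := fun v => ((v, 0) : V × W) ∈ Submodule.span K _)
          (fun x v hv => ?_) (Submodule.zero_mem _) (fun v w hv hw => ?_) v
        · refine Submodule.subset_span ⟨x, fun y => ?_⟩
          have := hv.act y
          unfold IsHomogeneous at this
          simp [this]
        · have : ((v + w, 0) : V × W) = (v, 0) + (w, 0) := by simp
          rw [this]
          exact Submodule.add_mem _ hv hw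
      · refine N.homogeneous_induction (P := fun w => ((0, w) : V × W) ∈ Submodule.span K _)
          (fun x v hv => ?_) (Submodule.zero_mem _) (fun v w hv hw => ?_) w
        · refine Submodule.subset_span ⟨x, fun y => ?_⟩
          have := hv.act y
          unfold IsHomogeneous at this
          simp [this]
        · have : ((0, v + w) : V × W) = (0, v) + (0, w) := by simp
          rw [this]
          exact Submodule.add_mem _ hv hw)

/-- The coaction of a tensor product: `V_x ⊗ W_y` has degree `x y`. -/
noncomputable def tensorCoact (M : YetterDrinfeld K G V) (N : YetterDrinfeld K G W) :
    V ⊗[K] W →ₗ[K] (G →₀ V ⊗[K] W) :=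
  TensorProduct.lift (LinearMap.mk₂ K
    (fun v w => (M.coact v).sum fun x v' => (N.coact w).sum fun y w' =>
      Finsupp.single (x * y) (v' ⊗ₜ[K] w'))
    (fun v₁ v₂ w => by
      rw [map_add, Finsupp.sum_add_index' (by simp)]
      intro x a b
      simp [TensorProduct.add_tmul, Finsupp.sum_add])
    (fun a v w => by
      rw [map_smul, Finsupp.sum_smul_index' (by simp), Finsupp.smul_sum]
      refine Finsupp.sum_congr fun x _ => ?_
      rw [Finsupp.smul_sum]
      refine Finsupp.sum_congr fun y _ => ?_
      rw [Finsupp.smul_single, TensorProduct.smul_tmul'])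
    (fun v w₁ w₂ => by
      rw [map_add, ← Finsupp.sum_add]
      refine Finsupp.sum_congr fun x _ => ?_
      rw [Finsupp.sum_add_index' (by simp)]
      intro x a b
      simp [TensorProduct.tmul_add])
    (fun a v w => by
      rw [map_smul, Finsupp.smul_sum]
      refine Finsupp.sum_congr fun x _ => ?_
      rw [Finsupp.sum_smul_index' (by simp), Finsupp.smul_sum]
      refine Finsupp.sum_congr fun y _ => ?_
      rw [Finsupp.smul_single, TensorProduct.tmul_smul]))

theorem tensorCoact_tmul {M : YetterDrinfeld K G V} {N : YetterDrinfeld K G W} {x y : G} {v : V}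
    {w : W} (hv : M.IsHomogeneous x v) (hw : N.IsHomogeneous y w) :
    tensorCoact M N (v ⊗ₜ w) = Finsupp.single (x * y) (v ⊗ₜ w) := by
  unfold IsHomogeneous at *
  simp [tensorCoact, hv, hw]

theorem tensor_induction (M : YetterDrinfeld K G V) (N : YetterDrinfeld K G W)
    {P : V ⊗[K] W → Prop}
    (hom : ∀ x y v w, M.IsHomogeneous x v → N.IsHomogeneous y w → P (v ⊗ₜ w)) (zero : P 0)
    (add : ∀ v w, P v → P w → P (v + w)) (z : V ⊗[K] W) : P z := by
  induction z using TensorProduct.induction_on with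
  | zero => exact zero
  | add a b ha hb => exact add a b ha hb
  | tmul v w =>
    refine M.homogeneous_induction (P := fun v => P (v ⊗ₜ w)) (fun x v hv => ?_)
      (by simpa using zero) (fun v v' h h' => by rw [TensorProduct.add_tmul]; exact add _ _ h h') v
    exact N.homogeneous_induction (P := fun w => P (v ⊗ₜ w)) (fun y w hw => hom x y v w hv hw)
      (by simpa using zero) (fun v v' h h' => by rw [TensorProduct.tmul_add]; exact add _ _ h h') w

/-- The tensor product of two Yetter-Drinfeld modules. -/
noncomputable def tensor (M : YetterDrinfeld K G V) (N : YetterDrinfeld K G W) :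
    YetterDrinfeld K G (V ⊗[K] W) :=
  ofSpan (M.act.tprod N.act) (tensorCoact M N) (by
    rw [eq_top_iff]
    intro z _
    refine M.tensor_induction N (fun x y v w hv hw => ?_) (Submodule.zero_mem _)
      (fun v w hv hw => Submodule.add_mem _ hv hw) z
    refine Submodule.subset_span ⟨x * y, fun a => ?_⟩
    rw [Representation.tprod_apply, TensorProduct.map_tmul, tensorCoact_tmul (hv.act a) (hw.act a)]
    congr 1
    group)

theorem tensor_act_tmul (M : YetterDrinfeld K G V) (N : YetterDrinfeld K G W) (x : G) (v : V)
    (w : W) : (M.tensor N).act x (v ⊗ₜ w) = M.act x v ⊗ₜ N.act x w := rfl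

theorem IsHomogeneous.tmul {M : YetterDrinfeld K G V} {N : YetterDrinfeld K G W} {x y : G} {v : V}
    {w : W} (hv : M.IsHomogeneous x v) (hw : N.IsHomogeneous y w) :
    (M.tensor N).IsHomogeneous (x * y) (v ⊗ₜ w) := tensorCoact_tmul hv hw

theorem IsHom.of_tensor {M : YetterDrinfeld K G V} {N : YetterDrinfeld K G W}
    {P : YetterDrinfeld K G X} {f : V ⊗[K] W →ₗ[K] X}
    (h₁ : ∀ a x y v w, M.IsHomogeneous x v → N.IsHomogeneous y w →
      f (M.act a v ⊗ₜ N.act a w) = P.act a (f (v ⊗ₜ w)))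
    (h₂ : ∀ x y v w, M.IsHomogeneous x v → N.IsHomogeneous y w →
      P.IsHomogeneous (x * y) (f (v ⊗ₜ w))) : (M.tensor N).IsHom P f := by
  classical
  refine ⟨fun a z => ?_, fun a z => ?_⟩
  · refine M.tensor_induction N
      (P := fun z => f ((M.tensor N).act a z) = P.act a (f z))
      (fun x y v w hv hw => h₁ a x y v w hv hw) (by simp) ?_ z
    intro v w hv hw
    simp only [map_add, hv, hw]
  · refine M.tensor_induction N
      (P := fun z => f ((M.tensor N).coact z a) = P.coact (f z) a)
      (fun x y v w hv hw => ?_) (by simp) ?_ z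
    · rw [hv.tmul hw, h₂ x y v w hv hw, Finsupp.single_apply, Finsupp.single_apply]
      split_ifs <;> simp
    · intro v w hv hw
      simp only [map_add, Finsupp.add_apply, hv, hw]

theorem IsHom.lTensor {N : YetterDrinfeld K G W} {P : YetterDrinfeld K G X} {f : W →ₗ[K] X}
    (hf : N.IsHom P f) (M : YetterDrinfeld K G V) :
    (M.tensor N).IsHom (M.tensor P) (f.lTensor V) := by
  refine IsHom.of_tensor (fun a x y v w hv hw => ?_) (fun x y v w hv hw => ?_)
  · simp [tensor_act_tmul, hf.1]
  · simpa using hv.tmul (hf.isHomogeneous hw)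

/-- The braiding `c_{V,W} : V ⊗ W → W ⊗ V`, `c (v ⊗ w) = x w ⊗ v` for `v ∈ V_x`. -/
noncomputable def braiding (M : YetterDrinfeld K G V) (N : YetterDrinfeld K G W) :
    V ⊗[K] W →ₗ[K] W ⊗[K] V :=
  TensorProduct.lift
    (Finsupp.lsum K (fun x => (TensorProduct.mk K W V).flip.compl₂ (N.act x)) ∘ₗ M.coact)

theorem braiding_tmul {M : YetterDrinfeld K G V} {x : G} {v : V} (hv : M.IsHomogeneous x v)
    (N : YetterDrinfeld K G W) (w : W) : M.braiding N (v ⊗ₜ w) = N.act x w ⊗ₜ v := by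
  unfold IsHomogeneous at hv
  simp [braiding, hv]

end Tensor

/-! ### The tensor algebra of a Yetter-Drinfeld module -/

section TensorAlgebra

variable {K G U : Type*} [Field K] [Group G] [AddCommGroup U] [Module K U]

/-- The group acts on the tensor algebra by algebra automorphisms. -/
noncomputable def algAct (M : YetterDrinfeld K G U) (x : G) :
    TensorAlgebra K U →ₐ[K] TensorAlgebra K U :=
  TensorAlgebra.lift K (TensorAlgebra.ι K ∘ₗ M.act x)

/-- The coaction of the tensor algebra, an algebra map. -/
noncomputable def algCoact (M : YetterDrinfeld K G U) :
    TensorAlgebra K U →ₐ[K] MonoidAlgebra (TensorAlgebra K U) G :=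
  TensorAlgebra.lift K ((MonoidAlgebra.coeffLinearEquiv K).symm.toLinearMap ∘ₗ
    Finsupp.mapRange.linearMap (TensorAlgebra.ι K) ∘ₗ M.coact)

theorem algAct_ι (M : YetterDrinfeld K G U) (x : G) (v : U) :
    M.algAct x (TensorAlgebra.ι K v) = TensorAlgebra.ι K (M.act x v) := by
  simp [algAct]

theorem algCoact_ι {M : YetterDrinfeld K G U} {x : G} {v : U} (hv : M.IsHomogeneous x v) :
    M.algCoact (TensorAlgebra.ι K v) = MonoidAlgebra.single x (TensorAlgebra.ι K v) := by
  unfold IsHomogeneous at hv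
  ext y
  simp [algCoact, hv]

/-- The tensor algebra is spanned by the products of homogeneous vectors. -/
theorem tensorAlgebra_induction (M : YetterDrinfeld K G U) {P : TensorAlgebra K U → Prop}
    (one : P 1) (mul : ∀ x v t, M.IsHomogeneous x v → P t → P (TensorAlgebra.ι K v * t)) :
    Submodule.span K {t | P t} = ⊤ := by
  have key : ∀ a t, t ∈ Submodule.span K {t | P t} → a * t ∈ Submodule.span K {t | P t} := by
    intro a
    induction a using TensorAlgebra.induction with
    | algebraMap r =>
      intro t ht
      rw [← Algebra.smul_def]
      exact Submodule.smul_mem _ _ ht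
    | ι v =>
      intro t ht
      induction ht using Submodule.span_induction with
      | mem t ht =>
        refine M.homogeneous_induction
          (P := fun v => TensorAlgebra.ι K v * t ∈ Submodule.span K {t | P t})
          (fun x v hv => Submodule.subset_span (mul x v t hv ht)) (by simp) ?_ v
        intro v w hv hw
        rw [map_add, add_mul]
        exact Submodule.add_mem _ hv hw
      | zero => simp
      | add v w _ _ hv hw => rw [mul_add]; exact Submodule.add_mem _ hv hw
      | smul a v _ hv => rw [mul_smul_comm]; exact Submodule.smul_mem _ _ hv
    | mul a b ha hb => intro t ht; rw [mul_assoc]; exact ha _ (hb _ ht)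
    | add a b ha hb => intro t ht; rw [add_mul]; exact Submodule.add_mem _ (ha _ ht) (hb _ ht)
  rw [eq_top_iff]
  intro t _
  simpa using key t 1 (Submodule.subset_span one)

/-- The tensor algebra `T(U)` as a Yetter-Drinfeld module. -/
noncomputable def tensorAlgebra (M : YetterDrinfeld K G U) :
    YetterDrinfeld K G (TensorAlgebra K U) :=
  ofSpan
    { toFun := fun x => (M.algAct x).toLinearMap
      map_one' := by
        have : M.algAct 1 = AlgHom.id K _ := by ext v; simp [algAct]
        rw [this]; rfl
      map_mul' := fun x y => by
        have : M.algAct (x * y) = (M.algAct x).comp (M.algAct y) := by ext v; simp [algAct]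
        rw [this]; rfl }
    ((MonoidAlgebra.coeffLinearEquiv K).toLinearMap ∘ₗ M.algCoact.toLinearMap) (by
      have := M.tensorAlgebra_induction (P := fun t => ∃ x, ∀ y, M.algCoact (M.algAct y t) =
        MonoidAlgebra.single (y * x * y⁻¹) (M.algAct y t))
        ⟨1, fun y => by simp [MonoidAlgebra.one_def]⟩ (by
          rintro x v t hv ⟨z, hz⟩
          refine ⟨x * z, fun y => ?_⟩
          rw [map_mul, map_mul, algAct_ι, algCoact_ι (hv.act y), hz, MonoidAlgebra.single_mul_single]
          congr 1
          group)
      rw [eq_top_iff, ← this]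
      refine Submodule.span_mono ?_
      rintro t ⟨x, hx⟩
      refine ⟨x, fun y => ?_⟩
      have := congrArg (MonoidAlgebra.coeffLinearEquiv K) (hx y)
      exact this)

theorem tensorAlgebra_act (M : YetterDrinfeld K G U) (x : G) (t : TensorAlgebra K U) :
    M.tensorAlgebra.act x t = M.algAct x t := rfl

theorem tensorAlgebra_coact (M : YetterDrinfeld K G U) (t : TensorAlgebra K U) :
    M.tensorAlgebra.coact t = (M.algCoact t).coeff := rfl

theorem isHomogeneous_tensorAlgebra_iff {M : YetterDrinfeld K G U} {x : G}
    {t : TensorAlgebra K U} :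
    M.tensorAlgebra.IsHomogeneous x t ↔ M.algCoact t = MonoidAlgebra.single x t :=
  ⟨fun h => by apply (MonoidAlgebra.coeffLinearEquiv K).injective; exact h, fun h => by
    have := congrArg (MonoidAlgebra.coeffLinearEquiv K) h
    exact this⟩

theorem isHomogeneous_one (M : YetterDrinfeld K G U) : M.tensorAlgebra.IsHomogeneous 1 1 := by
  rw [isHomogeneous_tensorAlgebra_iff]; simp [MonoidAlgebra.one_def]

theorem IsHomogeneous.ι {M : YetterDrinfeld K G U} {x : G} {v : U} (hv : M.IsHomogeneous x v) :
    M.tensorAlgebra.IsHomogeneous x (TensorAlgebra.ι K v) := by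
  rw [isHomogeneous_tensorAlgebra_iff, algCoact_ι hv]

theorem IsHomogeneous.mul {M : YetterDrinfeld K G U} {x y : G} {s t : TensorAlgebra K U}
    (hs : M.tensorAlgebra.IsHomogeneous x s) (ht : M.tensorAlgebra.IsHomogeneous y t) :
    M.tensorAlgebra.IsHomogeneous (x * y) (s * t) := by
  rw [isHomogeneous_tensorAlgebra_iff] at *
  rw [map_mul, hs, ht, MonoidAlgebra.single_mul_single]

/-! ### Quantum symmetrizers and the Nichols algebra -/

/-- For an endomorphism `b` of `U ⊗ U`, the map `b ⊗ id` on `U ⊗ (U ⊗ T(U))`. -/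
noncomputable def onFirst (b : U ⊗[K] U →ₗ[K] U ⊗[K] U) :
    U ⊗[K] (U ⊗[K] TensorAlgebra K U) →ₗ[K] U ⊗[K] (U ⊗[K] TensorAlgebra K U) :=
  (TensorProduct.assoc K U U (TensorAlgebra K U)).toLinearMap ∘ₗ
    b.rTensor (TensorAlgebra K U) ∘ₗ (TensorProduct.assoc K U U (TensorAlgebra K U)).symm.toLinearMap

/-- Multiplication `U ⊗ T(U) → T(U)`. -/
noncomputable def mulLeft (K U : Type*) [Field K] [AddCommGroup U] [Module K U] :
    U ⊗[K] TensorAlgebra K U →ₗ[K] TensorAlgebra K U :=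
  TensorProduct.lift (LinearMap.mul K (TensorAlgebra K U) ∘ₗ TensorAlgebra.ι K)

/-- Auxiliary: left multiplication by `u ∈ U` on pairs `(t, Δ t)`, see `shuffle`. -/
noncomputable def shuffleAux (b : U ⊗[K] U →ₗ[K] U ⊗[K] U) :
    U →ₗ[K] Module.End K (TensorAlgebra K U × (U ⊗[K] TensorAlgebra K U)) :=
  LinearMap.mk₂ K (fun u p => (TensorAlgebra.ι K u * p.1,
      u ⊗ₜ p.1 + (mulLeft K U).lTensor U (onFirst b (u ⊗ₜ p.2))))
    (fun u u' p => by
      simp only [map_add, add_mul, TensorProduct.add_tmul, Prod.mk_add_mk]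
      congr 1; abel)
    (fun a u p => by
      simp only [map_smul, smul_mul_assoc, ← TensorProduct.smul_tmul', Prod.smul_mk, smul_add])
    (fun u p q => by
      simp only [Prod.fst_add, Prod.snd_add, map_add, mul_add, TensorProduct.tmul_add,
        Prod.mk_add_mk]
      congr 1; abel)
    (fun a u p => by
      simp only [Prod.smul_fst, Prod.smul_snd, map_smul, mul_smul_comm, TensorProduct.tmul_smul,
        Prod.smul_mk, smul_add])

/-- For an endomorphism `b` of `U ⊗ U`, the linear map `T(U) → U ⊗ T(U)` given on `U^{⊗ n}`
by `∑_{1 ≤ k ≤ n} b₁ b₂ ⋯ b_{k-1} : U^{⊗ n} → U^{⊗ n} = U ⊗ U^{⊗ (n-1)}`, where `b_i` is `b`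
acting on the tensor factors `i` and `i + 1`.  It is determined by `shuffle_one` and
`shuffle_ι_mul`. -/
noncomputable def shuffle (b : U ⊗[K] U →ₗ[K] U ⊗[K] U) :
    TensorAlgebra K U →ₗ[K] U ⊗[K] TensorAlgebra K U :=
  LinearMap.snd K _ _ ∘ₗ
    (LinearMap.applyₗ ((1, 0) : TensorAlgebra K U × (U ⊗[K] TensorAlgebra K U))) ∘ₗ
    (TensorAlgebra.lift K (shuffleAux b)).toLinearMap

theorem shuffle_one (b : U ⊗[K] U →ₗ[K] U ⊗[K] U) : shuffle b 1 = 0 := by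
  simp [shuffle]

theorem shuffle_ι_mul (b : U ⊗[K] U →ₗ[K] U ⊗[K] U) (u : U) (t : TensorAlgebra K U) :
    shuffle b (TensorAlgebra.ι K u * t) =
      u ⊗ₜ t + (mulLeft K U).lTensor U (onFirst b (u ⊗ₜ shuffle b t)) := by
  have key : ∀ s : TensorAlgebra K U, ∀ p,
      (TensorAlgebra.lift K (shuffleAux b) s p).1 = s * p.1 := by
    intro s
    induction s using TensorAlgebra.induction with
    | algebraMap r => intro p; simp [Algebra.smul_def]
    | ι v => intro p; simp [shuffleAux]
    | mul a c ha hc => intro p; simp [ha, hc, mul_assoc]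
    | add a c ha hc => intro p; simp [ha, hc, add_mul]
  have h := key t (1, 0)
  simp only [mul_one] at h
  simp only [shuffle, LinearMap.comp_apply, AlgHom.toLinearMap_apply, map_mul,
    TensorAlgebra.lift_ι_apply, LinearMap.applyₗ_apply_apply, Module.End.mul_apply]
  change u ⊗ₜ[K] (TensorAlgebra.lift K (shuffleAux b) t (1, 0)).1 + (mulLeft K U).lTensor U
    (onFirst b (u ⊗ₜ (TensorAlgebra.lift K (shuffleAux b) t (1, 0)).2)) = _
  rw [h]
  rfl

/-- The quantum symmetrizers.  The restriction of `symmetrizer M n` to `U^{⊗ n}` is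
`S_n = (id ⊗ S_{n-1}) (id + c₁ + c₁ c₂ + ⋯ + c₁ c₂ ⋯ c_{n-1})`, which is the sum over all
permutations `w` of `n` letters of the lift of `w` to the braid group, where the braid group acts
through the braiding `c = c_{U,U}`; the other tensor powers are mapped to zero. -/
noncomputable def symmetrizer (M : YetterDrinfeld K G U) :
    ℕ → TensorAlgebra K U →ₗ[K] TensorAlgebra K U
  | 0 => Algebra.linearMap K (TensorAlgebra K U) ∘ₗ TensorAlgebra.algebraMapInv.toLinearMap
  | n + 1 => mulLeft K U ∘ₗ (symmetrizer M n).lTensor U ∘ₗ shuffle (M.braiding M)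

/-! The following facts show that the kernels of the quantum symmetrizers form an ideal of `T(U)`
which is also a Yetter-Drinfeld submodule. -/

theorem mulLeft_tmul (u : U) (t : TensorAlgebra K U) :
    mulLeft K U (u ⊗ₜ t) = TensorAlgebra.ι K u * t := by simp [mulLeft]

theorem mulLeft_injective : Function.Injective (mulLeft K U) := by
  have : Function.LeftInverse (shuffle (0 : U ⊗[K] U →ₗ[K] U ⊗[K] U)) (mulLeft K U) := by
    intro z
    induction z using TensorProduct.induction_on with
    | zero => simp
    | add a b ha hb => rw [map_add, map_add, ha, hb]
    | tmul u t => rw [mulLeft_tmul, shuffle_ι_mul]; simp [onFirst]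
  exact this.injective

theorem isHom_mulLeft (M : YetterDrinfeld K G U) :
    (M.tensor M.tensorAlgebra).IsHom M.tensorAlgebra (mulLeft K U) := by
  refine IsHom.of_tensor (fun a x y v w hv hw => ?_) (fun x y v w hv hw => ?_)
  · simp [mulLeft_tmul, tensorAlgebra_act, algAct_ι]
  · rw [mulLeft_tmul]
    exact hv.ι.mul hw

/-- `b ⊗ id` followed by the multiplication of the last two factors, for the braiding `b`. -/
theorem push_tmul {M : YetterDrinfeld K G U} {x : G} {u : U} (hu : M.IsHomogeneous x u) (v : U)
    (t : TensorAlgebra K U) :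
    (mulLeft K U).lTensor U (onFirst (M.braiding M) (u ⊗ₜ (v ⊗ₜ t))) =
      M.act x v ⊗ₜ (TensorAlgebra.ι K u * t) := by
  simp [onFirst, braiding_tmul hu, mulLeft_tmul]

theorem isHom_push (M : YetterDrinfeld K G U) :
    (M.tensor (M.tensor M.tensorAlgebra)).IsHom (M.tensor M.tensorAlgebra)
      ((mulLeft K U).lTensor U ∘ₗ onFirst (M.braiding M)) := by
  refine IsHom.of_tensor (fun a x y u z hu hz => ?_) (fun x y u z hu hz => ?_)
  · clear hz
    induction z using TensorProduct.induction_on with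
    | zero => simp
    | add z z' h h' => simp only [map_add, TensorProduct.tmul_add, h, h']
    | tmul v t =>
      simp only [tensor_act_tmul, LinearMap.comp_apply]
      rw [push_tmul hu, push_tmul (hu.act a), tensor_act_tmul, tensorAlgebra_act,
        tensorAlgebra_act, map_mul (M.algAct a), algAct_ι, ← Module.End.mul_apply,
        ← Module.End.mul_apply, ← map_mul, ← map_mul]
      congr 3
      group
  · classical
    have key : ∀ z : U ⊗[K] TensorAlgebra K U, ∀ y,
        (M.tensor M.tensorAlgebra).coact
          (((mulLeft K U).lTensor U ∘ₗ onFirst (M.braiding M)) (u ⊗ₜ z)) (x * y) =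
        ((mulLeft K U).lTensor U ∘ₗ onFirst (M.braiding M))
          (u ⊗ₜ ((M.tensor M.tensorAlgebra).coact z y)) := by
      intro z y
      refine M.tensor_induction M.tensorAlgebra
        (P := fun z => (M.tensor M.tensorAlgebra).coact
          (((mulLeft K U).lTensor U ∘ₗ onFirst (M.braiding M)) (u ⊗ₜ z)) (x * y) =
        ((mulLeft K U).lTensor U ∘ₗ onFirst (M.braiding M))
          (u ⊗ₜ ((M.tensor M.tensorAlgebra).coact z y)))
        (fun a b v t hv ht => ?_) (by simp)
        (fun z z' h h' => by simp only [map_add, TensorProduct.tmul_add, Finsupp.add_apply, h, h']) z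
      simp only [LinearMap.comp_apply]
      rw [push_tmul hu, (hv.act x).tmul (hu.ι.mul ht), hv.tmul ht, Finsupp.single_apply,
        Finsupp.single_apply]
      have : x * a * x⁻¹ * (x * b) = x * (a * b) := by group
      rw [this, mul_right_inj]
      split_ifs
      · rw [push_tmul hu]
      · simp
    unfold IsHomogeneous
    ext w
    obtain ⟨w, rfl⟩ : ∃ w', w = x * w' := ⟨x⁻¹ * w, by group⟩
    rw [key, hz, Finsupp.single_apply, Finsupp.single_apply, mul_right_inj]
    split_ifs <;> simp

theorem isHom_shuffle (M : YetterDrinfeld K G U) :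
    M.tensorAlgebra.IsHom (M.tensor M.tensorAlgebra) (shuffle (M.braiding M)) := by
  classical
  have := M.tensorAlgebra_induction (P := fun t =>
    (∀ x, shuffle (M.braiding M) (M.tensorAlgebra.act x t) =
      (M.tensor M.tensorAlgebra).act x (shuffle (M.braiding M) t)) ∧
    ∃ y, M.tensorAlgebra.IsHomogeneous y t ∧
      (M.tensor M.tensorAlgebra).IsHomogeneous y (shuffle (M.braiding M) t))
    ⟨fun x => by simp [tensorAlgebra_act, shuffle_one], 1, M.isHomogeneous_one, by
      simp [shuffle_one, IsHomogeneous]⟩ (by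
      rintro x u t hu ⟨h₁, y, hy, hy'⟩
      refine ⟨fun a => ?_, x * y, hu.ι.mul hy, ?_⟩
      · have h := M.isHom_push.1 a (u ⊗ₜ shuffle (M.braiding M) t)
        simp only [LinearMap.comp_apply, tensor_act_tmul] at h
        rw [tensorAlgebra_act, map_mul, algAct_ι, ← tensorAlgebra_act, shuffle_ι_mul,
          shuffle_ι_mul, map_add, h₁, h, tensor_act_tmul]
      · have h := M.isHom_push.isHomogeneous (hu.tmul hy')
        simp only [LinearMap.comp_apply] at h
        have h' := hu.tmul hy
        unfold IsHomogeneous at *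
        rw [shuffle_ι_mul, map_add, h, h', Finsupp.single_add])
  have mem : ∀ t : TensorAlgebra K U, t ∈ Submodule.span K _ := fun t => this ▸ Submodule.mem_top
  refine ⟨fun x t => ?_, fun x t => ?_⟩
  · induction mem t using Submodule.span_induction with
    | mem t ht => exact ht.1 x
    | zero => simp
    | add s t _ _ hs ht => simp only [map_add, hs, ht]
    | smul a t _ ht => simp only [map_smul, ht]
  · induction mem t using Submodule.span_induction with
    | mem t ht =>
      obtain ⟨_, y, hy, hy'⟩ := ht
      rw [hy, hy', Finsupp.single_apply, Finsupp.single_apply]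
      split_ifs <;> simp
    | zero => simp
    | add s t _ _ hs ht => simp only [map_add, hs, ht, Finsupp.add_apply]
    | smul a t _ ht => simp only [map_smul, ht, Finsupp.smul_apply]

theorem symmetrizer_zero_ι_mul (M : YetterDrinfeld K G U) (u : U) (t : TensorAlgebra K U) :
    M.symmetrizer 0 (TensorAlgebra.ι K u * t) = 0 := by
  simp [symmetrizer, TensorAlgebra.algebraMapInv]

theorem symmetrizer_zero_mul_ι (M : YetterDrinfeld K G U) (u : U) (t : TensorAlgebra K U) :
    M.symmetrizer 0 (t * TensorAlgebra.ι K u) = 0 := by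
  simp [symmetrizer, TensorAlgebra.algebraMapInv]

theorem isHom_symmetrizer (M : YetterDrinfeld K G U) (n : ℕ) :
    M.tensorAlgebra.IsHom M.tensorAlgebra (M.symmetrizer n) := by
  classical
  induction n with
  | succ n ih => exact M.isHom_mulLeft.comp ((ih.lTensor M).comp M.isHom_shuffle)
  | zero =>
    have := M.tensorAlgebra_induction (P := fun t =>
      (∀ x, M.symmetrizer 0 (M.tensorAlgebra.act x t) =
        M.tensorAlgebra.act x (M.symmetrizer 0 t)) ∧
      ∃ y, M.tensorAlgebra.IsHomogeneous y t ∧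
        M.tensorAlgebra.IsHomogeneous y (M.symmetrizer 0 t))
      ⟨fun x => by simp [tensorAlgebra_act, symmetrizer], 1, M.isHomogeneous_one, by
        simpa [symmetrizer] using M.isHomogeneous_one⟩ (by
        rintro x u t hu ⟨h₁, y, hy, hy'⟩
        refine ⟨fun a => ?_, x * y, hu.ι.mul hy, ?_⟩
        · rw [tensorAlgebra_act, map_mul, algAct_ι, symmetrizer_zero_ι_mul,
            symmetrizer_zero_ι_mul, map_zero]
        · rw [symmetrizer_zero_ι_mul]
          simp [IsHomogeneous])
    have mem : ∀ t : TensorAlgebra K U, t ∈ Submodule.span K _ := fun t => this ▸ Submodule.mem_top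
    refine ⟨fun x t => ?_, fun x t => ?_⟩
    · induction mem t using Submodule.span_induction with
      | mem t ht => exact ht.1 x
      | zero => simp
      | add s t _ _ hs ht => simp only [map_add, hs, ht]
      | smul a t _ ht => simp only [map_smul, ht]
    · induction mem t using Submodule.span_induction with
      | mem t ht =>
        obtain ⟨_, y, hy, hy'⟩ := ht
        rw [hy, hy', Finsupp.single_apply, Finsupp.single_apply]
        split_ifs <;> simp
      | zero => simp
      | add s t _ _ hs ht => simp only [map_add, hs, ht, Finsupp.add_apply]
      | smul a t _ ht => simp only [map_smul, ht, Finsupp.smul_apply]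

theorem mem_of_symmetrizer_succ {M : YetterDrinfeld K G U} {n : ℕ} {t : TensorAlgebra K U}
    (ht : M.symmetrizer (n + 1) t = 0) : shuffle (M.braiding M) t ∈
      LinearMap.range ((LinearMap.ker (M.symmetrizer n)).subtype.lTensor U) := by
  have h : (M.symmetrizer n).lTensor U (shuffle (M.braiding M) t) = 0 := by
    apply mulLeft_injective
    rw [map_zero]
    exact ht
  have hex := Module.Flat.lTensor_exact U
    (LinearMap.exact_subtype_ker_map (M.symmetrizer n))
  exact (hex _).1 h

theorem lTensor_push_eq_zero {M : YetterDrinfeld K G U}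
    {f : TensorAlgebra K U →ₗ[K] TensorAlgebra K U} {N : Submodule K (TensorAlgebra K U)}
    (hf : ∀ u, ∀ s ∈ N, f (TensorAlgebra.ι K u * s) = 0) (u : U)
    {z : U ⊗[K] TensorAlgebra K U} (hz : z ∈ LinearMap.range (N.subtype.lTensor U)) :
    f.lTensor U ((mulLeft K U).lTensor U (onFirst (M.braiding M) (u ⊗ₜ z))) = 0 := by
  obtain ⟨z, rfl⟩ := hz
  induction z using TensorProduct.induction_on with
  | zero => simp
  | add z z' h h' => simp only [map_add, TensorProduct.tmul_add, h, h', add_zero]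
  | tmul v s =>
    refine M.homogeneous_induction (P := fun u => f.lTensor U ((mulLeft K U).lTensor U
      (onFirst (M.braiding M) (u ⊗ₜ (N.subtype.lTensor U (v ⊗ₜ s))))) = 0)
      (fun x u hu => ?_) (by simp) (fun u u' h h' => by
        simp only [map_add, TensorProduct.add_tmul, h, h', add_zero]) u
    rw [LinearMap.lTensor_tmul, push_tmul hu, LinearMap.lTensor_tmul]
    rw [Submodule.subtype_apply, hf u s s.2, TensorProduct.tmul_zero]

theorem symmetrizer_ι_mul {M : YetterDrinfeld K G U} (n : ℕ) (u : U) (t : TensorAlgebra K U)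
    (ht : M.symmetrizer n t = 0) : M.symmetrizer (n + 1) (TensorAlgebra.ι K u * t) = 0 := by
  induction n generalizing u t with
  | zero =>
    rw [symmetrizer, LinearMap.comp_apply, LinearMap.comp_apply, shuffle_ι_mul, map_add,
      LinearMap.lTensor_tmul, ht, TensorProduct.tmul_zero, zero_add,
      lTensor_push_eq_zero (N := ⊤) (fun u s _ => M.symmetrizer_zero_ι_mul u s), map_zero]
    exact LinearMap.lTensor_surjective U (fun s => ⟨⟨s, trivial⟩, rfl⟩) _
  | succ n ih =>
    rw [symmetrizer, LinearMap.comp_apply, LinearMap.comp_apply, shuffle_ι_mul, map_add,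
      LinearMap.lTensor_tmul, ht, TensorProduct.tmul_zero, zero_add,
      lTensor_push_eq_zero ih u (mem_of_symmetrizer_succ ht), map_zero]

theorem shuffle_mul_ι (M : YetterDrinfeld K G U) (t : TensorAlgebra K U) (v : U) :
    shuffle (M.braiding M) (t * TensorAlgebra.ι K v) =
      (LinearMap.mulRight K (TensorAlgebra.ι K v)).lTensor U (shuffle (M.braiding M) t) +
        M.tensorAlgebra.braiding M (t ⊗ₜ v) := by
  have := M.tensorAlgebra_induction (P := fun t =>
    (∃ y, M.tensorAlgebra.IsHomogeneous y t) ∧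
    shuffle (M.braiding M) (t * TensorAlgebra.ι K v) =
      (LinearMap.mulRight K (TensorAlgebra.ι K v)).lTensor U (shuffle (M.braiding M) t) +
        M.tensorAlgebra.braiding M (t ⊗ₜ v))
    ⟨⟨1, M.isHomogeneous_one⟩, by
      have h := shuffle_ι_mul (M.braiding M) v 1
      rw [mul_one] at h
      rw [one_mul, h, shuffle_one, braiding_tmul M.isHomogeneous_one]
      simp⟩ (by
    rintro x u t hu ⟨⟨y, hy⟩, ht⟩
    refine ⟨⟨x * y, hu.ι.mul hy⟩, ?_⟩
    have comm : ∀ z : U ⊗[K] TensorAlgebra K U,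
        (mulLeft K U).lTensor U (onFirst (M.braiding M)
          (u ⊗ₜ (LinearMap.mulRight K (TensorAlgebra.ι K v)).lTensor U z)) =
        (LinearMap.mulRight K (TensorAlgebra.ι K v)).lTensor U
          ((mulLeft K U).lTensor U (onFirst (M.braiding M) (u ⊗ₜ z))) := by
      intro z
      induction z using TensorProduct.induction_on with
      | zero => simp
      | add z z' h h' => simp only [map_add, TensorProduct.tmul_add, h, h']
      | tmul w s =>
        rw [LinearMap.lTensor_tmul, push_tmul hu, push_tmul hu, LinearMap.lTensor_tmul]
        simp [mul_assoc]
    rw [mul_assoc, shuffle_ι_mul, shuffle_ι_mul, ht, TensorProduct.tmul_add, map_add, map_add,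
      comm, braiding_tmul hy, push_tmul hu, braiding_tmul (hu.ι.mul hy), map_add,
      LinearMap.lTensor_tmul, ← Module.End.mul_apply, ← map_mul, add_assoc]
    rfl)
  have ht : t ∈ Submodule.span K _ := this ▸ Submodule.mem_top
  induction ht using Submodule.span_induction with
  | mem t ht => exact ht.2
  | zero => simp
  | add s t _ _ hs ht =>
    rw [add_mul, map_add, hs, ht, map_add, TensorProduct.add_tmul, map_add, map_add]
    abel
  | smul a t _ ht =>
    rw [smul_mul_assoc, map_smul, ht, map_smul, ← TensorProduct.smul_tmul', map_smul, map_smul,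
      smul_add]

theorem lTensor_braiding {M : YetterDrinfeld K G U} {f : TensorAlgebra K U →ₗ[K] TensorAlgebra K U}
    (hf : M.tensorAlgebra.IsHom M.tensorAlgebra f) (t : TensorAlgebra K U) (v : U) :
    f.lTensor U (M.tensorAlgebra.braiding M (t ⊗ₜ v)) =
      M.tensorAlgebra.braiding M (f t ⊗ₜ v) := by
  refine M.tensorAlgebra.homogeneous_induction
    (P := fun t => f.lTensor U (M.tensorAlgebra.braiding M (t ⊗ₜ v)) =
      M.tensorAlgebra.braiding M (f t ⊗ₜ v)) (fun x t ht => ?_) (by simp)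
    (fun s t hs ht => by simp only [map_add, TensorProduct.add_tmul, hs, ht]) t
  rw [braiding_tmul ht, braiding_tmul (hf.isHomogeneous ht), LinearMap.lTensor_tmul]

theorem symmetrizer_mul_ι {M : YetterDrinfeld K G U} (n : ℕ) (v : U) (t : TensorAlgebra K U)
    (ht : M.symmetrizer n t = 0) : M.symmetrizer (n + 1) (t * TensorAlgebra.ι K v) = 0 := by
  have key : ∀ (f : TensorAlgebra K U →ₗ[K] TensorAlgebra K U)
      (N : Submodule K (TensorAlgebra K U)),
      (∀ s ∈ N, f (s * TensorAlgebra.ι K v) = 0) → ∀ z ∈ LinearMap.range (N.subtype.lTensor U),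
      f.lTensor U ((LinearMap.mulRight K (TensorAlgebra.ι K v)).lTensor U z) = 0 := by
    rintro f N h _ ⟨z, rfl⟩
    induction z using TensorProduct.induction_on with
    | zero => simp
    | add z z' h h' => simp only [map_add, h, h', add_zero]
    | tmul w s => simp [h s s.2]
  induction n generalizing t with
  | zero =>
    rw [symmetrizer, LinearMap.comp_apply, LinearMap.comp_apply, shuffle_mul_ι, map_add,
      lTensor_braiding (M.isHom_symmetrizer 0), ht, TensorProduct.zero_tmul, map_zero, add_zero,
      key _ ⊤ (fun s _ => M.symmetrizer_zero_mul_ι v s), map_zero]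
    exact LinearMap.lTensor_surjective U (fun s => ⟨⟨s, trivial⟩, rfl⟩) _
  | succ n ih =>
    rw [symmetrizer, LinearMap.comp_apply, LinearMap.comp_apply, shuffle_mul_ι, map_add,
      lTensor_braiding (M.isHom_symmetrizer (n + 1)), ht, TensorProduct.zero_tmul, map_zero,
      add_zero, key _ _ ih _ (mem_of_symmetrizer_succ ht), map_zero]

/-- The ideal of relations of the Nichols algebra: the direct sum of the kernels of the quantum
symmetrizers. -/
noncomputable def nicholsIdeal (M : YetterDrinfeld K G U) : Ideal (TensorAlgebra K U) where
  carrier := {t | ∀ n, M.symmetrizer n t = 0}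
  add_mem' {s t} hs ht n := by rw [map_add, hs n, ht n, add_zero]
  zero_mem' n := map_zero _
  smul_mem' a := by
    induction a using TensorAlgebra.induction with
    | algebraMap r =>
      intro t ht n
      rw [smul_eq_mul, ← Algebra.smul_def, map_smul, ht n, smul_zero]
    | ι u =>
      rintro t ht (_ | n)
      · exact M.symmetrizer_zero_ι_mul u t
      · exact symmetrizer_ι_mul n u t (ht n)
    | mul a b ha hb => intro t ht; rw [mul_smul]; exact ha (hb ht)
    | add a b ha hb =>
      intro t ht n
      rw [add_smul, map_add, ha ht n, hb ht n, add_zero]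

theorem mem_nicholsIdeal {M : YetterDrinfeld K G U} {t : TensorAlgebra K U} :
    t ∈ M.nicholsIdeal ↔ ∀ n, M.symmetrizer n t = 0 := Iff.rfl

instance (M : YetterDrinfeld K G U) : M.nicholsIdeal.IsTwoSided where
  mul_mem_of_left {t} b := by
    induction b using TensorAlgebra.induction generalizing t with
    | algebraMap r =>
      intro ht n
      rw [← Algebra.commutes, ← Algebra.smul_def, map_smul, ht n, smul_zero]
    | ι u =>
      rintro ht (_ | n)
      · exact M.symmetrizer_zero_mul_ι u t
      · exact symmetrizer_mul_ι n u t (ht n)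
    | mul a b ha hb => intro ht; rw [← mul_assoc]; exact hb (ha ht)
    | add a b ha hb =>
      intro ht n
      rw [mul_add, map_add, ha ht n, hb ht n, add_zero]

/-- The Nichols algebra `B(U) = T(U) / ⨁ ker S_n` of a Yetter-Drinfeld module `U`. -/
def NicholsAlgebra (M : YetterDrinfeld K G U) : Type _ := TensorAlgebra K U ⧸ M.nicholsIdeal

noncomputable instance (M : YetterDrinfeld K G U) : Ring M.NicholsAlgebra :=
  inferInstanceAs (Ring (TensorAlgebra K U ⧸ M.nicholsIdeal))

noncomputable instance (M : YetterDrinfeld K G U) : Algebra K M.NicholsAlgebra :=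
  inferInstanceAs (Algebra K (TensorAlgebra K U ⧸ M.nicholsIdeal))

/-- The quotient map `T(U) → B(U)`. -/
noncomputable def toNichols (M : YetterDrinfeld K G U) :
    TensorAlgebra K U →ₐ[K] M.NicholsAlgebra := Ideal.Quotient.mkₐ K M.nicholsIdeal

theorem toNichols_surjective (M : YetterDrinfeld K G U) : Function.Surjective M.toNichols :=
  Ideal.Quotient.mkₐ_surjective K M.nicholsIdeal

theorem toNichols_eq_zero {M : YetterDrinfeld K G U} {t : TensorAlgebra K U} :
    M.toNichols t = 0 ↔ ∀ n, M.symmetrizer n t = 0 :=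
  Ideal.Quotient.eq_zero_iff_mem

/-- The embedding `U → B(U)`. -/
noncomputable def nicholsι (M : YetterDrinfeld K G U) : U →ₗ[K] M.NicholsAlgebra :=
  M.toNichols.toLinearMap ∘ₗ TensorAlgebra.ι K

/-- The group acts on the Nichols algebra by algebra automorphisms. -/
noncomputable def nicholsAct (M : YetterDrinfeld K G U) (x : G) :
    M.NicholsAlgebra →ₐ[K] M.NicholsAlgebra :=
  Ideal.Quotient.liftₐ M.nicholsIdeal (M.toNichols.comp (M.algAct x)) (fun t ht => by
    rw [AlgHom.comp_apply, toNichols_eq_zero]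
    intro n
    rw [← tensorAlgebra_act, (M.isHom_symmetrizer n).1, ht n, map_zero])

/-- The coaction of the Nichols algebra, an algebra map. -/
noncomputable def nicholsCoact (M : YetterDrinfeld K G U) :
    M.NicholsAlgebra →ₐ[K] MonoidAlgebra M.NicholsAlgebra G :=
  Ideal.Quotient.liftₐ M.nicholsIdeal ((MonoidAlgebra.mapAlgHom G M.toNichols).comp M.algCoact)
    (fun t ht => by
      ext x
      rw [AlgHom.comp_apply, MonoidAlgebra.coeff_mapAlgHom, ← tensorAlgebra_coact]
      change _ = 0
      rw [toNichols_eq_zero]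
      intro n
      rw [(M.isHom_symmetrizer n).2, ht n, map_zero]
      rfl)

theorem nicholsAct_toNichols (M : YetterDrinfeld K G U) (x : G) (t : TensorAlgebra K U) :
    M.nicholsAct x (M.toNichols t) = M.toNichols (M.tensorAlgebra.act x t) := rfl

theorem nicholsCoact_toNichols {M : YetterDrinfeld K G U} {x : G} {t : TensorAlgebra K U}
    (ht : M.tensorAlgebra.IsHomogeneous x t) :
    M.nicholsCoact (M.toNichols t) = MonoidAlgebra.single x (M.toNichols t) := by
  rw [isHomogeneous_tensorAlgebra_iff] at ht
  change MonoidAlgebra.mapAlgHom G M.toNichols (M.algCoact t) = _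
  rw [ht]
  simp

/-- The action of `G` on the Nichols algebra as a representation. -/
noncomputable def nicholsRep (M : YetterDrinfeld K G U) : Representation K G M.NicholsAlgebra where
  toFun x := (M.nicholsAct x).toLinearMap
  map_one' := by
    refine LinearMap.ext fun t => ?_
    obtain ⟨t, rfl⟩ := M.toNichols_surjective t
    rw [AlgHom.toLinearMap_apply, nicholsAct_toNichols, map_one]
    rfl
  map_mul' x y := by
    refine LinearMap.ext fun t => ?_
    obtain ⟨t, rfl⟩ := M.toNichols_surjective t
    rw [Module.End.mul_apply, AlgHom.toLinearMap_apply, AlgHom.toLinearMap_apply,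
      AlgHom.toLinearMap_apply, nicholsAct_toNichols, nicholsAct_toNichols, nicholsAct_toNichols,
      map_mul]
    rfl

/-- The Nichols algebra as a Yetter-Drinfeld module. -/
noncomputable def nichols (M : YetterDrinfeld K G U) : YetterDrinfeld K G M.NicholsAlgebra :=
  ofSpan M.nicholsRep
    ((MonoidAlgebra.coeffLinearEquiv K).toLinearMap ∘ₗ M.nicholsCoact.toLinearMap) (by
      rw [eq_top_iff]
      intro t _
      obtain ⟨t, rfl⟩ := M.toNichols_surjective t
      refine M.tensorAlgebra.homogeneous_induction
        (P := fun t => M.toNichols t ∈ Submodule.span K _) (fun x t ht => ?_)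
        (by rw [map_zero]; exact Submodule.zero_mem _)
        (fun s t hs ht => by rw [map_add]; exact Submodule.add_mem _ hs ht) t
      refine Submodule.subset_span ⟨x, fun y => ?_⟩
      exact congrArg (MonoidAlgebra.coeffLinearEquiv K) (nicholsCoact_toNichols (ht.act y)))

theorem nichols_act_toNichols (M : YetterDrinfeld K G U) (x : G) (t : TensorAlgebra K U) :
    M.nichols.act x (M.toNichols t) = M.toNichols (M.tensorAlgebra.act x t) := rfl

/-- The (braided) adjoint action of `U` on the Nichols algebra:
`(ad u)(y) = u y - (u_{(-1)} · y) u_{(0)}`, that is, `(ad u)(y) = u y - (x · y) u` if `u ∈ U_x`. -/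
noncomputable def ad (M : YetterDrinfeld K G U) :
    U →ₗ[K] M.NicholsAlgebra →ₗ[K] M.NicholsAlgebra :=
  LinearMap.mul K M.NicholsAlgebra ∘ₗ M.nicholsι -
    Finsupp.lsum K (fun x =>
      ((LinearMap.mul K M.NicholsAlgebra).flip ∘ₗ M.nicholsι).compl₂ (M.nichols.act x)) ∘ₗ M.coact

theorem ad_apply {M : YetterDrinfeld K G U} {x : G} {u : U} (hu : M.IsHomogeneous x u)
    (y : M.NicholsAlgebra) :
    M.ad u y = M.nicholsι u * y - M.nichols.act x y * M.nicholsι u := by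
  unfold IsHomogeneous at hu
  simp [ad, hu]

/-- For subspaces `P` and `Q` of `U`, the subspace `(ad P)^m (Q)` of `B(U)`, spanned by the
elements `(ad p₁) ⋯ (ad p_m) (q)` with `p_i ∈ P`, `q ∈ Q`. -/
noncomputable def adPow (M : YetterDrinfeld K G U) (P Q : Submodule K U) :
    ℕ → Submodule K M.NicholsAlgebra
  | 0 => Q.map M.nicholsι
  | m + 1 => Submodule.map₂ M.ad P (adPow M P Q m)

end TensorAlgebra

/-! ### The Yetter-Drinfeld modules `M(g, ρ)` -/

section Induced

variable {K G A : Type*} [Field K] [Group G] [AddCommGroup A] [Module K A]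

/-- The centralizer `G^g`. -/
abbrev centralizer {G : Type*} [Group G] (g : G) : Subgroup G := Subgroup.centralizer {g}

/-- The underlying space of `M(g, ρ)`: the induced module `K G ⊗_{K G^g} A`.  In Mathlib's model
of the induced module, the class `IndV.mk _ _ x a` stands for `x⁻¹ ⊗ a`. -/
abbrev IndSpace (g : G) (ρ : Representation K (centralizer g) A) : Type _ :=
  Representation.IndV (centralizer g).subtype ρ

theorem IndSpace.mk_mul (g : G) (ρ : Representation K (centralizer g) A) (z : centralizer g) (x : G)
    (a : A) : Representation.IndV.mk (centralizer g).subtype ρ (z * x) (ρ z a) =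
      Representation.IndV.mk (centralizer g).subtype ρ x a := by
  have := Representation.Coinvariants.mk_self_apply (Representation.tprod
    ((Representation.leftRegular K G).comp (centralizer g).subtype) ρ) z
    (MonoidAlgebra.single x 1 ⊗ₜ a)
  simpa using this

/-- The coaction of `M(g, ρ)`: the vector `x⁻¹ ⊗ a` has degree `x⁻¹ g x`. -/
noncomputable def indCoact (g : G) (ρ : Representation K (centralizer g) A) :
    IndSpace g ρ →ₗ[K] (G →₀ IndSpace g ρ) :=
  Representation.Coinvariants.lift _
    (TensorProduct.lift
      (Finsupp.lsum K (fun x : G => (LinearMap.toSpanSingleton K (A →ₗ[K] (G →₀ IndSpace g ρ))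
        (Finsupp.lsingle (x⁻¹ * g * x) ∘ₗ Representation.IndV.mk _ ρ x))) ∘ₗ
          (MonoidAlgebra.coeffLinearEquiv K).toLinearMap))
    (fun z => by
      refine TensorProduct.ext (MonoidAlgebra.lhom_ext' fun x => LinearMap.ext_ring ?_)
      ext a : 1
      have h : Representation.IndV.mk (centralizer g).subtype ρ (z * x) (ρ z a) =
          Representation.IndV.mk (centralizer g).subtype ρ x a :=
        IndSpace.mk_mul g ρ z x a
      have hz : x⁻¹ * (z : G)⁻¹ * g * (z * x) = x⁻¹ * g * x := by
        have := Subgroup.mem_centralizer_singleton_iff.1 z.2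
        rw [mul_assoc _ g, ← mul_assoc g, ← this]
        group
      simp only [LinearMap.comp_apply, TensorProduct.mk_apply] at h
      simp [h, hz])

theorem indCoact_mk (g : G) (ρ : Representation K (centralizer g) A) (x : G) (a : A) :
    indCoact g ρ (Representation.IndV.mk (centralizer g).subtype ρ x a) =
      Finsupp.single (x⁻¹ * g * x) (Representation.IndV.mk (centralizer g).subtype ρ x a) := by
  simp [indCoact]

/-- The Yetter-Drinfeld module `M(g, ρ) = K G ⊗_{K G^g} A` for a representation `ρ` of the
centralizer `G^g` on `A`: the group acts by left multiplication, and `x ⊗ a` has degree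
`x g x⁻¹`. -/
noncomputable def induced (g : G) (ρ : Representation K (centralizer g) A) :
    YetterDrinfeld K G (IndSpace g ρ) :=
  ofSpan (Representation.ind (centralizer g).subtype ρ) (indCoact g ρ) (by
    rw [eq_top_iff]
    intro z _
    induction z using Representation.Coinvariants.induction_on with
    | h z =>
      induction z using TensorProduct.induction_on with
      | zero => rw [map_zero]; exact Submodule.zero_mem _
      | add z z' hz hz' =>
        rw [map_add]; exact Submodule.add_mem _ (hz trivial) (hz' trivial)
      | tmul f a =>
        induction f using MonoidAlgebra.induction_linear with
        | zero => rw [TensorProduct.zero_tmul, map_zero]; exact Submodule.zero_mem _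
        | add f f' hf hf' =>
          rw [TensorProduct.add_tmul, map_add]; exact Submodule.add_mem _ (hf trivial) (hf' trivial)
        | single x r =>
          have : (MonoidAlgebra.single x r : MonoidAlgebra K G) ⊗ₜ[K] a =
              MonoidAlgebra.single x 1 ⊗ₜ[K] (r • a) := by
            rw [← TensorProduct.smul_tmul]; simp
          rw [this]
          refine Submodule.subset_span ⟨x⁻¹ * g * x, fun y => ?_⟩
          have h := Representation.ind_mk (centralizer g).subtype ρ y x (r • a)
          have h' := indCoact_mk g ρ (x * y⁻¹) (r • a)
          simp only [LinearMap.comp_apply, TensorProduct.mk_apply] at h h'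
          rw [h, h']
          congr 1
          group)

end Induced

/-- The representation of degree one on `K` given by a character. -/
noncomputable def charRep {K H : Type*} [Field K] [Group H] (χ : H →* Kˣ) : Representation K H K :=
  ((algebraMap K (Module.End K K) : K →* Module.End K K).comp (Units.coeHom K)).comp χ

/-- `M(g, χ)` for a character `χ` of the centralizer of `g`. -/
noncomputable abbrev ofChar {K G : Type*} [Field K] [Group G] (g : G) (χ : centralizer g →* Kˣ) :
    YetterDrinfeld K G (IndSpace g (charRep χ)) :=
  induced g (charRep χ)

/-! ### Iterated adjoint actions in `B(V ⊕ W)` -/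

section AdjointPowers

variable {K G V W : Type*} [Field K] [Group G] [AddCommGroup V] [Module K V]
  [AddCommGroup W] [Module K W]

/-- `(ad V)^m (W) ⊆ B(V ⊕ W)`. -/
noncomputable def adLeft (M : YetterDrinfeld K G V) (N : YetterDrinfeld K G W) (m : ℕ) :
    Submodule K (M.prod N).NicholsAlgebra :=
  (M.prod N).adPow (LinearMap.range (LinearMap.inl K V W)) (LinearMap.range (LinearMap.inr K V W)) m

/-- `(ad W)^m (V) ⊆ B(V ⊕ W)`. -/
noncomputable def adRight (M : YetterDrinfeld K G V) (N : YetterDrinfeld K G W) (m : ℕ) :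
    Submodule K (M.prod N).NicholsAlgebra :=
  (M.prod N).adPow (LinearMap.range (LinearMap.inr K V W)) (LinearMap.range (LinearMap.inl K V W)) m

end AdjointPowers

end YetterDrinfeld

/-! ### The groups `Γ_n` and their quotients -/

/-- The generators of `Γ_n`. -/
inductive GammaGen
  | a
  | b
  | ν

/-- The defining relations `b a = ν a b`, `a ν = ν⁻¹ a`, `b ν = ν b`, `ν ^ n = 1` of `Γ_n`. -/
def gammaRels (n : ℕ) : Set (FreeGroup GammaGen) :=
  let a := FreeGroup.of GammaGen.a
  let b := FreeGroup.of GammaGen.b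
  let ν := FreeGroup.of GammaGen.ν
  {b * a * (ν * a * b)⁻¹, a * ν * (ν⁻¹ * a)⁻¹, b * ν * (ν * b)⁻¹, ν ^ n}

/-- The group `Γ_n = ⟨a, b, ν ∣ b a = ν a b, a ν = ν⁻¹ a, b ν = ν b, ν ^ n = 1⟩`. -/
abbrev Gamma (n : ℕ) : Type := PresentedGroup (gammaRels n)

/-- `G = ⟨g, h, ε⟩` with `ε ^ 2 ≠ 1`, and there is a group homomorphism `Γ_4 → G` with `a ↦ g`,
`b ↦ h`, `ν ↦ ε`.  Thus `G` is a non-abelian quotient of `Γ_4`. -/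
structure IsGammaFourQuotient {G : Type*} [Group G] (g h ε : G) : Prop where
  closure_eq_top : Subgroup.closure {g, h, ε} = ⊤
  sq_ne_one : ε ^ 2 ≠ 1
  exists_hom : ∃ f : Gamma 4 →* G, f (PresentedGroup.of GammaGen.a) = g ∧
    f (PresentedGroup.of GammaGen.b) = h ∧ f (PresentedGroup.of GammaGen.ν) = ε

namespace IsGammaFourQuotient

open YetterDrinfeld

variable {G : Type*} [Group G] {g h ε : G}

theorem relations (hG : IsGammaFourQuotient g h ε) :
    h * g = ε * g * h ∧ g * ε = ε⁻¹ * g ∧ h * ε = ε * h ∧ ε ^ 4 = 1 := by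
  obtain ⟨f, rfl, rfl, rfl⟩ := hG.exists_hom
  have key : ∀ r ∈ gammaRels 4, f (PresentedGroup.mk (gammaRels 4) r) = 1 := fun r hr => by
    rw [PresentedGroup.one_of_mem hr, map_one]
  refine ⟨?_, ?_, ?_, ?_⟩
  · have := key _ (Or.inl rfl)
    simp only [map_mul, map_inv] at this
    exact mul_inv_eq_one.1 this
  · have := key _ (Or.inr (Or.inl rfl))
    simp only [map_mul, map_inv] at this
    exact mul_inv_eq_one.1 this
  · have := key _ (Or.inr (Or.inr (Or.inl rfl)))
    simp only [map_mul, map_inv] at this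
    exact mul_inv_eq_one.1 this
  · have := key _ (Or.inr (Or.inr (Or.inr rfl)))
    simp only [map_pow] at this
    exact this

theorem self_mem (x : G) : x ∈ centralizer x := Subgroup.mem_centralizer_singleton_iff.2 rfl

theorem ε_mem (hG : IsGammaFourQuotient g h ε) : ε ∈ centralizer h :=
  Subgroup.mem_centralizer_singleton_iff.2 hG.relations.2.2.1.symm

theorem ε_sq_mem (hG : IsGammaFourQuotient g h ε) : ε ^ 2 ∈ centralizer h :=
  pow_mem hG.ε_mem 2

theorem g_sq_mem (hG : IsGammaFourQuotient g h ε) : g ^ 2 ∈ centralizer h := by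
  rw [Subgroup.mem_centralizer_singleton_iff, pow_two]
  obtain ⟨h₁, h₂, h₃, -⟩ := hG.relations
  calc g * g * h = g * ε⁻¹ * (ε * g * h) := by group
    _ = g * ε⁻¹ * (h * g) := by rw [h₁]
    _ = g * (ε⁻¹ * (h * ε) * ε⁻¹) * g := by group
    _ = g * (ε⁻¹ * (ε * h) * ε⁻¹) * g := by rw [h₃]
    _ = ε * (ε⁻¹ * g) * h * ε⁻¹ * g := by group
    _ = ε * (g * ε) * h * ε⁻¹ * g := by rw [h₂]
    _ = ε * g * (ε * h) * ε⁻¹ * g := by group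
    _ = ε * g * (h * ε) * ε⁻¹ * g := by rw [h₃]
    _ = (ε * g * h) * g := by group
    _ = (h * g) * g := by rw [h₁]
    _ = h * (g * g) := by group

theorem ε_inv_h_sq_mem (hG : IsGammaFourQuotient g h ε) : ε⁻¹ * h ^ 2 ∈ centralizer g := by
  rw [Subgroup.mem_centralizer_singleton_iff, pow_two]
  obtain ⟨h₁, h₂, h₃, -⟩ := hG.relations
  calc ε⁻¹ * (h * h) * g = ε⁻¹ * h * (h * g) := by group
    _ = ε⁻¹ * h * (ε * g * h) := by rw [h₁]
    _ = ε⁻¹ * (h * ε) * g * h := by group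
    _ = ε⁻¹ * (ε * h) * g * h := by rw [h₃]
    _ = (h * g) * h := by group
    _ = (ε * g * h) * h := by rw [h₁]
    _ = ε * (g * ε) * ε⁻¹ * h * h := by group
    _ = ε * (ε⁻¹ * g) * ε⁻¹ * h * h := by rw [h₂]
    _ = g * (ε⁻¹ * (h * h)) := by group

end IsGammaFourQuotient

open YetterDrinfeld

/-! Everything is computed in natural bases. $V$ is spanned by `v₀ = 1 ⊗ 1` and `v₁ = g v₀`, of
degrees $h$ and $\epsilon^3h$; $W$ is spanned by `w₀ = 1 ⊗ 1`, `w₁ = h w₀`, `w₂ = ε w₀`, `w₃ = h ε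
w₀`, of degrees $\epsilon^ig$. With $r=\rho(\epsilon)$, $p=\rho(g^2)$, $s=\sigma(\epsilon^{-1}h^2)$,
$t=\sigma(\epsilon^2)$, the generators permute these vectors up to monomials in $r,p,s,t$, where
$r^4=t^2=1$ and, by assumption, $r=ps$. `GammaFourPair` records this data and `exists_gammaFourPair`
produces it.

Identities in the Nichols algebra are tested with skew derivations: an element without constant term
is zero as soon as every skew derivation kills it (`eq_zero_of_nicholsDer`), and `nicholsDer_ad`
differentiates $(\mathrm{ad}\,u)(y)$. The equation $r=ps$ makes each $(\mathrm{ad}\,w_i)(v_1)$ a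
nonzero multiple of $(\mathrm{ad}\,w_{i+1})(v_0)$, and each $(\mathrm{ad}\,v_1)(w_{i+1})$ a nonzero
multiple of $(\mathrm{ad}\,v_0)(w_i)$, with indices modulo 4. So $(\mathrm{ad}\,W)(V)$ and
$(\mathrm{ad}\,V)(W)$ are spanned by four vectors of distinct degrees lying, up to scalars, in one
orbit. Such a module is simple, and remains so over every extension field
(`isAbsolutelySimple_of_orbit`).

Since $\rho(h)=\sigma(g)=-1$, every basis vector $u$ satisfies $(\mathrm{ad}\,u)^2=0$. Every
generator of $(\mathrm{ad}\,V)(W)$ is in the image of both $\mathrm{ad}\,v_0$ and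
$\mathrm{ad}\,v_1$, whence $(\mathrm{ad}\,V)^2(W)=0$.

In $(\mathrm{ad}\,W)^2(V)$ only the four vectors $(\mathrm{ad}\,w_0)(\mathrm{ad}\,w_2)(v_j)$ and
$(\mathrm{ad}\,w_1)(\mathrm{ad}\,w_3)(v_j)$ are needed, and for fixed $j$ the two have the same
degree. Comparing derivatives, they are proportional exactly when $r^2=-1$. In that case two vectors
interchanged by $g$ span the module, and all $\mathrm{ad}\,w_i$ kill them, so the third power
vanishes. If $r^2\ne-1$ the two vectors are independent and $h$ interchanges their lines; over the
algebraic closure an eigenvector of $h$ in their plane generates a proper submodule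
(`not_isAbsolutelySimple_of_swap`), so the condition already fails at $m=2$. -/

namespace YetterDrinfeld

/-! ### Homogeneous vectors and submodules -/

section General

variable {K G V W : Type*} [Field K] [Group G] [AddCommGroup V] [Module K V]
  [AddCommGroup W] [Module K W]

theorem IsHomogeneous.smul {M : YetterDrinfeld K G V} {x : G} {v : V} (hv : M.IsHomogeneous x v)
    (c : K) : M.IsHomogeneous x (c • v) := by
  unfold IsHomogeneous at *
  rw [map_smul, hv, Finsupp.smul_single]

theorem IsHomogeneous.add {M : YetterDrinfeld K G V} {x : G} {v w : V} (hv : M.IsHomogeneous x v)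
    (hw : M.IsHomogeneous x w) : M.IsHomogeneous x (v + w) := by
  unfold IsHomogeneous at *
  rw [map_add, hv, hw, Finsupp.single_add]

theorem IsHomogeneous.sub {M : YetterDrinfeld K G V} {x : G} {v w : V} (hv : M.IsHomogeneous x v)
    (hw : M.IsHomogeneous x w) : M.IsHomogeneous x (v - w) := by
  unfold IsHomogeneous at *
  rw [map_sub, hv, hw, Finsupp.single_sub]

theorem IsHomogeneous.coact_self {M : YetterDrinfeld K G V} {x : G} {v : V}
    (hv : M.IsHomogeneous x v) : M.coact v x = v := by
  unfold IsHomogeneous at hv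
  rw [hv, Finsupp.single_eq_same]

theorem IsHomogeneous.coact_of_ne {M : YetterDrinfeld K G V} {x y : G} {v : V}
    (hv : M.IsHomogeneous x v) (h : x ≠ y) : M.coact v y = 0 := by
  unfold IsHomogeneous at hv
  rw [hv, Finsupp.single_eq_of_ne h.symm]

theorem IsHomogeneous.act_of_eq {M : YetterDrinfeld K G V} {x : G} {v : V}
    (hv : M.IsHomogeneous x v) (y : G) {z : G} (h : y * x * y⁻¹ = z) :
    M.IsHomogeneous z (M.act y v) := h ▸ hv.act y

/-- A functional that detects a nonzero homogeneous vector and vanishes in all other degrees. -/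
theorem exists_dual_of_isHomogeneous {M : YetterDrinfeld K G V} {x : G} {v : V}
    (hv : M.IsHomogeneous x v) (h₀ : v ≠ 0) :
    ∃ f : Module.Dual K V, f v = 1 ∧ ∀ y u, M.IsHomogeneous y u → y ≠ x → f u = 0 := by
  obtain ⟨f, hf⟩ := Module.Projective.exists_dual_eq_one K h₀
  refine ⟨f ∘ₗ Finsupp.lapply x ∘ₗ M.coact, ?_, fun y u hu hy => ?_⟩
  · simp [hv.coact_self, hf]
  · simp [hu.coact_of_ne hy]

theorem act_inv_act (M : YetterDrinfeld K G V) (x : G) (v : V) :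
    M.act x⁻¹ (M.act x v) = v := by
  rw [← Module.End.mul_apply, ← map_mul, inv_mul_cancel, map_one, Module.End.one_apply]

theorem act_act (M : YetterDrinfeld K G V) (x y : G) (v : V) :
    M.act x (M.act y v) = M.act (x * y) v := by
  rw [← Module.End.mul_apply, ← map_mul]

theorem act_ne_zero {M : YetterDrinfeld K G V} (x : G) {v : V} (hv : v ≠ 0) :
    M.act x v ≠ 0 := fun h => hv <| by rw [← M.act_inv_act x v, h, map_zero]

/-- A Yetter-Drinfeld submodule is spanned by its homogeneous vectors. -/
theorem IsSub.le_span {M : YetterDrinfeld K G V} {N : Submodule K V} (hN : M.IsSub N) {n : V}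
    (hn : n ∈ N) : n ∈ Submodule.span K {v | v ∈ N ∧ ∃ x, M.IsHomogeneous x v} := by
  conv_rhs => rw [← M.sum_coact n]
  exact Submodule.sum_mem _ fun x _ =>
    Submodule.subset_span ⟨hN.2 x n hn, x, M.isHomogeneous_coact n x⟩

theorem isSub_range {M : YetterDrinfeld K G V} {N : YetterDrinfeld K G W} {f : V →ₗ[K] W}
    (hf : M.IsHom N f) : N.IsSub (LinearMap.range f) := by
  constructor
  · rintro x _ ⟨v, rfl⟩
    exact ⟨M.act x v, hf.1 x v⟩
  · rintro x _ ⟨v, rfl⟩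
    exact ⟨M.coact v x, hf.2 x v⟩

end General

/-! ### Skew derivations and the adjoint action on Nichols algebras -/

section NicholsDerivation

variable {K G U : Type*} [Field K] [Group G] [AddCommGroup U] [Module K U]

/-- Contraction of the first tensor factor with a functional. -/
noncomputable def contract (A : Type*) [AddCommGroup A] [Module K A] (f : Module.Dual K U) :
    U ⊗[K] A →ₗ[K] A :=
  (TensorProduct.lid K A).toLinearMap ∘ₗ f.rTensor A

theorem contract_tmul {A : Type*} [AddCommGroup A] [Module K A] (f : Module.Dual K U) (u : U)
    (a : A) : contract A f (u ⊗ₜ a) = f u • a := by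
  simp [contract]

theorem contract_lTensor {A B : Type*} [AddCommGroup A] [Module K A] [AddCommGroup B] [Module K B]
    (f : Module.Dual K U) (φ : A →ₗ[K] B) (z : U ⊗[K] A) :
    contract B f (φ.lTensor U z) = φ (contract A f z) := by
  induction z using TensorProduct.induction_on with
  | zero => simp
  | add a b ha hb => simp only [map_add, ha, hb]
  | tmul u a => simp [contract_tmul]

/-- The coordinates of a tensor with respect to a basis of `U` are its contractions with the
coordinate functionals. -/
theorem eq_zero_of_contract {A : Type*} [AddCommGroup A] [Module K A] {z : U ⊗[K] A}
    (hz : ∀ f, contract A f z = 0) : z = 0 := by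
  classical
  apply (TensorProduct.equivFinsuppOfBasisLeft (Module.Basis.ofVectorSpace K U)).injective
  ext i
  rw [TensorProduct.equivFinsuppOfBasisLeft_apply, map_zero]
  exact hz _

/-- The skew derivation of `T(U)` given by a functional on `U`. -/
noncomputable def skewDer (M : YetterDrinfeld K G U) (f : Module.Dual K U) :
    TensorAlgebra K U →ₗ[K] TensorAlgebra K U :=
  contract _ f ∘ₗ shuffle (M.braiding M)

theorem skewDer_one (M : YetterDrinfeld K G U) (f : Module.Dual K U) : M.skewDer f 1 = 0 := by
  simp [skewDer, shuffle_one]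

/-- Left Leibniz rule. The braiding carries a letter `v` of `t` to the front past `u`, where it
arrives as `x v`; hence the twisted functional `f ∘ x`. -/
theorem skewDer_ι_mul {M : YetterDrinfeld K G U} {x : G} {u : U} (hu : M.IsHomogeneous x u)
    (f : Module.Dual K U) (t : TensorAlgebra K U) :
    M.skewDer f (TensorAlgebra.ι K u * t) =
      f u • t + TensorAlgebra.ι K u * M.skewDer (f ∘ₗ M.act x) t := by
  have key : ∀ z : U ⊗[K] TensorAlgebra K U, contract _ f
      ((mulLeft K U).lTensor U (onFirst (M.braiding M) (u ⊗ₜ z))) =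
        TensorAlgebra.ι K u * contract _ (f ∘ₗ M.act x) z := by
    intro z
    induction z using TensorProduct.induction_on with
    | zero => simp
    | add a b ha hb => simp only [map_add, TensorProduct.tmul_add, mul_add, ha, hb]
    | tmul v t => rw [push_tmul hu, contract_tmul, contract_tmul, mul_smul_comm]; rfl
  simp only [skewDer, LinearMap.comp_apply, shuffle_ι_mul, map_add, key, contract_tmul]

/-- Right Leibniz rule: here the last letter is the one braided to the front, past all of `t`. -/
theorem skewDer_mul_ι {M : YetterDrinfeld K G U} {x : G} {t : TensorAlgebra K U}
    (ht : M.tensorAlgebra.IsHomogeneous x t) (f : Module.Dual K U) (v : U) :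
    M.skewDer f (t * TensorAlgebra.ι K v) =
      M.skewDer f t * TensorAlgebra.ι K v + f (M.act x v) • t := by
  simp only [skewDer, LinearMap.comp_apply, shuffle_mul_ι, map_add, contract_lTensor,
    braiding_tmul ht, contract_tmul]
  rfl

theorem skewDer_act (M : YetterDrinfeld K G U) (f : Module.Dual K U) (x : G)
    (t : TensorAlgebra K U) :
    M.skewDer f (M.tensorAlgebra.act x t) =
      M.tensorAlgebra.act x (M.skewDer (f ∘ₗ M.act x) t) := by
  simp only [skewDer, LinearMap.comp_apply, M.isHom_shuffle.1]
  generalize shuffle (M.braiding M) t = z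
  induction z using TensorProduct.induction_on with
  | zero => simp
  | add a b ha hb => simp only [map_add, ha, hb]
  | tmul v t => rw [tensor_act_tmul, contract_tmul, contract_tmul, map_smul]; rfl

/-- The symmetrizer of level `n + 1` is `shuffle` followed by the one of level `n` on the second
factor and an injective multiplication, so contracting the first factor preserves the vanishing.
Skew derivations therefore descend to `B(U)`. -/
theorem symmetrizer_skewDer {M : YetterDrinfeld K G U} {n : ℕ} {t : TensorAlgebra K U}
    (ht : M.symmetrizer (n + 1) t = 0) (f : Module.Dual K U) :
    M.symmetrizer n (M.skewDer f t) = 0 := by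
  have h : (M.symmetrizer n).lTensor U (shuffle (M.braiding M) t) = 0 := by
    apply mulLeft_injective
    rw [map_zero]
    exact ht
  rw [skewDer, LinearMap.comp_apply, ← contract_lTensor, h, map_zero]

/-- The skew derivation of `B(U)` given by a functional on `U`. -/
noncomputable def nicholsDer (M : YetterDrinfeld K G U) (f : Module.Dual K U) :
    M.NicholsAlgebra →ₗ[K] M.NicholsAlgebra :=
  (LinearMap.ker M.toNichols.toLinearMap).liftQ (M.toNichols.toLinearMap ∘ₗ M.skewDer f)
    (fun t ht => by
      have ht : M.toNichols t = 0 := ht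
      rw [toNichols_eq_zero] at ht
      change M.toNichols (M.skewDer f t) = 0
      rw [toNichols_eq_zero]
      exact fun n => symmetrizer_skewDer (ht (n + 1)) f) ∘ₗ
    (M.toNichols.toLinearMap.quotKerEquivOfSurjective M.toNichols_surjective).symm.toLinearMap

theorem nicholsDer_toNichols (M : YetterDrinfeld K G U) (f : Module.Dual K U)
    (t : TensorAlgebra K U) : M.nicholsDer f (M.toNichols t) = M.toNichols (M.skewDer f t) := by
  have : (M.toNichols.toLinearMap.quotKerEquivOfSurjective M.toNichols_surjective).symm
      (M.toNichols t) = Submodule.Quotient.mk t := by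
    rw [LinearEquiv.symm_apply_eq]
    rfl
  simp only [nicholsDer, LinearMap.comp_apply, LinearEquiv.coe_coe, this]
  rfl

/-- The counit of `B(U)`. -/
noncomputable def nicholsCounit (M : YetterDrinfeld K G U) : M.NicholsAlgebra →ₐ[K] K :=
  Ideal.Quotient.liftₐ M.nicholsIdeal TensorAlgebra.algebraMapInv (fun t ht => by
    have h : algebraMap K (TensorAlgebra K U) (TensorAlgebra.algebraMapInv t) = 0 := ht 0
    have := congrArg TensorAlgebra.algebraMapInv h
    rwa [TensorAlgebra.algebraMap_leftInverse, map_zero] at this)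

theorem nicholsCounit_toNichols (M : YetterDrinfeld K G U) (t : TensorAlgebra K U) :
    M.nicholsCounit (M.toNichols t) = TensorAlgebra.algebraMapInv t := rfl

theorem nicholsCounit_ι (M : YetterDrinfeld K G U) (u : U) :
    M.nicholsCounit (M.nicholsι u) = 0 := by
  change M.nicholsCounit (M.toNichols (TensorAlgebra.ι K u)) = 0
  rw [nicholsCounit_toNichols]
  simp [TensorAlgebra.algebraMapInv]

/-- An element of `B(U)` without constant term vanishes if all skew derivations kill it. -/
theorem eq_zero_of_nicholsDer {M : YetterDrinfeld K G U} {y : M.NicholsAlgebra}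
    (h₀ : M.nicholsCounit y = 0) (h : ∀ f, M.nicholsDer f y = 0) : y = 0 := by
  obtain ⟨t, rfl⟩ := M.toNichols_surjective y
  rw [toNichols_eq_zero]
  -- Level zero is the projection to constants, controlled by the counit; at level `n + 1` it
  -- suffices that every contraction of the first factor vanishes.
  rintro (_ | n)
  · rw [nicholsCounit_toNichols] at h₀
    simp [symmetrizer, h₀]
  · rw [symmetrizer, LinearMap.comp_apply, LinearMap.comp_apply,
      eq_zero_of_contract (z := (M.symmetrizer n).lTensor U _), map_zero]
    intro f
    rw [contract_lTensor]
    have := h f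
    rw [nicholsDer_toNichols, toNichols_eq_zero] at this
    exact this n

theorem eq_of_nicholsDer {M : YetterDrinfeld K G U} {y z : M.NicholsAlgebra}
    (hy : M.nicholsCounit y = 0) (hz : M.nicholsCounit z = 0)
    (h : ∀ f, M.nicholsDer f y = M.nicholsDer f z) : y = z := by
  rw [← sub_eq_zero]
  refine eq_zero_of_nicholsDer (by rw [map_sub, hy, hz, sub_zero]) fun f => ?_
  rw [map_sub, h, sub_self]

theorem isHom_toNichols (M : YetterDrinfeld K G U) :
    M.tensorAlgebra.IsHom M.nichols M.toNichols.toLinearMap :=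
  IsHom.of_homogeneous (fun _ _ _ _ => rfl) fun _ _ ht =>
    congrArg (MonoidAlgebra.coeffLinearEquiv K) (nicholsCoact_toNichols ht)

theorem isHom_nicholsι (M : YetterDrinfeld K G U) : M.IsHom M.nichols M.nicholsι :=
  M.isHom_toNichols.comp <| IsHom.of_homogeneous
    (fun x v _ _ => by rw [tensorAlgebra_act, algAct_ι]) fun _ _ hv => hv.ι

theorem nichols_act_ι (M : YetterDrinfeld K G U) (x : G) (u : U) :
    M.nichols.act x (M.nicholsι u) = M.nicholsι (M.act x u) := (M.isHom_nicholsι.1 x u).symm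

theorem IsHomogeneous.nicholsι {M : YetterDrinfeld K G U} {x : G} {u : U}
    (hu : M.IsHomogeneous x u) : M.nichols.IsHomogeneous x (M.nicholsι u) :=
  M.isHom_nicholsι.isHomogeneous hu

theorem nichols_act_mul (M : YetterDrinfeld K G U) (x : G) (y z : M.NicholsAlgebra) :
    M.nichols.act x (y * z) = M.nichols.act x y * M.nichols.act x z :=
  map_mul (M.nicholsAct x) y z

/-- Take any lift and keep only its component of degree `x`. -/
theorem exists_isHomogeneous_toNichols {M : YetterDrinfeld K G U} {x : G} {y : M.NicholsAlgebra}
    (hy : M.nichols.IsHomogeneous x y) :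
    ∃ t, M.tensorAlgebra.IsHomogeneous x t ∧ M.toNichols t = y := by
  obtain ⟨t, rfl⟩ := M.toNichols_surjective y
  exact ⟨_, M.tensorAlgebra.isHomogeneous_coact t x,
    (M.isHom_toNichols.2 x t).trans hy.coact_self⟩

theorem IsHomogeneous.nichols_mul {M : YetterDrinfeld K G U} {x y : G} {a b : M.NicholsAlgebra}
    (ha : M.nichols.IsHomogeneous x a) (hb : M.nichols.IsHomogeneous y b) :
    M.nichols.IsHomogeneous (x * y) (a * b) := by
  obtain ⟨s, hs, rfl⟩ := exists_isHomogeneous_toNichols ha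
  obtain ⟨t, ht, rfl⟩ := exists_isHomogeneous_toNichols hb
  rw [← map_mul]
  exact M.isHom_toNichols.isHomogeneous (hs.mul ht)

theorem nicholsDer_ι_mul {M : YetterDrinfeld K G U} {x : G} {u : U} (hu : M.IsHomogeneous x u)
    (f : Module.Dual K U) (y : M.NicholsAlgebra) :
    M.nicholsDer f (M.nicholsι u * y) =
      f u • y + M.nicholsι u * M.nicholsDer (f ∘ₗ M.act x) y := by
  obtain ⟨t, rfl⟩ := M.toNichols_surjective y
  change M.nicholsDer f (M.toNichols _ * _) = _ + M.toNichols _ * _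
  rw [← map_mul, nicholsDer_toNichols, skewDer_ι_mul hu, nicholsDer_toNichols, map_add, map_smul,
    map_mul]

theorem nicholsDer_mul_ι {M : YetterDrinfeld K G U} {x : G} {y : M.NicholsAlgebra}
    (hy : M.nichols.IsHomogeneous x y) (f : Module.Dual K U) (u : U) :
    M.nicholsDer f (y * M.nicholsι u) =
      M.nicholsDer f y * M.nicholsι u + f (M.act x u) • y := by
  obtain ⟨t, ht, rfl⟩ := exists_isHomogeneous_toNichols hy
  change M.nicholsDer f (_ * M.toNichols _) = _ * M.toNichols _ + _
  rw [← map_mul, nicholsDer_toNichols, skewDer_mul_ι ht, nicholsDer_toNichols, map_add, map_smul,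
    map_mul]

theorem nicholsDer_ι (M : YetterDrinfeld K G U) (f : Module.Dual K U) (u : U) :
    M.nicholsDer f (M.nicholsι u) = f u • 1 := by
  refine M.homogeneous_induction (P := fun u => M.nicholsDer f (M.nicholsι u) = f u • 1)
    (fun x u hu => ?_) (by simp) (fun u v hu hv => by simp only [map_add, hu, hv, add_smul]) u
  have h := nicholsDer_ι_mul hu f 1
  have h₁ : M.nicholsDer (f ∘ₗ M.act x) 1 = 0 := by
    rw [← map_one M.toNichols, nicholsDer_toNichols, skewDer_one, map_zero]
  rwa [h₁, mul_one, mul_zero, add_zero] at h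

theorem nicholsDer_act (M : YetterDrinfeld K G U) (f : Module.Dual K U) (x : G)
    (y : M.NicholsAlgebra) :
    M.nicholsDer f (M.nichols.act x y) = M.nichols.act x (M.nicholsDer (f ∘ₗ M.act x) y) := by
  obtain ⟨t, rfl⟩ := M.toNichols_surjective y
  rw [nichols_act_toNichols, nicholsDer_toNichols, nicholsDer_toNichols, skewDer_act]
  rfl

theorem nicholsι_injective (M : YetterDrinfeld K G U) : Function.Injective M.nicholsι := by
  have one_ne : (1 : M.NicholsAlgebra) ≠ 0 := fun h => by
    have := congrArg M.nicholsCounit h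
    simp at this
  rw [injective_iff_map_eq_zero]
  intro u hu
  rw [← Module.forall_dual_apply_eq_zero_iff K]
  intro f
  have h := M.nicholsDer_ι f u
  rw [hu, map_zero] at h
  exact (smul_eq_zero.1 h.symm).resolve_right one_ne

/-! ### The adjoint action -/

theorem nicholsCounit_ad {M : YetterDrinfeld K G U} (u : U) (y : M.NicholsAlgebra) :
    M.nicholsCounit (M.ad u y) = 0 := by
  refine M.homogeneous_induction (P := fun u => M.nicholsCounit (M.ad u y) = 0)
    (fun x u hu => ?_) (by simp) (fun u v hu hv => by simp [hu, hv]) u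
  rw [ad_apply hu, map_sub, map_mul, map_mul, nicholsCounit_ι, zero_mul, mul_zero, sub_zero]

theorem ad_one (M : YetterDrinfeld K G U) (u : U) : M.ad u 1 = 0 := by
  refine M.homogeneous_induction (P := fun u => M.ad u 1 = 0)
    (fun x u hu => ?_) (by simp) (fun u v hu hv => by simp [hu, hv]) u
  rw [ad_apply hu, mul_one, show M.nichols.act x 1 = 1 from map_one (M.nicholsAct x), one_mul,
    sub_self]

theorem act_ad (M : YetterDrinfeld K G U) (a : G) (u : U) (y : M.NicholsAlgebra) :
    M.nichols.act a (M.ad u y) = M.ad (M.act a u) (M.nichols.act a y) := by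
  refine M.homogeneous_induction
    (P := fun u => M.nichols.act a (M.ad u y) = M.ad (M.act a u) (M.nichols.act a y))
    (fun x u hu => ?_) (by simp) (fun u v hu hv => by simp [hu, hv]) u
  rw [ad_apply hu, ad_apply (hu.act a), map_sub, nichols_act_mul, nichols_act_mul, nichols_act_ι,
    act_act, act_act, inv_mul_cancel_right]

theorem IsHomogeneous.ad {M : YetterDrinfeld K G U} {x z : G} {u : U} {y : M.NicholsAlgebra}
    (hu : M.IsHomogeneous x u) (hy : M.nichols.IsHomogeneous z y) :
    M.nichols.IsHomogeneous (x * z) (M.ad u y) := by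
  rw [ad_apply hu]
  refine (hu.nicholsι.nichols_mul hy).sub ?_
  have := (hy.act x).nichols_mul hu.nicholsι
  rwa [inv_mul_cancel_right] at this

/-- The left Leibniz rule applies to `u y` and the right one to `(x · y) u`, where `x · y` has
degree `x z x⁻¹`. By equivariance the two terms in which `y` is differentiated recombine to `ad u`
of a derivative. -/
theorem nicholsDer_ad {M : YetterDrinfeld K G U} {x z : G} {u : U} {y : M.NicholsAlgebra}
    (hu : M.IsHomogeneous x u) (hy : M.nichols.IsHomogeneous z y) (f : Module.Dual K U) :
    M.nicholsDer f (M.ad u y) = f u • y - f (M.act (x * z * x⁻¹) u) • M.nichols.act x y +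
      M.ad u (M.nicholsDer (f ∘ₗ M.act x) y) := by
  rw [ad_apply hu, ad_apply hu, map_sub, nicholsDer_ι_mul hu, nicholsDer_mul_ι (hy.act x),
    nicholsDer_act]
  abel

theorem nicholsDer_ad_ι {M : YetterDrinfeld K G U} {x z : G} {u v : U}
    (hu : M.IsHomogeneous x u) (hv : M.IsHomogeneous z v) (f : Module.Dual K U) :
    M.nicholsDer f (M.ad u (M.nicholsι v)) =
      f u • M.nicholsι v - f (M.act (x * z * x⁻¹) u) • M.nicholsι (M.act x v) := by
  rw [nicholsDer_ad hu hv.nicholsι, nicholsDer_ι, map_smul, ad_one, smul_zero, add_zero,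
    nichols_act_ι]

/-- The condition `q * q' = 1` says that the double braiding fixes `u ⊗ u'`; then the braided
commutator has zero derivatives. -/
theorem ι_mul_ι_comm {M : YetterDrinfeld K G U} {x x' : G} {u u' : U} {q q' : K}
    (hu : M.IsHomogeneous x u) (hu' : M.IsHomogeneous x' u') (h : M.act x u' = q • u')
    (h' : M.act x' u = q' • u) (hq : q * q' = 1) :
    M.nicholsι u * M.nicholsι u' = q • (M.nicholsι u' * M.nicholsι u) := by
  refine eq_of_nicholsDer (by simp [nicholsCounit_ι]) (by simp [nicholsCounit_ι]) fun f => ?_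
  rw [map_smul, nicholsDer_ι_mul hu, nicholsDer_ι_mul hu', nicholsDer_ι, nicholsDer_ι,
    LinearMap.comp_apply, LinearMap.comp_apply, h, h', map_smul, map_smul]
  simp only [mul_smul_comm, mul_one, smul_add, smul_smul, smul_eq_mul, ← mul_assoc, hq, one_mul]
  abel

/-- The previous commutation relation carries over to adjoint actions; commuting degrees ensure that
`y` is twisted by the same group element on both sides. -/
theorem ad_ad_comm {M : YetterDrinfeld K G U} {x x' : G} {u u' : U} {q q' : K}
    (hu : M.IsHomogeneous x u) (hu' : M.IsHomogeneous x' u') (hx : x * x' = x' * x)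
    (h : M.act x u' = q • u') (h' : M.act x' u = q' • u) (hq : q * q' = 1)
    (y : M.NicholsAlgebra) : M.ad u (M.ad u' y) = q • M.ad u' (M.ad u y) := by
  have hc := ι_mul_ι_comm hu hu' h h' hq
  rw [ad_apply hu', ad_apply hu, ad_apply hu', ad_apply hu]
  simp only [map_sub, nichols_act_mul, nichols_act_ι, h, h', map_smul, act_act, hx]
  simp only [mul_sub, sub_mul, smul_sub, smul_mul_assoc, mul_smul_comm, smul_smul, hq, one_smul,
    mul_assoc]
  rw [← mul_assoc _ _ y, hc]
  simp only [smul_mul_assoc, mul_smul_comm, mul_assoc]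
  abel

/-- The derivative is `f u • u + f (x u) • u`, which cancels without dividing by 2, so the
characteristic plays no role. -/
theorem ι_mul_self {M : YetterDrinfeld K G U} {x : G} {u : U}
    (hu : M.IsHomogeneous x u) (h : M.act x u = -u) : M.nicholsι u * M.nicholsι u = 0 := by
  refine eq_zero_of_nicholsDer (by simp [nicholsCounit_ι]) fun f => ?_
  rw [nicholsDer_ι_mul hu, nicholsDer_ι, LinearMap.comp_apply, h]
  simp

theorem ad_ad_self {M : YetterDrinfeld K G U} {x : G} {u : U}
    (hu : M.IsHomogeneous x u) (h : M.act x u = -u) (y : M.NicholsAlgebra) :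
    M.ad u (M.ad u y) = 0 := by
  have hc := ι_mul_self hu h
  rw [ad_apply hu, ad_apply hu]
  simp only [map_sub, nichols_act_mul, nichols_act_ι, h, map_neg]
  simp only [mul_sub, sub_mul, mul_neg, neg_mul, mul_assoc, hc, mul_zero]
  rw [← mul_assoc, hc, zero_mul]
  abel

/-- `(ad u₁) y = c (ad u₂) z` may be checked with skew derivations. -/
theorem ad_ι_eq_smul {M : YetterDrinfeld K G U} {x x' z z' : G} {u u' v v' : U} {c : K}
    (hu : M.IsHomogeneous x u) (hv : M.IsHomogeneous z v) (hu' : M.IsHomogeneous x' u')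
    (hv' : M.IsHomogeneous z' v')
    (h : ∀ f : Module.Dual K U,
      f u • v - f (M.act (x * z * x⁻¹) u) • (M.act x v) =
        c • (f u' • v' - f (M.act (x' * z' * x'⁻¹) u') • (M.act x' v'))) :
    M.ad u (M.nicholsι v) = c • M.ad u' (M.nicholsι v') := by
  refine eq_of_nicholsDer (nicholsCounit_ad _ _) ?_ fun f => ?_
  · rw [map_smul, nicholsCounit_ad, smul_zero]
  · rw [map_smul, nicholsDer_ad_ι hu hv, nicholsDer_ad_ι hu' hv']
    have := congrArg M.nicholsι (h f)
    simpa only [map_smul, map_sub] using this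

theorem isSub_map₂_ad {M : YetterDrinfeld K G U} {P : Submodule K U}
    {N : Submodule K M.NicholsAlgebra} (hP : M.IsSub P) (hN : M.nichols.IsSub N) :
    M.nichols.IsSub (Submodule.map₂ M.ad P N) := by
  classical
  refine ⟨fun a y hy => ?_, fun a y hy => ?_⟩
  · suffices h : Submodule.map₂ M.ad P N ≤ (Submodule.map₂ M.ad P N).comap (M.nichols.act a) from
      h hy
    rw [Submodule.map₂_le]
    intro u hu n hn
    rw [Submodule.mem_comap, act_ad]
    exact Submodule.apply_mem_map₂ _ (hP.1 a u hu) (hN.1 a n hn)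
  · suffices h : Submodule.map₂ M.ad P N ≤ (Submodule.map₂ M.ad P N).comap
        (Finsupp.lapply a ∘ₗ M.nichols.coact) from h hy
    rw [Submodule.map₂_le]
    intro u hu n hn
    -- Both submodules are spanned by their homogeneous vectors, and for homogeneous arguments `ad u
    -- n` has a single degree.
    replace hu := hP.le_span hu
    replace hn := hN.le_span hn
    rw [Submodule.mem_comap]
    induction hu using Submodule.span_induction with
    | zero => simp
    | add u v _ _ hu hv => rw [map_add, LinearMap.add_apply, map_add]; exact add_mem hu hv
    | smul c u _ hu =>
      rw [map_smul, LinearMap.smul_apply, map_smul]; exact Submodule.smul_mem _ _ hu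
    | mem u hu =>
      obtain ⟨huP, x, hu⟩ := hu
      induction hn using Submodule.span_induction with
      | zero => simp
      | add u v _ _ hu hv => rw [map_add, map_add]; exact add_mem hu hv
      | smul c u _ hu => rw [map_smul, map_smul]; exact Submodule.smul_mem _ _ hu
      | mem n hn =>
        obtain ⟨hnN, z, hn⟩ := hn
        have h := hu.ad hn
        unfold IsHomogeneous at h
        rw [LinearMap.comp_apply, h, Finsupp.lapply_apply, Finsupp.single_apply]
        split_ifs
        · exact Submodule.apply_mem_map₂ _ huP hnN
        · exact zero_mem _

theorem isSub_adPow {M : YetterDrinfeld K G U} {P Q : Submodule K U} (hP : M.IsSub P)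
    (hQ : M.IsSub Q) (m : ℕ) : M.nichols.IsSub (M.adPow P Q m) := by
  induction m with
  | succ m ih => exact isSub_map₂_ad hP ih
  | zero =>
    constructor
    · rintro x _ ⟨u, hu, rfl⟩
      exact ⟨M.act x u, hQ.1 x u hu, M.isHom_nicholsι.1 x u⟩
    · rintro x _ ⟨u, hu, rfl⟩
      exact ⟨M.coact u x, hQ.2 x u hu, M.isHom_nicholsι.2 x u⟩

end NicholsDerivation

end YetterDrinfeld

namespace YetterDrinfeld

/-! ### Criteria for simplicity and for being a submodule -/

section Simplicity

variable {K G V : Type*} [Field K] [Group G] [AddCommGroup V] [Module K V]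

theorem exists_coact_ne_zero (M : YetterDrinfeld K G V) {v : V} (hv : v ≠ 0) :
    ∃ x, M.coact v x ≠ 0 := by
  by_contra! h
  refine hv ?_
  rw [← M.sum_coact v]
  exact Finset.sum_eq_zero fun x _ => h x

/-- A Yetter-Drinfeld module is simple if it is spanned by homogeneous vectors of pairwise distinct
degrees all of which belong, up to scalars, to a single orbit. -/
theorem isSimple_of_orbit (M : YetterDrinfeld K G V) {ι : Type*} {x₀ : V} (h₀ : x₀ ≠ 0) (x : ι → V)
    {d : ι → G} (hd : Function.Injective d) (hx : ∀ k, M.IsHomogeneous (d k) (x k))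
    (hspan : ∀ v, v ∈ Submodule.span K (Set.range x))
    (horb : ∀ k, ∃ (a : G) (c : K), c ≠ 0 ∧ M.act a x₀ = c • x k) : M.IsSimple := by
  refine ⟨⟨x₀, 0, h₀⟩, fun N hN => ?_⟩
  by_cases hbot : N = ⊥
  · exact Or.inl hbot
  obtain ⟨n, hn, hn0⟩ := N.ne_bot_iff.1 hbot
  obtain ⟨y, hy⟩ := M.exists_coact_ne_zero hn0
  -- The component of `n` in degree `y` involves only those `x k` whose degree is `y`; by
  -- injectivity of `d` there is at most one.
  have key : ∀ T : Submodule K V, (∀ k, d k = y → x k ∈ T) → M.coact n y ∈ T := by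
    intro T hT
    have : Submodule.span K (Set.range x) ≤ T.comap (Finsupp.lapply y ∘ₗ M.coact) := by
      rw [Submodule.span_le]
      rintro _ ⟨k, rfl⟩
      change M.coact (x k) y ∈ T
      by_cases hk : d k = y
      · rw [← hk, (hx k).coact_self]
        exact hT k hk
      · rw [(hx k).coact_of_ne hk]
        exact T.zero_mem
    exact this (hspan n)
  obtain ⟨k, hk⟩ : ∃ k, d k = y := by
    by_contra! h
    exact hy ((Submodule.mem_bot K).1 (key ⊥ fun k hk => absurd hk (h k)))
  have hk' : M.coact n y ∈ Submodule.span K {x k} := key _ fun l hl =>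
    hd (hl.trans hk.symm) ▸ Submodule.mem_span_singleton_self _
  obtain ⟨c, hc⟩ := Submodule.mem_span_singleton.1 hk'
  have hc0 : c ≠ 0 := by
    rintro rfl
    exact hy (by rw [← hc, zero_smul])
  have hxk : x k ∈ N := (Submodule.smul_mem_iff N hc0).1 (hc ▸ hN.2 y n hn)
  have hx₀ : x₀ ∈ N := by
    obtain ⟨a, c, -, h⟩ := horb k
    rw [← M.act_inv_act a x₀, h]
    exact hN.1 _ _ (N.smul_mem c hxk)
  right
  rw [eq_top_iff]
  intro v _
  refine Submodule.span_le.2 ?_ (hspan v)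
  rintro _ ⟨l, rfl⟩
  obtain ⟨a, c, hc, h⟩ := horb l
  exact (Submodule.smul_mem_iff N hc).1 (h ▸ hN.1 a x₀ hx₀)

theorem baseChange_act_tmul (L : Type*) [Field L] [Algebra K L] (M : YetterDrinfeld K G V) (x : G)
    (a : L) (v : V) : (M.baseChange L).act x (a ⊗ₜ v) = a ⊗ₜ M.act x v := rfl

theorem IsHomogeneous.tmul_baseChange (L : Type*) [Field L] [Algebra K L]
    {M : YetterDrinfeld K G V} {x : G} {v : V} (hv : M.IsHomogeneous x v) (a : L) :
    (M.baseChange L).IsHomogeneous x (a ⊗ₜ v) := by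
  classical
  unfold IsHomogeneous at *
  change (TensorProduct.finsuppRight K L L V G) (a ⊗ₜ M.coact v) = _
  rw [hv]
  ext y
  simp [Finsupp.single_apply]

theorem one_tmul_ne_zero (L : Type*) [Field L] [Algebra K L] {v : V} (hv : v ≠ 0) :
    (1 : L) ⊗ₜ[K] v ≠ 0 := by
  obtain ⟨f, hf⟩ := Module.Projective.exists_dual_eq_one K hv
  intro h
  have := congrArg (f.baseChange L) h
  simp [hf] at this

theorem isHomogeneous_restrict {M : YetterDrinfeld K G V} {N : Submodule K V} (hN : M.IsSub N)
    {x : G} {v : N} (hv : M.IsHomogeneous x (v : V)) : (M.restrict N hN).IsHomogeneous x v := by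
  classical
  unfold IsHomogeneous at *
  ext y
  change M.coact v y = _
  rw [hv, Finsupp.single_apply, Finsupp.single_apply]
  split_ifs <;> rfl

/-- A finite-dimensional subspace stable under an invertible operator is stable under its
inverse. -/
theorem act_inv_mem (M : YetterDrinfeld K G V) {N : Submodule K V} [FiniteDimensional K N] {x : G}
    (h : ∀ v ∈ N, M.act x v ∈ N) {v : V} (hv : v ∈ N) : M.act x⁻¹ v ∈ N := by
  have hinj : Function.Injective ((M.act x).restrict h) := by
    intro a b hab
    have := congrArg (fun n : N => M.act x⁻¹ (n : V)) hab
    simp only [LinearMap.coe_restrict_apply, act_inv_act] at this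
    exact Subtype.ext this
  obtain ⟨w, hw⟩ := LinearMap.surjective_of_injective hinj ⟨v, hv⟩
  have := congrArg (fun n : N => M.act x⁻¹ (n : V)) hw
  simp only [LinearMap.coe_restrict_apply, act_inv_act] at this
  rw [← this]
  exact w.2

/-- Finite dimension takes care of inverses, so stability need only be checked on generators. -/
theorem act_mem_of_closure (M : YetterDrinfeld K G V) {S : Set G} (hS : Subgroup.closure S = ⊤)
    {N : Submodule K V} [FiniteDimensional K N] (h : ∀ x ∈ S, ∀ v ∈ N, M.act x v ∈ N) (x : G) :
    ∀ v ∈ N, M.act x v ∈ N := by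
  have hx : x ∈ Subgroup.closure S := hS ▸ Subgroup.mem_top x
  induction hx using Subgroup.closure_induction with
  | mem x hx => exact h x hx
  | one => intro v hv; rwa [map_one]
  | mul x y _ _ hx hy => intro v hv; rw [← act_act]; exact hx _ (hy v hv)
  | inv x _ hx => exact fun v hv => M.act_inv_mem hx hv

theorem isSub_span (M : YetterDrinfeld K G V) {S : Set G} (hS : Subgroup.closure S = ⊤)
    {T : Set V} (hfin : T.Finite) (hT : ∀ v ∈ T, ∃ x, M.IsHomogeneous x v)
    (h : ∀ x ∈ S, ∀ v ∈ T, M.act x v ∈ Submodule.span K T) : M.IsSub (Submodule.span K T) := by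
  classical
  have : FiniteDimensional K (Submodule.span K T) := FiniteDimensional.span_of_finite K hfin
  refine ⟨M.act_mem_of_closure hS fun x hx => ?_, fun x => ?_⟩
  · suffices h' : Submodule.span K T ≤ (Submodule.span K T).comap (M.act x) from fun v hv => h' hv
    rw [Submodule.span_le]
    exact fun v hv => h x hx v hv
  · suffices h' : Submodule.span K T ≤ (Submodule.span K T).comap (Finsupp.lapply x ∘ₗ M.coact) from
      fun v hv => h' hv
    rw [Submodule.span_le]
    intro v hv
    obtain ⟨y, hy⟩ := hT v hv
    change M.coact v x ∈ Submodule.span K T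
    by_cases hyx : y = x
    · rw [← hyx, hy.coact_self]
      exact Submodule.subset_span hv
    · rw [hy.coact_of_ne hyx]
      exact zero_mem _

end Simplicity

/-! ### Absolute simplicity and an obstruction to it -/

section AbsoluteSimplicity

variable {K : Type u} {G V : Type*} [Field K] [Group G] [AddCommGroup V] [Module K V]

/-- The orbit criterion is stable under extension of scalars: the vectors `1 ⊗ x k` keep their
degrees and the orbit relations keep nonzero scalars. -/
theorem isAbsolutelySimple_of_orbit (M : YetterDrinfeld K G V) {ι : Type*} {x₀ : V} (h₀ : x₀ ≠ 0)
    (x : ι → V) {d : ι → G} (hd : Function.Injective d) (hx : ∀ k, M.IsHomogeneous (d k) (x k))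
    (hspan : ∀ v, v ∈ Submodule.span K (Set.range x))
    (horb : ∀ k, ∃ (a : G) (c : K), c ≠ 0 ∧ M.act a x₀ = c • x k) : M.IsAbsolutelySimple := by
  intro L _ _
  refine isSimple_of_orbit _ (one_tmul_ne_zero L h₀) (fun k => (1 : L) ⊗ₜ[K] x k) hd
    (fun k => (hx k).tmul_baseChange L 1) (fun v => ?_) (fun k => ?_)
  · induction v using TensorProduct.induction_on with
    | zero => exact zero_mem _
    | add a b ha hb => exact add_mem ha hb
    | tmul a v =>
      have hv := hspan v
      induction hv using Submodule.span_induction with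
      | zero => simp
      | add v w _ _ hv hw => rw [TensorProduct.tmul_add]; exact add_mem hv hw
      | smul c v _ hv =>
        rw [TensorProduct.tmul_smul, ← algebraMap_smul L c]
        exact Submodule.smul_mem _ _ hv
      | mem v hv =>
        obtain ⟨k, rfl⟩ := hv
        rw [show a ⊗ₜ[K] x k = a • ((1 : L) ⊗ₜ[K] x k) by simp [TensorProduct.smul_tmul']]
        exact Submodule.smul_mem _ _ (Submodule.subset_span ⟨k, rfl⟩)
  · obtain ⟨a, c, hc, h⟩ := horb k
    refine ⟨a, algebraMap K L c, by simpa using hc, ?_⟩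
    rw [baseChange_act_tmul, h, TensorProduct.tmul_smul, algebraMap_smul]

theorem isAbsolutelySimpleSub_of_orbit {M : YetterDrinfeld K G V} {N : Submodule K V}
    (hN : M.IsSub N) {ι : Type*} {x₀ : V} (h₀ : x₀ ≠ 0) (hx₀ : x₀ ∈ N)
    (x : ι → V) {d : ι → G} (hd : Function.Injective d) (hx : ∀ k, M.IsHomogeneous (d k) (x k))
    (hspan : N = Submodule.span K (Set.range x))
    (horb : ∀ k, ∃ (a : G) (c : K), c ≠ 0 ∧ M.act a x₀ = c • x k) : M.IsAbsolutelySimpleSub N := by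
  have hxN : ∀ k, x k ∈ N := fun k => hspan ▸ Submodule.subset_span ⟨k, rfl⟩
  refine ⟨hN, isAbsolutelySimple_of_orbit _ (x₀ := ⟨x₀, hx₀⟩) (by simpa using h₀)
    (fun k => ⟨x k, hxN k⟩) hd (fun k => isHomogeneous_restrict hN (hx k)) (fun v => ?_)
    (fun k => ?_)⟩
  · have hv : (v : V) ∈ Submodule.span K (Set.range x) := hspan ▸ v.2
    have himg : (Submodule.span K (Set.range fun k => (⟨x k, hxN k⟩ : N))).map N.subtype =
        Submodule.span K (Set.range x) := by
      rw [Submodule.map_span, ← Set.range_comp]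
      rfl
    rw [← himg] at hv
    obtain ⟨w, hw, hwv⟩ := hv
    rwa [Subtype.ext hwv] at hw
  · obtain ⟨a, c, hc, h⟩ := horb k
    exact ⟨a, c, hc, Subtype.ext h⟩

/-- Over a generating set `{g, h, ε}`: if `z` and `z'` are linearly independent of the same degree,
`h` interchanges their lines, and `ε` and `g ^ 2` act on both by the same scalar, then a
combination of `z` and `z'` generates a proper submodule over the algebraic closure. -/
theorem not_isAbsolutelySimple_of_swap (M : YetterDrinfeld K G V) {g h ε d : G}
    (hgen : Subgroup.closure {g, h, ε} = ⊤) (hgε : g * ε = ε⁻¹ * g) (hhg : h * g = ε * g * h)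
    (hd : g * d * g⁻¹ ≠ d) {z z' : V} (hz : M.IsHomogeneous d z) (hz' : M.IsHomogeneous d z')
    (hind : ∀ a b : K, a • z + b • z' = 0 → a = 0 ∧ b = 0) {α β γ δ : K}
    (hα : α ≠ 0) (hβ : β ≠ 0) (hγ : γ ≠ 0)
    (h₁ : M.act h z = α • z') (h₂ : M.act h z' = β • z)
    (h₃ : M.act ε z = γ • z) (h₄ : M.act ε z' = γ • z')
    (h₅ : M.act g (M.act g z) = δ • z) (h₆ : M.act g (M.act g z') = δ • z') :
    ¬ M.IsAbsolutelySimple := by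
  intro habs
  let L := AlgebraicClosure K
  let φ := algebraMap K L
  obtain ⟨-, hsimple⟩ := habs L
  have hφ : ∀ c : K, c ≠ 0 → φ c ≠ 0 := fun c hc => by simpa [φ] using hc
  -- With `l² = α / β` the vector `e = z + l z'` is an eigenvector: `h e = lβ z + α z' = lβ e`.
  obtain ⟨l, hl⟩ := IsAlgClosed.exists_pow_nat_eq (φ α / φ β) (n := 2) two_pos
  have hl0 : l ≠ 0 := by
    rintro rfl
    have := div_ne_zero (hφ α hα) (hφ β hβ)
    rw [← hl] at this
    simp at this
  have hlβ : l * l * φ β = φ α := by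
    rw [← pow_two, hl, div_mul_cancel₀ _ (hφ β hβ)]
  let M' := M.baseChange L
  let e : L ⊗[K] V := 1 ⊗ₜ z + l ⊗ₜ z'
  have he : M'.IsHomogeneous d e := (hz.tmul_baseChange L 1).add (hz'.tmul_baseChange L l)
  have tmul_eq : ∀ (a : L) (c : K) (v : V), a ⊗ₜ[K] (c • v) = φ c • (a ⊗ₜ[K] v) := by
    intro a c v
    rw [TensorProduct.tmul_smul, algebraMap_smul]
  have tmul_eq' : ∀ (a : L) (v : V), a ⊗ₜ[K] v = a • ((1 : L) ⊗ₜ[K] v) := by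
    intro a v
    simp [TensorProduct.smul_tmul']
  have hhe : M'.act h e = (l * φ β) • e := by
    simp only [e, map_add, M', baseChange_act_tmul, h₁, h₂, tmul_eq, smul_add]
    rw [tmul_eq' l, tmul_eq' l]
    simp only [smul_smul]
    rw [show l * φ β * l = φ α by rw [← hlβ]; ring, add_comm, mul_comm l]
  have hεe : M'.act ε e = φ γ • e := by
    simp only [e, map_add, M', baseChange_act_tmul, h₃, h₄, tmul_eq, smul_add]
  have hg2e : M'.act g (M'.act g e) = φ δ • e := by
    simp only [e, map_add, M', baseChange_act_tmul, h₅, h₆, tmul_eq, smul_add]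
  have hεe' : M'.act ε⁻¹ e = (φ γ)⁻¹ • e := by
    have := congrArg (M'.act ε⁻¹) hεe
    rw [act_inv_act, map_smul] at this
    conv_rhs => rw [this]
    rw [smul_smul, inv_mul_cancel₀ (hφ γ hγ), one_smul]
  have hεge : M'.act ε (M'.act g e) = (φ γ)⁻¹ • M'.act g e := by
    rw [act_act, show ε * g = g * ε⁻¹ by
      rw [eq_mul_inv_iff_mul_eq, mul_assoc, hgε, mul_inv_cancel_left], ← act_act, hεe', map_smul]
  have hhge : M'.act h (M'.act g e) = (l * φ β * (φ γ)⁻¹) • M'.act g e := by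
    rw [act_act, hhg, ← act_act, hhe, map_smul, ← act_act, hεge, smul_smul]
  -- `e` and `g e` are eigenvectors of `h` and `ε`, and `g` interchanges their lines because `g² e`
  -- is a multiple of `e`.
  have hsub : M'.IsSub (Submodule.span L {e, M'.act g e}) := by
    have me : e ∈ Submodule.span L {e, M'.act g e} := Submodule.subset_span (by simp)
    have mge : M'.act g e ∈ Submodule.span L {e, M'.act g e} := Submodule.subset_span (by simp)
    refine M'.isSub_span hgen (by simp) ?_ ?_
    · rintro v (rfl | rfl)
      exacts [⟨_, he⟩, ⟨_, he.act g⟩]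
    · rintro x (rfl | rfl | rfl) v (rfl | rfl)
      · exact mge
      · rw [hg2e]; exact Submodule.smul_mem _ _ me
      · rw [hhe]; exact Submodule.smul_mem _ _ me
      · rw [hhge]; exact Submodule.smul_mem _ _ mge
      · rw [hεe]; exact Submodule.smul_mem _ _ me
      · rw [hεge]; exact Submodule.smul_mem _ _ mge
  have hz0 : z ≠ 0 := fun h => one_ne_zero (hind 1 0 (by simp [h])).1
  have hnot : z' ∉ Submodule.span K {z} := by
    intro hmem
    obtain ⟨c, hc⟩ := Submodule.mem_span_singleton.1 hmem
    have := (hind c (-1) (by rw [hc]; simp)).2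
    simp at this
  -- A functional killing `z` but not `z'` does not kill `e`. This gives `e ≠ 0` and also separates
  -- `1 ⊗ z` from the line of `e`.
  obtain ⟨f, hf, hker⟩ := Submodule.exists_le_ker_of_notMem hnot
  have hfz : f z = 0 := hker (Submodule.mem_span_singleton_self z)
  have hfe : f.baseChange L e = (l * φ (f z')) ⊗ₜ 1 := by
    have : l ⊗ₜ[K] f z' = (l * φ (f z')) ⊗ₜ[K] (1 : K) := by
      rw [show f z' = f z' • (1 : K) by simp, ← TensorProduct.smul_tmul, Algebra.smul_def, mul_comm]
      simp [φ]
    simp [e, hfz, this]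
  have hfe0 : ∀ c : L, f.baseChange L (c • e) = 0 → c = 0 := by
    intro c hc
    have := congrArg (TensorProduct.rid K L) hc
    rw [map_smul, hfe] at this
    simpa [TensorProduct.smul_tmul', hl0, φ, hf] using this
  rcases hsimple _ hsub with hbot | htop
  · have he0 : e = 0 := by
      rw [← Submodule.mem_bot L, ← hbot]
      exact Submodule.subset_span (by simp)
    exact one_ne_zero (hfe0 1 (by rw [he0]; simp))
  · have hmem : (1 : L) ⊗ₜ[K] z ∈ Submodule.span L {e, M'.act g e} := htop ▸ Submodule.mem_top
    obtain ⟨a, b, hab⟩ := Submodule.mem_span_pair.1 hmem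
    -- In degree `d` only the multiple of `e` survives, as `g e` has another degree. So `1 ⊗ z`
    -- would be a multiple of `e`, which `f` excludes.
    have hdeg := congrArg (fun v => M'.coact v d) hab
    simp only [map_add, map_smul, Finsupp.add_apply, Finsupp.smul_apply, he.coact_self,
      (he.act g).coact_of_ne hd, smul_zero, add_zero] at hdeg
    rw [show M'.coact ((1 : L) ⊗ₜ[K] z) d = 1 ⊗ₜ[K] z from
      (hz.tmul_baseChange L 1).coact_self] at hdeg
    have ha : a = 0 := hfe0 a (by rw [hdeg]; simp [hfz])
    rw [ha, zero_smul] at hdeg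
    exact one_tmul_ne_zero L hz0 hdeg.symm

theorem not_isAbsolutelySimpleSub_of_swap {M : YetterDrinfeld K G V} {N : Submodule K V}
    {g h ε d : G}
    (hgen : Subgroup.closure {g, h, ε} = ⊤) (hgε : g * ε = ε⁻¹ * g) (hhg : h * g = ε * g * h)
    (hd : g * d * g⁻¹ ≠ d) {z z' : V} (hzN : z ∈ N) (hzN' : z' ∈ N)
    (hz : M.IsHomogeneous d z) (hz' : M.IsHomogeneous d z')
    (hind : ∀ a b : K, a • z + b • z' = 0 → a = 0 ∧ b = 0) {α β γ δ : K}
    (hα : α ≠ 0) (hβ : β ≠ 0) (hγ : γ ≠ 0)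
    (h₁ : M.act h z = α • z') (h₂ : M.act h z' = β • z)
    (h₃ : M.act ε z = γ • z) (h₄ : M.act ε z' = γ • z')
    (h₅ : M.act g (M.act g z) = δ • z) (h₆ : M.act g (M.act g z') = δ • z') :
    ¬ M.IsAbsolutelySimpleSub N := by
  rintro ⟨hN, habs⟩
  refine not_isAbsolutelySimple_of_swap (M.restrict N hN) hgen hgε hhg hd (z := ⟨z, hzN⟩)
    (z' := ⟨z', hzN'⟩) (isHomogeneous_restrict hN hz) (isHomogeneous_restrict hN hz')
    (fun a b hab => hind a b (congrArg Subtype.val hab)) hα hβ hγ (Subtype.ext h₁) (Subtype.ext h₂)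
    (Subtype.ext h₃) (Subtype.ext h₄) (Subtype.ext h₅) (Subtype.ext h₆) habs

end AbsoluteSimplicity

end YetterDrinfeld

/-! ### Quotients of `Γ_4`: the basis table and relations in degree two -/

namespace YetterDrinfeld

/-- Rewriting rules for the normal form `ε ^ i g ^ j h ^ k` in quotients of `Γ_4`. -/
theorem gammaFour_rewrites {G : Type*} [Group G] {g h ε : G} (h₁ : h * g = ε * (g * h))
    (h₂ : g * ε = ε * (ε * (ε * g))) (h₃ : h * ε = ε * h) (h₄ : ε * (ε * (ε * ε)) = 1) :
    h * g = ε * (g * h) ∧ (∀ a, h * (g * a) = ε * (g * (h * a))) ∧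
    g * ε = ε * (ε * (ε * g)) ∧ (∀ a, g * (ε * a) = ε * (ε * (ε * (g * a)))) ∧
    h * ε = ε * h ∧ (∀ a, h * (ε * a) = ε * (h * a)) ∧
    ε * (ε * (ε * ε)) = 1 ∧ ∀ a, ε * (ε * (ε * (ε * a))) = a := by
  refine ⟨h₁, fun a => ?_, h₂, fun a => ?_, h₃, fun a => ?_, h₄, fun a => ?_⟩
  · rw [← mul_assoc, h₁]; simp only [mul_assoc]
  · rw [← mul_assoc, h₂]; simp only [mul_assoc]
  · rw [← mul_assoc, h₃]; simp only [mul_assoc]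
  · conv_rhs => rw [← one_mul a, ← h₄]
    simp only [mul_assoc]

/-- Homogeneous vectors `v₀, v₁` and `w₀, …, w₃` of a Yetter-Drinfeld module over a quotient of
`Γ_4` which are permuted up to scalars by the generators in the same way as the natural bases of
`M(h, ρ)` and `M(g, σ)`, where `r = ρ(ε)`, `p = ρ(g ^ 2)`, `s = σ(ε⁻¹ h ^ 2)`, `t = σ(ε ^ 2)`. -/
structure GammaFourPair {K G U : Type*} [Field K] [Group G] [AddCommGroup U] [Module K U]
    (M : YetterDrinfeld K G U) (g h ε : G) (r p s t : K) (v₀ v₁ w₀ w₁ w₂ w₃ : U) : Prop where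
  closure_eq_top : Subgroup.closure {g, h, ε} = ⊤
  sq_ne_one : ε * ε ≠ 1
  h_mul_g : h * g = ε * (g * h)
  g_mul_ε : g * ε = ε * (ε * (ε * g))
  h_mul_ε : h * ε = ε * h
  ε_pow : ε * (ε * (ε * ε)) = 1
  r_eq : r = p * s
  r_pow : r ^ 4 = 1
  t_sq : t ^ 2 = 1
  v₀_ne_zero : v₀ ≠ 0
  w₀_ne_zero : w₀ ≠ 0
  v₀_hom : M.IsHomogeneous h v₀
  v₁_hom : M.IsHomogeneous (ε * (ε * (ε * h))) v₁
  w₀_hom : M.IsHomogeneous g w₀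
  w₁_hom : M.IsHomogeneous (ε * g) w₁
  w₂_hom : M.IsHomogeneous (ε * (ε * g)) w₂
  w₃_hom : M.IsHomogeneous (ε * (ε * (ε * g))) w₃
  table : (M.act g v₀ = v₁ ∧ M.act g v₁ = p • v₀ ∧ M.act h v₀ = -v₀ ∧ M.act h v₁ = (-r ^ 3) • v₁ ∧
    M.act ε v₀ = r • v₀ ∧ M.act ε v₁ = r ^ 3 • v₁) ∧
    (M.act g w₀ = -w₀ ∧ M.act g w₁ = -t • w₃ ∧ M.act g w₂ = -t • w₂ ∧ M.act g w₃ = -t • w₁) ∧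
    (M.act h w₀ = w₁ ∧ M.act h w₁ = s • w₂ ∧ M.act h w₂ = w₃ ∧ M.act h w₃ = (s * t) • w₀) ∧
    (M.act ε w₀ = w₂ ∧ M.act ε w₁ = w₃ ∧ M.act ε w₂ = t • w₀ ∧ M.act ε w₃ = t • w₁)

namespace GammaFourPair

variable {K G U : Type*} [Field K] [Group G] [AddCommGroup U] [Module K U]
  {M : YetterDrinfeld K G U} {g h ε : G} {r p s t : K} {v₀ v₁ w₀ w₁ w₂ w₃ : U}
  (D : GammaFourPair M g h ε r p s t v₀ v₁ w₀ w₁ w₂ w₃)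

include D

theorem r_ne_zero : r ≠ 0 := by
  rintro rfl
  simpa using D.r_pow

theorem s_ne_zero : s ≠ 0 := by
  rintro rfl
  exact D.r_ne_zero (by rw [D.r_eq, mul_zero])

theorem p_ne_zero : p ≠ 0 := by
  rintro rfl
  exact D.r_ne_zero (by rw [D.r_eq, zero_mul])

theorem t_ne_zero : t ≠ 0 := by
  rintro rfl
  simpa using D.t_sq

/-- A single conjunction, so that `simp only [D.rel]` uses all rules at once. The versions with a
trailing factor `a` fire inside right-associated products. -/
theorem rel : h * g = ε * (g * h) ∧ (∀ a, h * (g * a) = ε * (g * (h * a))) ∧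
    g * ε = ε * (ε * (ε * g)) ∧ (∀ a, g * (ε * a) = ε * (ε * (ε * (g * a)))) ∧
    h * ε = ε * h ∧ (∀ a, h * (ε * a) = ε * (h * a)) ∧
    ε * (ε * (ε * ε)) = 1 ∧ ∀ a, ε * (ε * (ε * (ε * a))) = a :=
  gammaFour_rewrites D.h_mul_g D.g_mul_ε D.h_mul_ε D.ε_pow

theorem ε_ne_one : ε ≠ 1 := fun h => D.sq_ne_one (by rw [h, one_mul])

theorem ε_cube_ne_one : ε * (ε * ε) ≠ 1 := fun h => D.ε_ne_one (by
  have := D.ε_pow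
  rwa [h, mul_one] at this)

theorem ε_mul_ne (a : G) : ε * a ≠ a := fun h => D.ε_ne_one (mul_eq_right.1 h)

theorem ε_ε_mul_ne (a : G) : ε * (ε * a) ≠ a := fun h =>
  D.sq_ne_one (mul_eq_right.1 ((mul_assoc ε ε a).trans h))

theorem ε_ε_ε_mul_ne (a : G) : ε * (ε * (ε * a)) ≠ a := fun h =>
  D.ε_cube_ne_one (mul_eq_right.1 (by simpa only [mul_assoc] using h))

/-- The elements `a, ε a, ε² a, ε³ a` are pairwise distinct. -/
theorem injective_deg (a : G) :
    Function.Injective ![a, ε * a, ε * (ε * a), ε * (ε * (ε * a))] := by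
  have h₁ := D.ε_mul_ne
  have h₂ := D.ε_ε_mul_ne
  have h₃ := D.ε_ε_ε_mul_ne
  have h₁' := fun a => (h₁ a).symm
  have h₂' := fun a => (h₂ a).symm
  have h₃' := fun a => (h₃ a).symm
  intro i j
  fin_cases i <;> fin_cases j <;> simp_all

/-- The four degrees of `W` differ by powers of `ε`, which centralize `h`, so they all conjugate in
the same way. -/
theorem conj_h {x : G} (hx : x = g ∨ x = ε * g ∨ x = ε * (ε * g) ∨ x = ε * (ε * (ε * g))) :
    x * h * x⁻¹ = ε * (ε * (ε * h)) := by
  rw [mul_inv_eq_iff_eq_mul]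
  rcases hx with rfl | rfl | rfl | rfl <;> simp only [mul_assoc, D.rel]

theorem conj_ε_h {x : G} (hx : x = g ∨ x = ε * g ∨ x = ε * (ε * g) ∨ x = ε * (ε * (ε * g))) :
    x * (ε * (ε * (ε * h))) * x⁻¹ = h := by
  rw [mul_inv_eq_iff_eq_mul]
  rcases hx with rfl | rfl | rfl | rfl <;> simp only [mul_assoc, D.rel]

/-! ### Conjugates of degrees -/

theorem conj_v₀_w₀ : h * g * h⁻¹ = ε * g := by
  rw [mul_inv_eq_iff_eq_mul]; simp only [mul_assoc, D.rel]

theorem conj_v₁_w₀ : ε * (ε * (ε * h)) * g * (ε * (ε * (ε * h)))⁻¹ = ε * (ε * (ε * g)) := by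
  rw [mul_inv_eq_iff_eq_mul]; simp only [mul_assoc, D.rel]

theorem conj_v₀_w₁ : h * (ε * g) * h⁻¹ = ε * (ε * g) := by
  rw [mul_inv_eq_iff_eq_mul]; simp only [mul_assoc, D.rel]

theorem conj_v₁_w₁ : ε * (ε * (ε * h)) * (ε * g) * (ε * (ε * (ε * h)))⁻¹ = g := by
  rw [mul_inv_eq_iff_eq_mul]; simp only [mul_assoc, D.rel]

theorem conj_v₀_w₂ : h * (ε * (ε * g)) * h⁻¹ = ε * (ε * (ε * g)) := by
  rw [mul_inv_eq_iff_eq_mul]; simp only [mul_assoc, D.rel]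

theorem conj_v₁_w₂ : ε * (ε * (ε * h)) * (ε * (ε * g)) * (ε * (ε * (ε * h)))⁻¹ = ε * g := by
  rw [mul_inv_eq_iff_eq_mul]; simp only [mul_assoc, D.rel]

theorem conj_v₀_w₃ : h * (ε * (ε * (ε * g))) * h⁻¹ = g := by
  rw [mul_inv_eq_iff_eq_mul]; simp only [D.rel]

theorem conj_v₁_w₃ : ε * (ε * (ε * h)) * (ε * (ε * (ε * g))) * (ε * (ε * (ε * h)))⁻¹ = ε * (ε * g) := by
  rw [mul_inv_eq_iff_eq_mul]; simp only [mul_assoc, D.rel]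

/-! ### Relations in `(ad W)(V)` -/

/-- The derivatives of the two sides are combinations of `v₀` and `v₁` with coefficients involving
`f w₀` and `f w₁`. Those of `v₀` agree by the choice of the factor, those of `v₁` because `p s r³ =
r⁴ = 1`. The next three relations arise in the same way. -/
theorem ad_w₀_v₁ : M.ad w₀ (M.nicholsι v₁) = (-p) • M.ad w₁ (M.nicholsι v₀) :=
  ad_ι_eq_smul D.w₀_hom D.v₁_hom D.w₁_hom D.v₀_hom fun f => by
    rw [D.conj_h (by simp), D.conj_ε_h (by simp)]
    simp only [map_mul, Module.End.mul_apply, D.table, map_smul, smul_eq_mul]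
    have h₁ := D.r_pow
    have h₂ := D.t_sq
    have h₃ := D.r_eq
    match_scalars <;> grind

theorem ad_w₁_v₁ : M.ad w₁ (M.nicholsι v₁) = (-r ^ 2) • M.ad w₂ (M.nicholsι v₀) :=
  ad_ι_eq_smul D.w₁_hom D.v₁_hom D.w₂_hom D.v₀_hom fun f => by
    rw [D.conj_h (by simp), D.conj_ε_h (by simp)]
    simp only [map_mul, Module.End.mul_apply, D.table, map_smul, smul_eq_mul]
    have h₁ := D.r_pow
    have h₂ := D.t_sq
    have h₃ := D.r_eq
    match_scalars <;> grind

theorem ad_w₂_v₁ : M.ad w₂ (M.nicholsι v₁) = (-(p * r ^ 2)) • M.ad w₃ (M.nicholsι v₀) :=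
  ad_ι_eq_smul D.w₂_hom D.v₁_hom D.w₃_hom D.v₀_hom fun f => by
    rw [D.conj_h (by simp), D.conj_ε_h (by simp)]
    simp only [map_mul, Module.End.mul_apply, D.table, map_smul, smul_eq_mul]
    have h₁ := D.r_pow
    have h₂ := D.t_sq
    have h₃ := D.r_eq
    match_scalars <;> grind

theorem ad_w₃_v₁ : M.ad w₃ (M.nicholsι v₁) = (-t) • M.ad w₀ (M.nicholsι v₀) :=
  ad_ι_eq_smul D.w₃_hom D.v₁_hom D.w₀_hom D.v₀_hom fun f => by
    rw [D.conj_h (by simp), D.conj_ε_h (by simp)]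
    simp only [map_mul, Module.End.mul_apply, D.table, map_smul, smul_eq_mul]
    have h₁ := D.r_pow
    have h₂ := D.t_sq
    have h₃ := D.r_eq
    match_scalars <;> grind

/-! ### Relations in `(ad V)(W)` -/

/-- The mirror image of the relations in `(ad W)(V)`: the factor is fixed by `p s = r`, and the
remaining coefficient agrees by `r⁴ = 1`. -/
theorem ad_v₁_w₁ : M.ad v₁ (M.nicholsι w₁) = (-r) • M.ad v₀ (M.nicholsι w₀) :=
  ad_ι_eq_smul D.v₁_hom D.w₁_hom D.v₀_hom D.w₀_hom fun f => by
    rw [D.conj_v₁_w₁, D.conj_v₀_w₀]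
    simp only [map_mul, Module.End.mul_apply, D.table, map_smul, smul_eq_mul]
    have h₁ := D.r_pow
    have h₂ := D.t_sq
    have h₃ := D.r_eq
    match_scalars <;> grind

theorem ad_v₁_w₂ : M.ad v₁ (M.nicholsι w₂) = (-(p * r)) • M.ad v₀ (M.nicholsι w₁) :=
  ad_ι_eq_smul D.v₁_hom D.w₂_hom D.v₀_hom D.w₁_hom fun f => by
    rw [D.conj_v₁_w₂, D.conj_v₀_w₁]
    simp only [map_mul, Module.End.mul_apply, D.table, map_smul, smul_eq_mul]
    have h₁ := D.r_pow
    have h₂ := D.t_sq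
    have h₃ := D.r_eq
    match_scalars <;> grind

theorem ad_v₁_w₃ : M.ad v₁ (M.nicholsι w₃) = (-r ^ 3) • M.ad v₀ (M.nicholsι w₂) :=
  ad_ι_eq_smul D.v₁_hom D.w₃_hom D.v₀_hom D.w₂_hom fun f => by
    rw [D.conj_v₁_w₃, D.conj_v₀_w₂]
    simp only [map_mul, Module.End.mul_apply, D.table, map_smul, smul_eq_mul]
    have h₁ := D.r_pow
    have h₂ := D.t_sq
    have h₃ := D.r_eq
    match_scalars <;> grind

theorem ad_v₁_w₀ : M.ad v₁ (M.nicholsι w₀) = (-(t * p * r ^ 3)) • M.ad v₀ (M.nicholsι w₃) :=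
  ad_ι_eq_smul D.v₁_hom D.w₀_hom D.v₀_hom D.w₃_hom fun f => by
    rw [D.conj_v₁_w₀, D.conj_v₀_w₃]
    simp only [map_mul, Module.End.mul_apply, D.table, map_smul, smul_eq_mul]
    have h₁ := D.r_pow
    have h₂ := D.t_sq
    have h₃ := D.r_eq
    match_scalars <;> grind

end GammaFourPair

end YetterDrinfeld

namespace YetterDrinfeld

namespace GammaFourPair

/-! ### Explicit elements of degrees two and three -/

section Elements

variable {K G U : Type*} [Field K] [Group G] [AddCommGroup U] [Module K U]
  {M : YetterDrinfeld K G U} {g h ε : G} {r p s t : K} {v₀ v₁ w₀ w₁ w₂ w₃ : U}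
  (D : GammaFourPair M g h ε r p s t v₀ v₁ w₀ w₁ w₂ w₃)

include D

/-! ### Nonvanishing in degree two -/

theorem ι_v₀_ne_zero : M.nicholsι v₀ ≠ 0 := fun h =>
  D.v₀_ne_zero (M.nicholsι_injective (h.trans (map_zero _).symm))

theorem ι_w₀_ne_zero : M.nicholsι w₀ ≠ 0 := fun h =>
  D.w₀_ne_zero (M.nicholsι_injective (h.trans (map_zero _).symm))

theorem exists_dual_w₀ : ∃ f : Module.Dual K U, f w₀ = 1 ∧ f w₁ = 0 ∧ f w₂ = 0 ∧ f w₃ = 0 := by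
  obtain ⟨f, hf, hf'⟩ := exists_dual_of_isHomogeneous D.w₀_hom D.w₀_ne_zero
  exact ⟨f, hf, hf' _ _ D.w₁_hom (D.ε_mul_ne _), hf' _ _ D.w₂_hom (D.ε_ε_mul_ne _),
    hf' _ _ D.w₃_hom (D.ε_ε_ε_mul_ne _)⟩

theorem exists_dual_w₁ : ∃ f : Module.Dual K U, f w₀ = 0 ∧ f w₁ = 1 ∧ f w₂ = 0 ∧ f w₃ = 0 := by
  have h₁ : w₁ ≠ 0 := by
    have := act_ne_zero (M := M) h D.w₀_ne_zero
    rwa [D.table.2.2.1.1] at this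
  obtain ⟨f, hf, hf'⟩ := exists_dual_of_isHomogeneous D.w₁_hom h₁
  exact ⟨f, hf' _ _ D.w₀_hom (D.ε_mul_ne _).symm, hf, hf' _ _ D.w₂_hom (D.ε_mul_ne _),
    hf' _ _ D.w₃_hom (D.ε_ε_mul_ne _)⟩

theorem exists_dual_v₀ : ∃ f : Module.Dual K U, f v₀ = 1 ∧ f v₁ = 0 := by
  obtain ⟨f, hf, hf'⟩ := exists_dual_of_isHomogeneous D.v₀_hom D.v₀_ne_zero
  exact ⟨f, hf, hf' _ _ D.v₁_hom (D.ε_ε_ε_mul_ne _)⟩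

/-- The skew derivation dual to `w₀` sends this element to `v₀`: the subtracted term only sees `f
w₃`. -/
theorem ad_w₀_v₀_ne_zero : M.ad w₀ (M.nicholsι v₀) ≠ 0 := by
  obtain ⟨f, hf₀, -, -, hf₃⟩ := D.exists_dual_w₀
  intro h0
  have := M.nicholsDer_ad_ι D.w₀_hom D.v₀_hom f
  rw [h0, map_zero, D.conj_h (by simp)] at this
  simp only [map_mul, Module.End.mul_apply, D.table, map_smul, hf₀, hf₃, smul_zero,
    zero_smul, sub_zero, one_smul] at this
  exact D.ι_v₀_ne_zero this.symm

theorem ad_v₀_w₀_ne_zero : M.ad v₀ (M.nicholsι w₀) ≠ 0 := by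
  obtain ⟨f, hf₀, hf₁⟩ := D.exists_dual_v₀
  intro h0
  have := M.nicholsDer_ad_ι D.v₀_hom D.w₀_hom f
  rw [h0, map_zero, D.conj_v₀_w₀] at this
  simp only [map_mul, Module.End.mul_apply, D.table, map_smul, hf₀, hf₁, smul_zero,
    zero_smul, sub_zero, one_smul] at this
  exact D.ι_w₀_ne_zero this.symm

/-- `h` fixes the line of `v₀` and shifts the lines of the `w_i`. These shifts transport
nonvanishing and later exhibit a single orbit. -/
theorem act_h_ad_w₀ : M.nichols.act h (M.ad w₀ (M.nicholsι v₀)) =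
    (-1 : K) • M.ad w₁ (M.nicholsι v₀) := by
  simp only [act_ad, nichols_act_ι, D.table, map_neg, neg_smul, one_smul]

theorem act_h_ad_w₁ : M.nichols.act h (M.ad w₁ (M.nicholsι v₀)) =
    (-s) • M.ad w₂ (M.nicholsι v₀) := by
  simp only [act_ad, nichols_act_ι, D.table, map_neg, neg_smul, map_smul, LinearMap.smul_apply]

theorem act_h_ad_w₂ : M.nichols.act h (M.ad w₂ (M.nicholsι v₀)) =
    (-1 : K) • M.ad w₃ (M.nicholsι v₀) := by
  simp only [act_ad, nichols_act_ι, D.table, map_neg, neg_smul, one_smul]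

theorem ad_w₁_v₀_ne_zero : M.ad w₁ (M.nicholsι v₀) ≠ 0 := fun h0 =>
  act_ne_zero (M := M.nichols) h D.ad_w₀_v₀_ne_zero (by rw [D.act_h_ad_w₀, h0, smul_zero])

theorem ad_w₂_v₀_ne_zero : M.ad w₂ (M.nicholsι v₀) ≠ 0 := fun h0 =>
  act_ne_zero (M := M.nichols) h D.ad_w₁_v₀_ne_zero (by rw [D.act_h_ad_w₁, h0, smul_zero])

theorem ad_w₃_v₀_ne_zero : M.ad w₃ (M.nicholsι v₀) ≠ 0 := fun h0 =>
  act_ne_zero (M := M.nichols) h D.ad_w₂_v₀_ne_zero (by rw [D.act_h_ad_w₂, h0, smul_zero])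

/-! ### Degree three -/

theorem ad_w₀_self (y : M.NicholsAlgebra) : M.ad w₀ (M.ad w₀ y) = 0 :=
  ad_ad_self D.w₀_hom D.table.2.1.1 y

/-- The degree of `w₁` acts on it by `-t² = -1`. In general `w_i` comes from `w₀` by a group
element, and conjugation preserves the eigenvalue `σ(g) = -1`. -/
theorem ad_w₁_self (y : M.NicholsAlgebra) : M.ad w₁ (M.ad w₁ y) = 0 :=
  ad_ad_self D.w₁_hom (by
    simp only [map_mul, Module.End.mul_apply, D.table, map_smul, smul_smul]
    have := D.t_sq
    match_scalars; grind) y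

theorem ad_w₂_self (y : M.NicholsAlgebra) : M.ad w₂ (M.ad w₂ y) = 0 :=
  ad_ad_self D.w₂_hom (by
    simp only [map_mul, Module.End.mul_apply, D.table, map_smul, smul_smul]
    have := D.t_sq
    match_scalars; grind) y

theorem ad_w₃_self (y : M.NicholsAlgebra) : M.ad w₃ (M.ad w₃ y) = 0 :=
  ad_ad_self D.w₃_hom (by
    simp only [map_mul, Module.End.mul_apply, D.table, map_smul, smul_smul]
    have := D.t_sq
    match_scalars; grind) y

theorem ad_v₀_self (y : M.NicholsAlgebra) : M.ad v₀ (M.ad v₀ y) = 0 :=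
  ad_ad_self D.v₀_hom D.table.1.2.2.1 y

theorem ad_v₁_self (y : M.NicholsAlgebra) : M.ad v₁ (M.ad v₁ y) = 0 :=
  ad_ad_self D.v₁_hom (by
    simp only [map_mul, Module.End.mul_apply, D.table, map_smul, smul_smul]
    have := D.r_pow
    match_scalars; grind) y

/-- The degrees `g` and `ε² g` commute and each of `w₀`, `w₂` sees the other with eigenvalue `-t`,
so `t² = 1` makes the double braiding trivial. -/
theorem ad_w₂_w₀ (y : M.NicholsAlgebra) : M.ad w₂ (M.ad w₀ y) = -t • M.ad w₀ (M.ad w₂ y) := by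
  refine ad_ad_comm (q' := -t) D.w₂_hom D.w₀_hom (by simp only [mul_assoc, D.rel]) ?_ ?_ ?_ y
  · simp only [map_mul, Module.End.mul_apply, D.table, map_neg, neg_smul]
  · simp only [D.table]
  · linear_combination D.t_sq

theorem ad_w₃_w₁ (y : M.NicholsAlgebra) : M.ad w₃ (M.ad w₁ y) = -t • M.ad w₁ (M.ad w₃ y) := by
  have := D.t_sq
  refine ad_ad_comm (q' := -t) D.w₃_hom D.w₁_hom (by simp only [mul_assoc, D.rel]) ?_ ?_ ?_ y
  · simp only [map_mul, Module.End.mul_apply, D.table, map_smul, smul_smul]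
    match_scalars; grind
  · simp only [map_mul, Module.End.mul_apply, D.table, map_smul]
  · linear_combination D.t_sq

/-- The product rule also yields terms in `ad w_i v₁`; the degree two relations turn them into
multiples of the four vectors `ad w_j v₀`, so that coefficients can be compared. -/
theorem nicholsDer_ad_w₀_w₂ (f : Module.Dual K U) :
    M.nicholsDer f (M.ad w₀ (M.ad w₂ (M.nicholsι v₀))) =
      f w₀ • M.ad w₂ (M.nicholsι v₀) + (p * r ^ 2 * f w₁) • M.ad w₃ (M.nicholsι v₀) -
      (t * f w₂) • M.ad w₀ (M.nicholsι v₀) - (t * p * r ^ 2 * f w₃) • M.ad w₁ (M.nicholsι v₀) := by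
  have h₁ := D.r_pow
  have h₂ := D.t_sq
  have h₃ := D.r_eq
  rw [nicholsDer_ad D.w₀_hom (D.w₂_hom.ad D.v₀_hom.nicholsι), nicholsDer_ad_ι D.w₂_hom D.v₀_hom,
    D.conj_h (by simp), show g * (ε * (ε * g) * h) * g⁻¹ = ε * (ε * (ε * (g * h))) by
      rw [mul_inv_eq_iff_eq_mul]; simp only [mul_assoc, D.rel]]
  simp only [act_ad, nichols_act_ι, map_mul, Module.End.mul_apply, D.table, map_smul, map_sub,
    LinearMap.comp_apply, smul_eq_mul, LinearMap.smul_apply, D.ad_w₀_v₁, D.ad_w₂_v₁]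
  match_scalars <;> grind

theorem act_h_ad_w₀_w₂ : M.nichols.act h (M.ad w₀ (M.ad w₂ (M.nicholsι v₀))) =
    (-1 : K) • M.ad w₁ (M.ad w₃ (M.nicholsι v₀)) := by
  simp only [act_ad, nichols_act_ι, D.table, map_neg, neg_smul, one_smul]

theorem act_h_ad_w₁_w₃ : M.nichols.act h (M.ad w₁ (M.ad w₃ (M.nicholsι v₀))) =
    s ^ 2 • M.ad w₀ (M.ad w₂ (M.nicholsι v₀)) := by
  have := D.t_sq
  simp only [act_ad, nichols_act_ι, D.table, map_neg, map_smul, LinearMap.smul_apply, D.ad_w₂_w₀]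
  match_scalars; grind

/-- Transported from the previous formula by `h`, using the equivariance of skew derivations. -/
theorem nicholsDer_ad_w₁_w₃ (f : Module.Dual K U) :
    M.nicholsDer f (M.ad w₁ (M.ad w₃ (M.nicholsι v₀))) =
      (-(r ^ 3 * s * f w₀)) • M.ad w₂ (M.nicholsι v₀) + f w₁ • M.ad w₃ (M.nicholsι v₀) +
      (r ^ 3 * s * t * f w₂) • M.ad w₀ (M.nicholsι v₀) - (t * f w₃) • M.ad w₁ (M.nicholsι v₀) := by
  have h₁ := D.r_pow
  have h₂ := D.t_sq
  have h₃ := D.r_eq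
  have h₄ := M.nicholsDer_act f h (M.ad w₀ (M.ad w₂ (M.nicholsι v₀)))
  rw [D.act_h_ad_w₀_w₂, map_smul, neg_one_smul, neg_eq_iff_eq_neg, D.nicholsDer_ad_w₀_w₂] at h₄
  rw [h₄]
  simp only [act_ad, nichols_act_ι, D.table, map_smul, map_sub, map_add, map_neg,
    LinearMap.comp_apply, smul_eq_mul, LinearMap.smul_apply]
  match_scalars <;> grind

/-- The coefficient of `f w₀` forces the factor `-r³ s`. That of `f w₁` then asks for `1 = -p s r⁵ =
-r⁶ = -r²`, which is where the hypothesis on `r` enters. -/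
theorem ad_w₁_w₃_eq (hr : r ^ 2 = -1) : M.ad w₁ (M.ad w₃ (M.nicholsι v₀)) =
    (-(r ^ 3 * s)) • M.ad w₀ (M.ad w₂ (M.nicholsι v₀)) := by
  have h₁ := D.r_pow
  have h₂ := D.t_sq
  have h₃ := D.r_eq
  refine eq_of_nicholsDer (nicholsCounit_ad _ _) ?_ fun f => ?_
  · rw [map_smul, nicholsCounit_ad, smul_zero]
  · rw [map_smul, D.nicholsDer_ad_w₀_w₂, D.nicholsDer_ad_w₁_w₃]
    match_scalars <;> grind

/-- The derivations dual to `w₀` and `w₁` give a linear system in `a`, `b` of determinant `1 + p s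
r⁵ = 1 + r²`. -/
theorem linearIndependent_ad_ad (hr : r ^ 2 ≠ -1) (a b : K)
    (hab : a • M.ad w₀ (M.ad w₂ (M.nicholsι v₀)) + b • M.ad w₁ (M.ad w₃ (M.nicholsι v₀)) = 0) :
    a = 0 ∧ b = 0 := by
  have h₁ := D.r_pow
  have h₃ := D.r_eq
  obtain ⟨f, hf₀, hf₁, hf₂, hf₃⟩ := D.exists_dual_w₀
  obtain ⟨f', hf₀', hf₁', hf₂', hf₃'⟩ := D.exists_dual_w₁
  have e₁ := congrArg (M.nicholsDer f) hab
  have e₂ := congrArg (M.nicholsDer f') hab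
  rw [map_add, map_smul, map_smul, D.nicholsDer_ad_w₀_w₂, D.nicholsDer_ad_w₁_w₃, map_zero] at e₁ e₂
  have e₁ : (a - b * (r ^ 3 * s)) • M.ad w₂ (M.nicholsι v₀) = 0 := by
    rw [← e₁, hf₀, hf₁, hf₂, hf₃]
    module
  have e₂ : (a * (p * r ^ 2) + b) • M.ad w₃ (M.nicholsι v₀) = 0 := by
    rw [← e₂, hf₀', hf₁', hf₂', hf₃']
    module
  have e₁ := (smul_eq_zero.1 e₁).resolve_right D.ad_w₂_v₀_ne_zero
  have e₂ := (smul_eq_zero.1 e₂).resolve_right D.ad_w₃_v₀_ne_zero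
  -- Elimination of `a`; the determinant first appears as `r⁶ + 1`.
  have e₃ : b * (r ^ 2 + 1) = 0 := by
    have : r ^ 6 = r ^ 2 := by linear_combination r ^ 2 * h₁
    rw [← this]
    linear_combination e₂ - p * r ^ 2 * e₁ + b * r ^ 5 * h₃
  have hb : b = 0 := (mul_eq_zero.1 e₃).resolve_right fun h => hr (by linear_combination h)
  refine ⟨?_, hb⟩
  rw [hb] at e₁
  linear_combination e₁

theorem ad_w₀_w₂_ne_zero : M.ad w₀ (M.ad w₂ (M.nicholsι v₀)) ≠ 0 := by
  obtain ⟨f, hf₀, hf₁, hf₂, hf₃⟩ := D.exists_dual_w₀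
  intro h0
  have := D.nicholsDer_ad_w₀_w₂ f
  rw [h0, map_zero, hf₀, hf₁, hf₂, hf₃] at this
  simp only [mul_zero, zero_smul, one_smul, add_zero, sub_zero] at this
  exact D.ad_w₂_v₀_ne_zero this.symm

theorem act_g_ad_w₀_w₂ : M.nichols.act g (M.ad w₀ (M.ad w₂ (M.nicholsι v₀))) =
    t • M.ad w₀ (M.ad w₂ (M.nicholsι v₁)) := by
  simp only [act_ad, nichols_act_ι, D.table, map_neg, map_smul, LinearMap.smul_apply,
    LinearMap.neg_apply]
  module

theorem act_g_ad_w₁_w₃ : M.nichols.act g (M.ad w₁ (M.ad w₃ (M.nicholsι v₀))) =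
    (-t) • M.ad w₁ (M.ad w₃ (M.nicholsι v₁)) := by
  have h₂ := D.t_sq
  simp only [act_ad, nichols_act_ι, D.table, map_smul, LinearMap.smul_apply, D.ad_w₃_w₁]
  match_scalars; grind

theorem act_g_g_ad_w₀_w₂ :
    M.nichols.act g (M.nichols.act g (M.ad w₀ (M.ad w₂ (M.nicholsι v₀)))) =
      p • M.ad w₀ (M.ad w₂ (M.nicholsι v₀)) := by
  have h₂ := D.t_sq
  simp only [act_ad, nichols_act_ι, D.table, map_neg, map_smul, LinearMap.smul_apply,
    LinearMap.neg_apply]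
  match_scalars; grind

theorem act_g_g_ad_w₁_w₃ :
    M.nichols.act g (M.nichols.act g (M.ad w₁ (M.ad w₃ (M.nicholsι v₀)))) =
      p • M.ad w₁ (M.ad w₃ (M.nicholsι v₀)) := by
  have h₂ := D.t_sq
  simp only [act_ad, nichols_act_ι, D.table, map_smul, LinearMap.smul_apply]
  match_scalars; grind

/-- `ε` interchanges `w₀` and `w₂` up to scalars; restoring the order contributes `-t`, for a total
of `r · t · (-t) = -r`. The pair `w₁`, `w₃` has the same eigenvalue, as the swap criterion requires.
-/
theorem act_ε_ad_w₀_w₂ : M.nichols.act ε (M.ad w₀ (M.ad w₂ (M.nicholsι v₀))) =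
    (-r) • M.ad w₀ (M.ad w₂ (M.nicholsι v₀)) := by
  have h₂ := D.t_sq
  simp only [act_ad, nichols_act_ι, D.table, map_smul, LinearMap.smul_apply, D.ad_w₂_w₀]
  match_scalars; grind

theorem act_ε_ad_w₁_w₃ : M.nichols.act ε (M.ad w₁ (M.ad w₃ (M.nicholsι v₀))) =
    (-r) • M.ad w₁ (M.ad w₃ (M.nicholsι v₀)) := by
  have h₂ := D.t_sq
  simp only [act_ad, nichols_act_ι, D.table, map_smul, LinearMap.smul_apply, D.ad_w₃_w₁]
  match_scalars; grind

/-- Apply `g` to the relation over `v₀`. The opposite signs in its action on the two vectors account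
for the change of sign. -/
theorem ad_w₁_w₃_v₁_eq (hr : r ^ 2 = -1) : M.ad w₁ (M.ad w₃ (M.nicholsι v₁)) =
    (r ^ 3 * s) • M.ad w₀ (M.ad w₂ (M.nicholsι v₁)) := by
  have h₂ := D.t_sq
  have h₄ := congrArg (M.nichols.act g) (D.ad_w₁_w₃_eq hr)
  rw [map_smul, D.act_g_ad_w₀_w₂, D.act_g_ad_w₁_w₃] at h₄
  have h₅ := congrArg (fun y => (-t) • y) h₄
  simp only [smul_smul] at h₅
  rw [show -t * -t = 1 by linear_combination h₂, one_smul,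
    show -t * (-(r ^ 3 * s) * t) = r ^ 3 * s by linear_combination r ^ 3 * s * h₂] at h₅
  exact h₅

end Elements

end GammaFourPair

end YetterDrinfeld

namespace YetterDrinfeld

/-! ### Spanning sets of the adjoint powers -/

section Spans

variable {K G U : Type*} [Field K] [Group G] [AddCommGroup U] [Module K U]

theorem map₂_ad_eq_span {M : YetterDrinfeld K G U} {S : Set U} {T T' : Set M.NicholsAlgebra}
    {P : Submodule K U} {N : Submodule K M.NicholsAlgebra} (hP : P = Submodule.span K S)
    (hN : N = Submodule.span K T) (h : ∀ u ∈ S, ∀ y ∈ T, M.ad u y ∈ Submodule.span K T')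
    (h' : ∀ y ∈ T', y ∈ Submodule.map₂ M.ad P N) :
    Submodule.map₂ M.ad P N = Submodule.span K T' := by
  refine le_antisymm ?_ (Submodule.span_le.2 h')
  rw [hP, hN, Submodule.map₂_span_span, Submodule.span_le]
  rintro _ ⟨u, hu, y, hy, rfl⟩
  exact h u hu y hy

theorem map₂_ad_eq_bot {M : YetterDrinfeld K G U} {S : Set U} {T : Set M.NicholsAlgebra}
    {P : Submodule K U} {N : Submodule K M.NicholsAlgebra} (hP : P = Submodule.span K S)
    (hN : N = Submodule.span K T) (h : ∀ u ∈ S, ∀ y ∈ T, M.ad u y = 0) :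
    Submodule.map₂ M.ad P N = ⊥ := by
  rw [map₂_ad_eq_span hP hN (T' := ∅) (fun u hu y hy => by simp [h u hu y hy]) (by simp),
    Submodule.span_empty]

theorem adPow_eq_bot_of_le {M : YetterDrinfeld K G U} {P Q : Submodule K U} {m n : ℕ}
    (h : M.adPow P Q m = ⊥) (hmn : m ≤ n) : M.adPow P Q n = ⊥ := by
  induction n, hmn using Nat.le_induction with
  | base => exact h
  | succ n _ ih => rw [adPow, ih, Submodule.map₂_bot_right]

end Spans

namespace GammaFourPair

section Spans

variable {K G U : Type*} [Field K] [Group G] [AddCommGroup U] [Module K U]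
  {M : YetterDrinfeld K G U} {g h ε : G} {r p s t : K} {v₀ v₁ w₀ w₁ w₂ w₃ : U}
  (D : GammaFourPair M g h ε r p s t v₀ v₁ w₀ w₁ w₂ w₃)
  {P Q : Submodule K U}

theorem adPow_zero_left (hP : P = Submodule.span K {v₀, v₁}) :
    M.adPow Q P 0 = Submodule.span K {M.nicholsι v₀, M.nicholsι v₁} := by
  rw [adPow, hP, Submodule.map_span, Set.image_pair]

theorem adPow_zero_right (hQ : Q = Submodule.span K {w₀, w₁, w₂, w₃}) :
    M.adPow P Q 0 = Submodule.span K {M.nicholsι w₀, M.nicholsι w₁, M.nicholsι w₂,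
      M.nicholsι w₃} := by
  rw [adPow, hQ, Submodule.map_span]
  simp only [Set.image_insert_eq, Set.image_singleton]

include D

/-- The relations of degree two make the four products with `v₁` redundant. -/
theorem adPow_one_left (hP : P = Submodule.span K {v₀, v₁})
    (hQ : Q = Submodule.span K {w₀, w₁, w₂, w₃}) :
    M.adPow P Q 1 = Submodule.span K {M.ad v₀ (M.nicholsι w₀), M.ad v₀ (M.nicholsι w₁),
      M.ad v₀ (M.nicholsι w₂), M.ad v₀ (M.nicholsι w₃)} := by
  refine map₂_ad_eq_span hP (adPow_zero_right hQ) ?_ ?_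
  · rintro _ (rfl | rfl) _ (rfl | rfl | rfl | rfl)
    on_goal 5 => rw [D.ad_v₁_w₀]
    on_goal 6 => rw [D.ad_v₁_w₁]
    on_goal 7 => rw [D.ad_v₁_w₂]
    on_goal 8 => rw [D.ad_v₁_w₃]
    on_goal 5 => apply Submodule.smul_mem
    on_goal 6 => apply Submodule.smul_mem
    on_goal 7 => apply Submodule.smul_mem
    on_goal 8 => apply Submodule.smul_mem
    all_goals exact Submodule.subset_span (by simp)
  · have hv : v₀ ∈ P := hP ▸ Submodule.subset_span (by simp)
    rintro _ (rfl | rfl | rfl | rfl) <;>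
    exact Submodule.apply_mem_map₂ _ hv ⟨_, hQ ▸ Submodule.subset_span (by simp), rfl⟩

/-- Each generator `ad v₀ w_i` is also, up to a nonzero scalar, in the image of `ad v₁`. As both `ad
v₀` and `ad v₁` square to zero, both kill it. -/
theorem adPow_two_left (hP : P = Submodule.span K {v₀, v₁})
    (hQ : Q = Submodule.span K {w₀, w₁, w₂, w₃}) : M.adPow P Q 2 = ⊥ := by
  have hr := D.r_ne_zero
  have hp := D.p_ne_zero
  have ht := D.t_ne_zero
  have key : ∀ {y z : M.NicholsAlgebra} {c : K}, c ≠ 0 → M.ad v₁ y = c • z → M.ad v₁ z = 0 := by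
    intro y z c hc hyz
    have := D.ad_v₁_self y
    rw [hyz, map_smul] at this
    exact (smul_eq_zero.1 this).resolve_left hc
  refine map₂_ad_eq_bot hP (D.adPow_one_left hP hQ) ?_
  rintro _ (rfl | rfl) _ (rfl | rfl | rfl | rfl)
  · exact D.ad_v₀_self _
  · exact D.ad_v₀_self _
  · exact D.ad_v₀_self _
  · exact D.ad_v₀_self _
  · exact key (by simp [hr]) D.ad_v₁_w₁
  · exact key (by simp [hr, hp]) D.ad_v₁_w₂
  · exact key (by simp [hr]) D.ad_v₁_w₃
  · exact key (by simp [hr, hp, ht]) D.ad_v₁_w₀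

theorem adPow_one_right (hP : P = Submodule.span K {v₀, v₁})
    (hQ : Q = Submodule.span K {w₀, w₁, w₂, w₃}) :
    M.adPow Q P 1 = Submodule.span K {M.ad w₀ (M.nicholsι v₀), M.ad w₁ (M.nicholsι v₀),
      M.ad w₂ (M.nicholsι v₀), M.ad w₃ (M.nicholsι v₀)} := by
  refine map₂_ad_eq_span hQ (adPow_zero_left hP) ?_ ?_
  · rintro _ (rfl | rfl | rfl | rfl) _ (rfl | rfl)
    on_goal 2 => rw [D.ad_w₀_v₁]
    on_goal 4 => rw [D.ad_w₁_v₁]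
    on_goal 6 => rw [D.ad_w₂_v₁]
    on_goal 8 => rw [D.ad_w₃_v₁]
    on_goal 2 => apply Submodule.smul_mem
    on_goal 4 => apply Submodule.smul_mem
    on_goal 6 => apply Submodule.smul_mem
    on_goal 8 => apply Submodule.smul_mem
    all_goals exact Submodule.subset_span (by simp)
  · have hv : v₀ ∈ P := hP ▸ Submodule.subset_span (by simp)
    rintro _ (rfl | rfl | rfl | rfl) <;>
    exact Submodule.apply_mem_map₂ _ (hQ ▸ Submodule.subset_span (by simp)) ⟨_, hv, rfl⟩

/-- Write `w_i w_j v₀` for the iterated adjoint action, with indices modulo 4. It is zero for `j =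
i`; for `j = i ± 1` the factor `w_j v₀` is replaced by a multiple of `w_{j-1} v₁`, which gives zero
or an element with indices `i`, `i + 2` over `v₁`. Elements with indices `i`, `i + 2` are reordered
to start with `w₀` or `w₁`. -/
theorem adPow_two_right (hP : P = Submodule.span K {v₀, v₁})
    (hQ : Q = Submodule.span K {w₀, w₁, w₂, w₃}) :
    M.adPow Q P 2 = Submodule.span K {M.ad w₀ (M.ad w₂ (M.nicholsι v₀)),
      M.ad w₁ (M.ad w₃ (M.nicholsι v₀)), M.ad w₀ (M.ad w₂ (M.nicholsι v₁)),
      M.ad w₁ (M.ad w₃ (M.nicholsι v₁))} := by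
  have hr := D.r_ne_zero
  have hp := D.p_ne_zero
  have ht := D.t_ne_zero
  have key₀ : ∀ {u : U} {x y z : M.NicholsAlgebra} {c : K}, M.ad u x = 0 → c ≠ 0 → x = c • z →
      ∀ T : Set M.NicholsAlgebra, M.ad u z ∈ Submodule.span K T := by
    rintro u x y z c hx hc rfl T
    rw [map_smul] at hx
    rw [(smul_eq_zero.1 hx).resolve_left hc]
    exact zero_mem _
  have key : ∀ {u : U} {y z : M.NicholsAlgebra} {c : K} {T : Submodule K M.NicholsAlgebra},
      c ≠ 0 → y = c • z → M.ad u y ∈ T → M.ad u z ∈ T := by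
    rintro u y z c T hc rfl hT
    rw [map_smul] at hT
    exact (T.smul_mem_iff hc).1 hT
  have hp' : -p ≠ 0 := by simp [hp]
  have hr' : -r ^ 2 ≠ 0 := by simp [hr]
  have hpr' : -(p * r ^ 2) ≠ 0 := by simp [hp, hr]
  have ht' : -t ≠ 0 := by simp [ht]
  refine map₂_ad_eq_span hQ (D.adPow_one_right hP hQ) ?_ ?_
  · rintro _ (rfl | rfl | rfl | rfl) _ (rfl | rfl | rfl | rfl)
    · rw [D.ad_w₀_self]; exact zero_mem _
    · refine key hp' D.ad_w₀_v₁ ?_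
      rw [D.ad_w₀_self]; exact zero_mem _
    · exact Submodule.subset_span (by simp)
    · exact key hpr' D.ad_w₂_v₁ (Submodule.subset_span (by simp))
    · exact key ht' D.ad_w₃_v₁ (Submodule.subset_span (by simp))
    · rw [D.ad_w₁_self]; exact zero_mem _
    · refine key hr' D.ad_w₁_v₁ ?_
      rw [D.ad_w₁_self]; exact zero_mem _
    · exact Submodule.subset_span (by simp)
    · rw [D.ad_w₂_w₀]; exact Submodule.smul_mem _ _ (Submodule.subset_span (by simp))
    · refine key hp' D.ad_w₀_v₁ ?_
      rw [D.ad_w₂_w₀]; exact Submodule.smul_mem _ _ (Submodule.subset_span (by simp))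
    · rw [D.ad_w₂_self]; exact zero_mem _
    · refine key hpr' D.ad_w₂_v₁ ?_
      rw [D.ad_w₂_self]; exact zero_mem _
    · refine key ht' D.ad_w₃_v₁ ?_
      rw [D.ad_w₃_self]; exact zero_mem _
    · rw [D.ad_w₃_w₁]; exact Submodule.smul_mem _ _ (Submodule.subset_span (by simp))
    · refine key hr' D.ad_w₁_v₁ ?_
      rw [D.ad_w₃_w₁]; exact Submodule.smul_mem _ _ (Submodule.subset_span (by simp))
    · rw [D.ad_w₃_self]; exact zero_mem _
  · have hv₀ : v₀ ∈ P := hP ▸ Submodule.subset_span (by simp)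
    have hv₁ : v₁ ∈ P := hP ▸ Submodule.subset_span (by simp)
    rintro _ (rfl | rfl | rfl | rfl) <;>
    refine Submodule.apply_mem_map₂ _ (hQ ▸ Submodule.subset_span (by simp))
      (Submodule.apply_mem_map₂ _ (hQ ▸ Submodule.subset_span (by simp)) ⟨_, ?_, rfl⟩)
    exacts [hv₀, hv₀, hv₁, hv₁]

theorem adPow_two_right_of_sq (hr : r ^ 2 = -1) (hP : P = Submodule.span K {v₀, v₁})
    (hQ : Q = Submodule.span K {w₀, w₁, w₂, w₃}) :
    M.adPow Q P 2 = Submodule.span K {M.ad w₀ (M.ad w₂ (M.nicholsι v₀)),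
      M.ad w₀ (M.ad w₂ (M.nicholsι v₁))} := by
  rw [D.adPow_two_right hP hQ, D.ad_w₁_w₃_eq hr, D.ad_w₁_w₃_v₁_eq hr]
  refine le_antisymm (Submodule.span_le.2 ?_) (Submodule.span_mono ?_)
  · rintro _ (rfl | rfl | rfl | rfl)
    · exact Submodule.subset_span (by simp)
    · exact Submodule.smul_mem _ _ (Submodule.subset_span (by simp))
    · exact Submodule.subset_span (by simp)
    · exact Submodule.smul_mem _ _ (Submodule.subset_span (by simp))
  · rintro _ (rfl | rfl) <;> simp

/-- Each generator can be written with `w₀, w₂` or with `w₁, w₃`, in either order. So any given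
`w_i` can be moved to the front, where `(ad w_i)² = 0` applies. -/
theorem adPow_three_right_of_sq (hr : r ^ 2 = -1) (hP : P = Submodule.span K {v₀, v₁})
    (hQ : Q = Submodule.span K {w₀, w₁, w₂, w₃}) : M.adPow Q P 3 = ⊥ := by
  have hrs : -(r ^ 3 * s) ≠ 0 := by simp [D.r_ne_zero, D.s_ne_zero]
  have hrs' : r ^ 3 * s ≠ 0 := by simp [D.r_ne_zero, D.s_ne_zero]
  have key : ∀ {u : U} {y z : M.NicholsAlgebra} {c : K}, c ≠ 0 → y = c • z → M.ad u y = 0 →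
      M.ad u z = 0 := by
    rintro u y z c hc rfl h
    rw [map_smul] at h
    exact (smul_eq_zero.1 h).resolve_left hc
  refine map₂_ad_eq_bot hQ (D.adPow_two_right_of_sq hr hP hQ) ?_
  rintro _ (rfl | rfl | rfl | rfl) _ (rfl | rfl)
  · exact D.ad_w₀_self _
  · exact D.ad_w₀_self _
  · exact key hrs (D.ad_w₁_w₃_eq hr) (D.ad_w₁_self _)
  · exact key hrs' (D.ad_w₁_w₃_v₁_eq hr) (D.ad_w₁_self _)
  · rw [D.ad_w₂_w₀, D.ad_w₂_self, map_zero, smul_zero]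
  · rw [D.ad_w₂_w₀, D.ad_w₂_self, map_zero, smul_zero]
  · refine key hrs (D.ad_w₁_w₃_eq hr) ?_
    rw [D.ad_w₃_w₁, D.ad_w₃_self, map_zero, smul_zero]
  · refine key hrs' (D.ad_w₁_w₃_v₁_eq hr) ?_
    rw [D.ad_w₃_w₁, D.ad_w₃_self, map_zero, smul_zero]

end Spans

/-! ### Absolute simplicity of the adjoint powers -/

section Main

variable {K : Type u} {G U : Type*} [Field K] [Group G] [AddCommGroup U] [Module K U]
  {M : YetterDrinfeld K G U} {g h ε : G} {r p s t : K} {v₀ v₁ w₀ w₁ w₂ w₃ : U}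
  (D : GammaFourPair M g h ε r p s t v₀ v₁ w₀ w₁ w₂ w₃)
  {P Q : Submodule K U} (hPsub : M.IsSub P) (hQsub : M.IsSub Q)
  (hP : P = Submodule.span K {v₀, v₁}) (hQ : Q = Submodule.span K {w₀, w₁, w₂, w₃})

include D hPsub hQsub hP hQ

/-- Orbit criterion: the degrees are `ε^i h g`, and the powers `1, h, h², h³` move the first vector
to multiples of all four. -/
theorem isAbsolutelySimpleSub_adPow_one_left :
    M.nichols.IsAbsolutelySimpleSub (M.adPow P Q 1) := by
  have e₁ : M.nichols.act h (M.ad v₀ (M.nicholsι w₀)) = (-1 : K) • M.ad v₀ (M.nicholsι w₁) := by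
    simp only [act_ad, nichols_act_ι, D.table, map_neg, LinearMap.neg_apply, neg_smul, one_smul]
  have e₂ : M.nichols.act (h * h) (M.ad v₀ (M.nicholsι w₀)) = s • M.ad v₀ (M.nicholsι w₂) := by
    simp only [← act_act, act_ad, nichols_act_ι, D.table, map_neg, LinearMap.neg_apply, smul_neg,
      neg_neg, map_smul]
  have e₃ : M.nichols.act (h * (h * h)) (M.ad v₀ (M.nicholsι w₀)) =
      (-s) • M.ad v₀ (M.nicholsι w₃) := by
    rw [← act_act, e₂]
    simp only [act_ad, nichols_act_ι, D.table, map_neg, LinearMap.neg_apply, map_smul, smul_neg,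
      neg_smul]
  refine isAbsolutelySimpleSub_of_orbit (isSub_adPow hPsub hQsub 1) D.ad_v₀_w₀_ne_zero
    ?_ ![M.ad v₀ (M.nicholsι w₀), M.ad v₀ (M.nicholsι w₁), M.ad v₀ (M.nicholsι w₂),
      M.ad v₀ (M.nicholsι w₃)] (D.injective_deg (h * g)) ?_ ?_ ?_
  · rw [D.adPow_one_left hP hQ]
    exact Submodule.subset_span (by simp)
  · intro k
    fin_cases k
    · exact D.v₀_hom.ad D.w₀_hom.nicholsι
    · have := D.v₀_hom.ad D.w₁_hom.nicholsι
      rwa [show h * (ε * g) = ε * (h * g) by simp only [D.rel]] at this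
    · have := D.v₀_hom.ad D.w₂_hom.nicholsι
      rwa [show h * (ε * (ε * g)) = ε * (ε * (h * g)) by simp only [D.rel]] at this
    · have := D.v₀_hom.ad D.w₃_hom.nicholsι
      rwa [show h * (ε * (ε * (ε * g))) = ε * (ε * (ε * (h * g))) by simp only [D.rel]] at this
  · rw [D.adPow_one_left hP hQ]
    simp only [Matrix.range_cons, Matrix.range_empty, Set.singleton_union, Set.union_empty]
  · intro k
    fin_cases k
    · exact ⟨1, 1, one_ne_zero, by simp⟩
    · exact ⟨h, -1, by simp, e₁⟩
    · exact ⟨_, s, D.s_ne_zero, e₂⟩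
    · exact ⟨_, -s, neg_ne_zero.2 D.s_ne_zero, e₃⟩

omit hQ in
theorem isAbsolutelySimpleSub_adPow_zero_right :
    M.nichols.IsAbsolutelySimpleSub (M.adPow Q P 0) := by
  refine isAbsolutelySimpleSub_of_orbit (d := ![h, ε * (ε * (ε * h))])
    (isSub_adPow hQsub hPsub 0) D.ι_v₀_ne_zero ?_ ![M.nicholsι v₀, M.nicholsι v₁] ?_ ?_ ?_ ?_
  · rw [adPow_zero_left hP]
    exact Submodule.subset_span (by simp)
  · have h₃ := D.ε_ε_ε_mul_ne h
    intro i j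
    fin_cases i <;> fin_cases j <;> simp [h₃, h₃.symm]
  · intro k
    fin_cases k
    exacts [D.v₀_hom.nicholsι, D.v₁_hom.nicholsι]
  · rw [adPow_zero_left hP]
    simp only [Matrix.range_cons, Matrix.range_empty, Set.singleton_union, Set.union_empty]
  · intro k
    fin_cases k
    · exact ⟨1, 1, one_ne_zero, by simp⟩
    · exact ⟨g, 1, one_ne_zero, by simp [nichols_act_ι, D.table]⟩

theorem isAbsolutelySimpleSub_adPow_one_right :
    M.nichols.IsAbsolutelySimpleSub (M.adPow Q P 1) := by
  have e₂ : M.nichols.act (h * h) (M.ad w₀ (M.nicholsι v₀)) = s • M.ad w₂ (M.nicholsι v₀) := by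
    rw [← act_act, D.act_h_ad_w₀, map_smul, D.act_h_ad_w₁]
    module
  have e₃ : M.nichols.act (h * (h * h)) (M.ad w₀ (M.nicholsι v₀)) =
      (-s) • M.ad w₃ (M.nicholsι v₀) := by
    rw [← act_act, e₂, map_smul, D.act_h_ad_w₂]
    module
  refine isAbsolutelySimpleSub_of_orbit (isSub_adPow hQsub hPsub 1) D.ad_w₀_v₀_ne_zero
    ?_ ![M.ad w₀ (M.nicholsι v₀), M.ad w₁ (M.nicholsι v₀), M.ad w₂ (M.nicholsι v₀),
      M.ad w₃ (M.nicholsι v₀)] (D.injective_deg (g * h)) ?_ ?_ ?_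
  · rw [D.adPow_one_right hP hQ]
    exact Submodule.subset_span (by simp)
  · intro k
    fin_cases k
    · exact D.w₀_hom.ad D.v₀_hom.nicholsι
    · have := D.w₁_hom.ad D.v₀_hom.nicholsι
      simp only [mul_assoc] at this
      exact this
    · have := D.w₂_hom.ad D.v₀_hom.nicholsι
      simp only [mul_assoc] at this
      exact this
    · have := D.w₃_hom.ad D.v₀_hom.nicholsι
      simp only [mul_assoc] at this
      exact this
  · rw [D.adPow_one_right hP hQ]
    simp only [Matrix.range_cons, Matrix.range_empty, Set.singleton_union, Set.union_empty]
  · intro k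
    fin_cases k
    · exact ⟨1, 1, one_ne_zero, by simp⟩
    · exact ⟨h, -1, by simp, D.act_h_ad_w₀⟩
    · exact ⟨_, s, D.s_ne_zero, e₂⟩
    · exact ⟨_, -s, neg_ne_zero.2 D.s_ne_zero, e₃⟩

omit hPsub hQsub in
theorem adPow_two_right_ne_bot : M.adPow Q P 2 ≠ ⊥ := by
  intro hbot
  have hmem : M.ad w₀ (M.ad w₂ (M.nicholsι v₀)) ∈ M.adPow Q P 2 := by
    rw [D.adPow_two_right hP hQ]
    exact Submodule.subset_span (by simp)
  rw [hbot, Submodule.mem_bot] at hmem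
  exact D.ad_w₀_w₂_ne_zero hmem

/-- Orbit criterion with two vectors: `g` carries the first to a multiple of the second, and their
degrees differ by a factor `ε ≠ 1`. -/
theorem isAbsolutelySimpleSub_adPow_two_right (hr : r ^ 2 = -1) :
    M.nichols.IsAbsolutelySimpleSub (M.adPow Q P 2) := by
  refine isAbsolutelySimpleSub_of_orbit
    (d := ![ε * (ε * (g * (g * h))), ε * (g * (g * h))])
    (isSub_adPow hQsub hPsub 2) D.ad_w₀_w₂_ne_zero ?_
    ![M.ad w₀ (M.ad w₂ (M.nicholsι v₀)), M.ad w₀ (M.ad w₂ (M.nicholsι v₁))] ?_ ?_ ?_ ?_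
  · rw [D.adPow_two_right_of_sq hr hP hQ]
    exact Submodule.subset_span (by simp)
  · have h₁ := D.ε_ne_one
    intro i j
    fin_cases i <;> fin_cases j <;> simp [h₁]
  · intro k
    fin_cases k
    · have := D.w₀_hom.ad (D.w₂_hom.ad D.v₀_hom.nicholsι)
      simp only [mul_assoc, D.rel] at this
      exact this
    · have := D.w₀_hom.ad (D.w₂_hom.ad D.v₁_hom.nicholsι)
      simp only [mul_assoc, D.rel] at this
      exact this
  · rw [D.adPow_two_right_of_sq hr hP hQ]
    simp only [Matrix.range_cons, Matrix.range_empty, Set.singleton_union, Set.union_empty]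
  · intro k
    fin_cases k
    · exact ⟨1, 1, one_ne_zero, by simp⟩
    · exact ⟨g, t, D.t_ne_zero, D.act_g_ad_w₀_w₂⟩

omit hPsub hQsub in
-- The swap criterion with `α = -1`, `β = s²`, `γ = -r`, `δ = p`. The common degree `ε² g² h` is
-- moved by `g` because `ε ≠ 1`.
theorem not_isAbsolutelySimpleSub_adPow_two_right (hr : r ^ 2 ≠ -1) :
    ¬ M.nichols.IsAbsolutelySimpleSub (M.adPow Q P 2) := by
  have hgε : g * ε = ε⁻¹ * g := by
    rw [eq_inv_mul_iff_mul_eq]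
    simp only [D.rel]
  have hS := D.adPow_two_right hP hQ
  refine not_isAbsolutelySimpleSub_of_swap (d := ε * (ε * (g * (g * h)))) D.closure_eq_top hgε
    (by rw [D.h_mul_g, mul_assoc]) ?_
    (hS ▸ Submodule.subset_span (by simp)) (hS ▸ Submodule.subset_span (by simp)) ?_ ?_
    (D.linearIndependent_ad_ad hr) (by simp) (pow_ne_zero 2 D.s_ne_zero)
    (neg_ne_zero.2 D.r_ne_zero) D.act_h_ad_w₀_w₂ D.act_h_ad_w₁_w₃ D.act_ε_ad_w₀_w₂
    D.act_ε_ad_w₁_w₃ D.act_g_g_ad_w₀_w₂ D.act_g_g_ad_w₁_w₃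
  · rw [Ne, mul_inv_eq_iff_eq_mul]
    simp only [mul_assoc, D.rel, mul_right_inj]
    simpa using D.ε_ne_one
  · simpa only [mul_assoc, D.rel] using D.w₀_hom.ad (D.w₂_hom.ad D.v₀_hom.nicholsι)
  · simpa only [mul_assoc, D.rel] using D.w₁_hom.ad (D.w₃_hom.ad D.v₀_hom.nicholsι)

/-- Only `m = 2` decides: powers 0 and 1 are absolutely simple in any case, and power 2 is never
zero. -/
theorem forall_isAbsolutelySimpleSub_or_eq_bot_iff :
    (∀ m, M.nichols.IsAbsolutelySimpleSub (M.adPow Q P m) ∨ M.adPow Q P m = ⊥) ↔ r ^ 2 = -1 := by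
  constructor
  · intro H
    by_contra hr
    exact (H 2).elim (D.not_isAbsolutelySimpleSub_adPow_two_right hP hQ hr)
      (D.adPow_two_right_ne_bot hP hQ)
  · rintro hr (_ | _ | _ | m)
    · exact Or.inl (D.isAbsolutelySimpleSub_adPow_zero_right hPsub hQsub hP)
    · exact Or.inl (D.isAbsolutelySimpleSub_adPow_one_right hPsub hQsub hP hQ)
    · exact Or.inl (D.isAbsolutelySimpleSub_adPow_two_right hPsub hQsub hP hQ hr)
    · exact Or.inr (adPow_eq_bot_of_le (D.adPow_three_right_of_sq hr hP hQ) (by omega))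

end Main

end GammaFourPair

end YetterDrinfeld

namespace YetterDrinfeld

/-! ### The two summands of a direct sum -/

section Prod

variable {K G V W : Type*} [Field K] [Group G] [AddCommGroup V] [Module K V]
  [AddCommGroup W] [Module K W]

theorem prod_act (M : YetterDrinfeld K G V) (N : YetterDrinfeld K G W) (x : G) (v : V) (w : W) :
    (M.prod N).act x (v, w) = (M.act x v, N.act x w) := rfl

theorem isHom_inl (M : YetterDrinfeld K G V) (N : YetterDrinfeld K G W) :
    M.IsHom (M.prod N) (LinearMap.inl K V W) := by
  refine IsHom.of_homogeneous (fun x v y hv => ?_) fun x v hv => ?_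
  · simp [prod_act]
  · unfold IsHomogeneous at *
    change (LinearMap.coprod _ _) (v, (0 : W)) = _
    rw [LinearMap.coprod_apply, map_zero, add_zero, LinearMap.comp_apply, hv]
    simp

theorem isHom_inr (M : YetterDrinfeld K G V) (N : YetterDrinfeld K G W) :
    N.IsHom (M.prod N) (LinearMap.inr K V W) := by
  refine IsHom.of_homogeneous (fun x v y hv => ?_) fun x v hv => ?_
  · simp [prod_act]
  · unfold IsHomogeneous at *
    change (LinearMap.coprod _ _) ((0 : V), v) = _
    rw [LinearMap.coprod_apply, map_zero, zero_add, LinearMap.comp_apply, hv]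
    simp

end Prod

/-! ### The modules `M(x, χ)` and their generators -/

section OfChar

variable {K G : Type*} [Field K] [Group G] (x : G) (χ : centralizer x →* Kˣ)

/-- The canonical generator `1 ⊗ 1` of `M(x, χ)`. -/
noncomputable def charGen : IndSpace x (charRep χ) :=
  Representation.IndV.mk (centralizer x).subtype (charRep χ) 1 1

theorem charGen_isHomogeneous : (ofChar x χ).IsHomogeneous x (charGen x χ) := by
  have := indCoact_mk x (charRep χ) 1 1
  rwa [inv_one, one_mul, mul_one] at this

theorem act_mk (a y : G) (c : K) :
    (ofChar x χ).act a (Representation.IndV.mk (centralizer x).subtype (charRep χ) y c) =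
      Representation.IndV.mk (centralizer x).subtype (charRep χ) (y * a⁻¹) c :=
  Representation.ind_mk (centralizer x).subtype (charRep χ) a y c

theorem charRep_apply (z : centralizer x) (c : K) : charRep χ z c = χ z * c := by
  simp [charRep, Algebra.algebraMap_eq_smul_one]

theorem act_charGen (z : centralizer x) :
    (ofChar x χ).act z (charGen x χ) = (χ z : K) • charGen x χ := by
  -- The balancing relation is used for `z⁻¹`, since `mk y` stands for `y⁻¹ ⊗ -` and `z` therefore
  -- acts by right multiplication with `z⁻¹`.
  have h := IndSpace.mk_mul x (charRep χ) z⁻¹ 1 (χ z : K)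
  rw [charRep_apply, mul_one, ← Units.val_mul, ← map_mul, inv_mul_cancel, map_one,
    Units.val_one] at h
  rw [charGen, act_mk, one_mul, ← map_smul, smul_eq_mul, mul_one, ← h]
  rfl

theorem act_charGen_of_mem {a : G} (ha : a ∈ centralizer x) {c : K}
    (hc : (χ ⟨a, ha⟩ : K) = c) : (ofChar x χ).act a (charGen x χ) = c • charGen x χ :=
  hc ▸ act_charGen x χ ⟨a, ha⟩

theorem mem_span_orbit_charGen (v : IndSpace x (charRep χ)) :
    v ∈ Submodule.span K (Set.range fun a => (ofChar x χ).act a (charGen x χ)) := by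
  induction v using Representation.Coinvariants.induction_on with
  | h z =>
    induction z using TensorProduct.induction_on with
    | zero => rw [map_zero]; exact zero_mem _
    | add z z' hz hz' => rw [map_add]; exact add_mem hz hz'
    | tmul f c =>
      induction f using MonoidAlgebra.induction_linear with
      | zero => rw [TensorProduct.zero_tmul, map_zero]; exact zero_mem _
      | add f f' hf hf' => rw [TensorProduct.add_tmul, map_add]; exact add_mem hf hf'
      | single y b =>
        have : (MonoidAlgebra.single y b : MonoidAlgebra K G) ⊗ₜ[K] c =
            (b * c) • (MonoidAlgebra.single y 1 ⊗ₜ[K] (1 : K)) := by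
          rw [← TensorProduct.tmul_smul, smul_eq_mul, mul_one, ← smul_eq_mul,
            ← TensorProduct.smul_tmul]
          simp
        rw [this, map_smul]
        refine Submodule.smul_mem _ _ (Submodule.subset_span ⟨y⁻¹, ?_⟩)
        change (ofChar x χ).act y⁻¹ (charGen x χ) = _
        rw [charGen, act_mk, one_mul, inv_inv]
        rfl

/-- A linear form detects the generator: `y⁻¹ ⊗ c` goes to `χ(y)⁻¹ c` if `y` centralizes `x`, and to
zero otherwise. The identity `hφ` makes it well defined on the balanced tensor product. -/
theorem charGen_ne_zero : charGen x χ ≠ 0 := by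
  classical
  let φ : G → K := fun y => if hy : y ∈ centralizer x then ((χ ⟨y, hy⟩)⁻¹ : Kˣ) else 0
  have hφ : ∀ (z : centralizer x) (y : G), φ (z * y) * χ z = φ y := by
    intro z y
    by_cases hy : y ∈ centralizer x
    · have hzy : (z : G) * y ∈ centralizer x := mul_mem z.2 hy
      have : (⟨z * y, hzy⟩ : centralizer x) = z * ⟨y, hy⟩ := rfl
      simp only [φ, dif_pos hy, dif_pos hzy, this, map_mul, mul_inv]
      rw [← Units.val_mul]
      congr 1
      rw [mul_comm, mul_inv_cancel_left]
    · have hzy : (z : G) * y ∉ centralizer x := fun h => hy <| by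
        have := mul_mem (inv_mem z.2) h
        rwa [inv_mul_cancel_left] at this
      simp only [φ, dif_neg hy, dif_neg hzy, zero_mul]
  let F : IndSpace x (charRep χ) →ₗ[K] K := Representation.Coinvariants.lift _
    (TensorProduct.lift (Finsupp.lsum K (fun y : G => φ y • LinearMap.id (R := K) (M := K)
      |> LinearMap.toSpanSingleton K (K →ₗ[K] K)) ∘ₗ
        (MonoidAlgebra.coeffLinearEquiv K).toLinearMap)) (fun z => by
      refine TensorProduct.ext (MonoidAlgebra.lhom_ext' fun y => LinearMap.ext_ring ?_)
      ext
      simpa [charRep_apply] using hφ z y)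
  intro h
  have h1 : F (charGen x χ) = φ 1 := by simp [F, charGen]
  rw [h, map_zero] at h1
  simp only [φ, dif_pos (one_mem _)] at h1
  exact Units.ne_zero _ h1.symm

/-- `M(x, χ)` is spanned by any set of homogeneous vectors that contains the canonical generator
and is stable, up to linear combinations, under a generating set of the group. -/
theorem span_eq_top_of_charGen_mem {S : Set G} (hS : Subgroup.closure S = ⊤)
    {T : Set (IndSpace x (charRep χ))} (hfin : T.Finite) (hT : charGen x χ ∈ T)
    (h : ∀ a ∈ S, ∀ v ∈ T, (ofChar x χ).act a v ∈ Submodule.span K T) :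
    Submodule.span K T = ⊤ := by
  have : FiniteDimensional K (Submodule.span K T) := FiniteDimensional.span_of_finite K hfin
  have hact := (ofChar x χ).act_mem_of_closure hS (N := Submodule.span K T) fun a ha => by
    suffices h' : Submodule.span K T ≤ (Submodule.span K T).comap ((ofChar x χ).act a) from
      fun v hv => h' hv
    rw [Submodule.span_le]
    exact fun v hv => h a ha v hv
  rw [eq_top_iff]
  intro v _
  refine Submodule.span_le.2 ?_ (mem_span_orbit_charGen x χ v)
  rintro _ ⟨a, rfl⟩
  exact hact a _ (Submodule.subset_span hT)

end OfChar

end YetterDrinfeld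

namespace IsGammaFourQuotient

/-! ### The natural bases of `M(h, ρ)` and `M(g, σ)` -/

section Modules

variable {K G : Type*} [Field K] [Group G] {g h ε : G} (hG : IsGammaFourQuotient g h ε)

include hG

theorem ε_pow_four : ε * (ε * (ε * ε)) = 1 := by
  rw [← hG.relations.2.2.2]
  simp only [pow_succ, pow_zero, one_mul, mul_assoc]

theorem g_mul_ε : g * ε = ε * (ε * (ε * g)) := by
  have h₁ : ε⁻¹ = ε * (ε * ε) := inv_eq_of_mul_eq_one_right hG.ε_pow_four
  rw [hG.relations.2.1, h₁]
  simp only [mul_assoc]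

theorem h_mul_g : h * g = ε * (g * h) := by
  rw [hG.relations.1, mul_assoc]

theorem rel : h * g = ε * (g * h) ∧ (∀ a, h * (g * a) = ε * (g * (h * a))) ∧
    g * ε = ε * (ε * (ε * g)) ∧ (∀ a, g * (ε * a) = ε * (ε * (ε * (g * a)))) ∧
    h * ε = ε * h ∧ (∀ a, h * (ε * a) = ε * (h * a)) ∧
    ε * (ε * (ε * ε)) = 1 ∧ ∀ a, ε * (ε * (ε * (ε * a))) = a :=
  gammaFour_rewrites hG.h_mul_g hG.g_mul_ε hG.relations.2.2.1 hG.ε_pow_four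

theorem ε_sq_mem_centralizer_g : ε ^ 2 ∈ centralizer g := by
  rw [Subgroup.mem_centralizer_singleton_iff, pow_two]
  simp only [mul_assoc, hG.rel]

/-- The action of the generators on the natural basis of `M(h, ρ)`. -/
theorem table_left (ρ : centralizer h →* Kˣ)
    (hρ : ρ ⟨h, IsGammaFourQuotient.self_mem h⟩ = -1) {v : IndSpace h (charRep ρ)}
    (hv : v = charGen h ρ) {r p : K} (hr : (ρ ⟨ε, hG.ε_mem⟩ : K) = r)
    (hp : (ρ ⟨g ^ 2, hG.g_sq_mem⟩ : K) = p) :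
    (ofChar h ρ).act g ((ofChar h ρ).act g v) = p • v ∧ (ofChar h ρ).act h v = -v ∧
      (ofChar h ρ).act h ((ofChar h ρ).act g v) = (-r ^ 3) • (ofChar h ρ).act g v ∧
      (ofChar h ρ).act ε v = r • v ∧
      (ofChar h ρ).act ε ((ofChar h ρ).act g v) = r ^ 3 • (ofChar h ρ).act g v := by
  have e₁ : (ofChar h ρ).act h v = -v := by
    rw [hv, act_charGen_of_mem h ρ (self_mem h) (c := -1) (by rw [hρ]; simp), neg_one_smul]
  have e₂ : (ofChar h ρ).act ε v = r • v := by rw [hv, act_charGen_of_mem h ρ _ hr]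
  have e₃ : (ofChar h ρ).act ε ((ofChar h ρ).act g v) = r ^ 3 • (ofChar h ρ).act g v := by
    have : ε * g = g * (ε * (ε * ε)) := by simp only [hG.rel]
    rw [act_act, this]
    simp only [← act_act, e₂, map_smul, smul_smul]
    congr 1
    ring
  refine ⟨?_, e₁, ?_, e₂, e₃⟩
  · rw [act_act, ← pow_two, hv, act_charGen_of_mem h ρ _ hp]
  · rw [act_act, hG.h_mul_g]
    simp only [← act_act, e₁, map_neg, e₃, neg_smul]

theorem char_ε_sq_sq (σ : centralizer g →* Kˣ) :
    (σ ⟨ε ^ 2, hG.ε_sq_mem_centralizer_g⟩ : K) ^ 2 = 1 := by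
  rw [← Units.val_pow_eq_pow_val, ← map_pow, Units.val_eq_one]
  convert map_one σ
  refine Subtype.ext ?_
  change (ε ^ 2) ^ 2 = 1
  rw [← pow_mul]
  exact hG.relations.2.2.2

/-- The action of the generators on the natural basis of `M(g, σ)`. -/
theorem table_right (σ : centralizer g →* Kˣ)
    (hσ : σ ⟨g, IsGammaFourQuotient.self_mem g⟩ = -1) {w : IndSpace g (charRep σ)}
    (hw : w = charGen g σ) {s t : K} (hs : (σ ⟨ε⁻¹ * h ^ 2, hG.ε_inv_h_sq_mem⟩ : K) = s)
    (ht : (σ ⟨ε ^ 2, hG.ε_sq_mem_centralizer_g⟩ : K) = t) :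
    ((ofChar g σ).act g w = -w ∧
      (ofChar g σ).act g ((ofChar g σ).act h w) =
        -t • (ofChar g σ).act h ((ofChar g σ).act ε w) ∧
      (ofChar g σ).act g ((ofChar g σ).act ε w) = -t • (ofChar g σ).act ε w ∧
      (ofChar g σ).act g ((ofChar g σ).act h ((ofChar g σ).act ε w)) =
        -t • (ofChar g σ).act h w) ∧
    ((ofChar g σ).act h ((ofChar g σ).act h w) = s • (ofChar g σ).act ε w ∧
      (ofChar g σ).act h ((ofChar g σ).act h ((ofChar g σ).act ε w)) = (s * t) • w) ∧
    ((ofChar g σ).act ε ((ofChar g σ).act h w) = (ofChar g σ).act h ((ofChar g σ).act ε w) ∧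
      (ofChar g σ).act ε ((ofChar g σ).act ε w) = t • w ∧
      (ofChar g σ).act ε ((ofChar g σ).act h ((ofChar g σ).act ε w)) =
        t • (ofChar g σ).act h w) := by
  set N := ofChar g σ
  have e₁ : N.act g w = -w := by
    rw [hw, act_charGen_of_mem g σ (self_mem g) (c := -1) (by rw [hσ]; simp), neg_one_smul]
  have e₂ : N.act ε (N.act ε w) = t • w := by
    rw [act_act, ← pow_two, hw, act_charGen_of_mem g σ _ ht]
  -- `h² = ε (ε⁻¹ h²)`, and the second factor centralizes `g`, hence acts on `w` by `s`.
  have e₃ : N.act h (N.act h w) = s • N.act ε w := by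
    rw [act_act, ← pow_two, ← map_smul, hw, ← act_charGen_of_mem g σ _ hs, act_act,
      mul_inv_cancel_left]
  have c₁ : ∀ x, N.act ε (N.act h x) = N.act h (N.act ε x) := fun x => by
    rw [act_act, act_act, hG.relations.2.2.1]
  have c₂ : ∀ x, N.act g (N.act ε x) = N.act ε (N.act ε (N.act ε (N.act g x))) := fun x => by
    simp only [act_act, hG.g_mul_ε]
  have c₃ : ∀ x, N.act g (N.act h x) = N.act ε (N.act ε (N.act ε (N.act h (N.act g x)))) :=
    fun x => by simp only [act_act, hG.rel]
  refine ⟨⟨e₁, ?_, ?_, ?_⟩, ⟨e₃, ?_⟩, c₁ w, e₂, ?_⟩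
  · simp only [c₃, c₁, e₁, e₂, map_neg, map_smul, neg_smul]
  · simp only [c₂, e₁, e₂, map_neg, map_smul, neg_smul]
  · have ht₂ : t * t = 1 := by rw [← pow_two, ← ht, hG.char_ε_sq_sq σ]
    simp only [c₃, c₂, c₁, e₁, e₂, map_neg, map_smul, neg_smul]
    rw [smul_smul, ht₂, one_smul]
  · rw [← c₁, ← c₁, e₃, map_smul, e₂, smul_smul]
  · rw [c₁, e₂, map_smul]

end Modules

/-- The lists `v, g v` and `w, h w, ε w, h ε w` are stable up to scalars under the three generators,
so they span the two modules. Only the parameter `ρ(ε)` is kept visible, because the final condition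
refers to it. -/
theorem exists_gammaFourPair {K G : Type*} [Field K] [Group G] {g h ε : G}
    (hG : IsGammaFourQuotient g h ε)
    (ρ : centralizer h →* Kˣ) (σ : centralizer g →* Kˣ)
    (hρ : ρ ⟨h, IsGammaFourQuotient.self_mem h⟩ = -1)
    (hσ : σ ⟨g, IsGammaFourQuotient.self_mem g⟩ = -1)
    (hρσ : ρ ⟨ε, hG.ε_mem⟩ = ρ ⟨g ^ 2, hG.g_sq_mem⟩ * σ ⟨ε⁻¹ * h ^ 2, hG.ε_inv_h_sq_mem⟩) :
    ∃ (p s t : K) (v₀ v₁ w₀ w₁ w₂ w₃ : IndSpace h (charRep ρ) × IndSpace g (charRep σ)),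
      GammaFourPair ((ofChar h ρ).prod (ofChar g σ)) g h ε (ρ ⟨ε, hG.ε_mem⟩ : K) p s t
        v₀ v₁ w₀ w₁ w₂ w₃ ∧
      LinearMap.range (LinearMap.inl K (IndSpace h (charRep ρ)) (IndSpace g (charRep σ))) =
        Submodule.span K {v₀, v₁} ∧
      LinearMap.range (LinearMap.inr K (IndSpace h (charRep ρ)) (IndSpace g (charRep σ))) =
        Submodule.span K {w₀, w₁, w₂, w₃} := by
  obtain ⟨v, hv⟩ : ∃ v, v = charGen h ρ := ⟨_, rfl⟩
  obtain ⟨w, hw⟩ : ∃ w, w = charGen g σ := ⟨_, rfl⟩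
  have tl := hG.table_left ρ hρ hv rfl rfl
  have tr := hG.table_right σ hσ hw rfl rfl
  have hv₀ : (ofChar h ρ).IsHomogeneous h v := hv ▸ charGen_isHomogeneous h ρ
  have hw₀ : (ofChar g σ).IsHomogeneous g w := hw ▸ charGen_isHomogeneous g σ
  have hl := isHom_inl (ofChar h ρ) (ofChar g σ)
  have hr := isHom_inr (ofChar h ρ) (ofChar g σ)
  have dg : g * h * g⁻¹ = ε * (ε * (ε * h)) := by
    rw [mul_inv_eq_iff_eq_mul]; simp only [mul_assoc, hG.rel]
  have dh : h * g * h⁻¹ = ε * g := by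
    rw [mul_inv_eq_iff_eq_mul]; simp only [mul_assoc, hG.rel]
  have dε : ε * g * ε⁻¹ = ε * (ε * g) := by
    rw [mul_inv_eq_iff_eq_mul]; simp only [mul_assoc, hG.rel]
  have dhε : h * (ε * (ε * g)) * h⁻¹ = ε * (ε * (ε * g)) := by
    rw [mul_inv_eq_iff_eq_mul]; simp only [mul_assoc, hG.rel]
  have hspanl : Submodule.span K {v, (ofChar h ρ).act g v} = ⊤ := by
    refine span_eq_top_of_charGen_mem h ρ hG.closure_eq_top (by simp) (by simp [hv]) ?_
    rintro a (rfl | rfl | rfl) x (rfl | rfl)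
    · exact Submodule.subset_span (by simp)
    · rw [tl.1]; exact Submodule.smul_mem _ _ (Submodule.subset_span (by simp))
    · rw [tl.2.1]; exact neg_mem (Submodule.subset_span (by simp))
    · rw [tl.2.2.1]; exact Submodule.smul_mem _ _ (Submodule.subset_span (by simp))
    · rw [tl.2.2.2.1]; exact Submodule.smul_mem _ _ (Submodule.subset_span (by simp))
    · rw [tl.2.2.2.2]; exact Submodule.smul_mem _ _ (Submodule.subset_span (by simp))
  have hspanr : Submodule.span K {w, (ofChar g σ).act h w, (ofChar g σ).act ε w,
      (ofChar g σ).act h ((ofChar g σ).act ε w)} = ⊤ := by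
    refine span_eq_top_of_charGen_mem g σ hG.closure_eq_top (by simp) (by simp [hw]) ?_
    rintro a (rfl | rfl | rfl) x (rfl | rfl | rfl | rfl)
    · rw [tr.1.1]; exact neg_mem (Submodule.subset_span (by simp))
    · rw [tr.1.2.1]; exact Submodule.smul_mem _ _ (Submodule.subset_span (by simp))
    · rw [tr.1.2.2.1]; exact Submodule.smul_mem _ _ (Submodule.subset_span (by simp))
    · rw [tr.1.2.2.2]; exact Submodule.smul_mem _ _ (Submodule.subset_span (by simp))
    · exact Submodule.subset_span (by simp)
    · rw [tr.2.1.1]; exact Submodule.smul_mem _ _ (Submodule.subset_span (by simp))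
    · exact Submodule.subset_span (by simp)
    · rw [tr.2.1.2]; exact Submodule.smul_mem _ _ (Submodule.subset_span (by simp))
    · exact Submodule.subset_span (by simp)
    · rw [tr.2.2.1]; exact Submodule.subset_span (by simp)
    · rw [tr.2.2.2.1]; exact Submodule.smul_mem _ _ (Submodule.subset_span (by simp))
    · rw [tr.2.2.2.2]; exact Submodule.smul_mem _ _ (Submodule.subset_span (by simp))
  refine ⟨(ρ ⟨g ^ 2, hG.g_sq_mem⟩ : K), (σ ⟨ε⁻¹ * h ^ 2, hG.ε_inv_h_sq_mem⟩ : K),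
    (σ ⟨ε ^ 2, hG.ε_sq_mem_centralizer_g⟩ : K), LinearMap.inl K _ _ v, LinearMap.inl K _ _ ((ofChar h ρ).act g v),
    LinearMap.inr K _ _ w, LinearMap.inr K _ _ ((ofChar g σ).act h w),
    LinearMap.inr K _ _ ((ofChar g σ).act ε w),
    LinearMap.inr K _ _ ((ofChar g σ).act h ((ofChar g σ).act ε w)),
    { closure_eq_top := hG.closure_eq_top
      sq_ne_one := fun e => hG.sq_ne_one ((pow_two ε).trans e)
      h_mul_g := hG.h_mul_g
      g_mul_ε := hG.g_mul_ε
      h_mul_ε := hG.relations.2.2.1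
      ε_pow := hG.ε_pow_four
      r_eq := by rw [hρσ, Units.val_mul]
      r_pow := ?_
      t_sq := hG.char_ε_sq_sq σ
      v₀_ne_zero := fun e => charGen_ne_zero h ρ (hv ▸ LinearMap.inl_injective (e.trans
        (map_zero _).symm))
      w₀_ne_zero := fun e => charGen_ne_zero g σ (hw ▸ LinearMap.inr_injective (e.trans
        (map_zero _).symm))
      v₀_hom := hl.isHomogeneous hv₀
      v₁_hom := hl.isHomogeneous (hv₀.act_of_eq g dg)
      w₀_hom := hr.isHomogeneous hw₀
      w₁_hom := hr.isHomogeneous (hw₀.act_of_eq h dh)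
      w₂_hom := hr.isHomogeneous (hw₀.act_of_eq ε dε)
      w₃_hom := hr.isHomogeneous ((hw₀.act_of_eq ε dε).act_of_eq h dhε)
      table := ?_ }, ?_, ?_⟩
  · rw [← Units.val_pow_eq_pow_val, ← map_pow, Units.val_eq_one]
    convert map_one ρ
    exact Subtype.ext hG.relations.2.2.2
  · simp only [← hl.1, ← hr.1, tl, tr, map_smul, map_neg, and_self]
  · rw [LinearMap.range_eq_map, ← hspanl, Submodule.map_span, Set.image_pair]
  · rw [LinearMap.range_eq_map, ← hspanr, Submodule.map_span]
    simp only [Set.image_insert_eq, Set.image_singleton]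

end IsGammaFourQuotient

/-! ### Assembly of the result -/

theorem proposition5p6 {K : Type*} [Field K] {G : Type*} [Group G] (g h ε : G)
    (hG : IsGammaFourQuotient g h ε) (ρ : centralizer h →* Kˣ) (σ : centralizer g →* Kˣ)
    (hρ : ρ ⟨h, IsGammaFourQuotient.self_mem h⟩ = -1)
    (hσ : σ ⟨g, IsGammaFourQuotient.self_mem g⟩ = -1)
    (hρσ : ρ ⟨ε, hG.ε_mem⟩ = ρ ⟨g ^ 2, hG.g_sq_mem⟩ * σ ⟨ε⁻¹ * h ^ 2, hG.ε_inv_h_sq_mem⟩) :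
    -- with `V = M(h, ρ) = ofChar h ρ` and `W = M(g, σ) = ofChar g σ`
    (((ofChar h ρ).prod (ofChar g σ)).nichols.IsAbsolutelySimpleSub
        ((ofChar h ρ).adLeft (ofChar g σ) 1) ∧
      (ofChar h ρ).adLeft (ofChar g σ) 2 = ⊥) ∧
    ((∀ m : ℕ,
        ((ofChar h ρ).prod (ofChar g σ)).nichols.IsAbsolutelySimpleSub
          ((ofChar h ρ).adRight (ofChar g σ) m) ∨
        (ofChar h ρ).adRight (ofChar g σ) m = ⊥) ↔
      ρ ⟨ε ^ 2, hG.ε_sq_mem⟩ = -1) ∧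
    (ρ ⟨ε ^ 2, hG.ε_sq_mem⟩ = -1 →
      (ofChar h ρ).adRight (ofChar g σ) 2 ≠ ⊥ ∧ (ofChar h ρ).adRight (ofChar g σ) 3 = ⊥) := by

  obtain ⟨p, s, t, v₀, v₁, w₀, w₁, w₂, w₃, D, hP, hQ⟩ :=
    hG.exists_gammaFourPair ρ σ hρ hσ hρσ
  have hPsub := isSub_range (isHom_inl (ofChar h ρ) (ofChar g σ))
  have hQsub := isSub_range (isHom_inr (ofChar h ρ) (ofChar g σ))
  -- The condition on `ρ(ε²)` is an equation of units; it becomes `r² = -1` in the field.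
  have hsq : ρ ⟨ε ^ 2, hG.ε_sq_mem⟩ = -1 ↔ (ρ ⟨ε, hG.ε_mem⟩ : K) ^ 2 = -1 := by
    have : (⟨ε ^ 2, hG.ε_sq_mem⟩ : centralizer h) = ⟨ε, hG.ε_mem⟩ ^ 2 := rfl
    rw [this, map_pow, Units.ext_iff]
    simp
  rw [hsq]
  exact ⟨⟨D.isAbsolutelySimpleSub_adPow_one_left hPsub hQsub hP hQ, D.adPow_two_left hP hQ⟩,
    D.forall_isAbsolutelySimpleSub_or_eq_bot_iff hPsub hQsub hP hQ, fun hr =>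
      ⟨D.adPow_two_right_ne_bot hP hQ, D.adPow_three_right_of_sq hr hP hQ⟩⟩
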